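/- \textbf{Model.} Fix $0\le \underline x<\bar x<\infty$, $\tau>0$, and cost functions $c_A,c_P:[0,1]\to\mathbb R$ that are thrice differentiable (one-sided at the endpoints), strictly increasing and strictly convex, with $c_A(0)=c_P(0)=c_A'(0)=c_P'(0)=0$. Let $u_A(e)=e\,c_A'(e)-c_A(e)$. Assume (i) $\tau\ge c_A'(1)>c_P(1)$; (ii) for all $e\in[0,1]$, $\frac{\underline x+\tau}{c_P'(1)}+e>e(1-e)\frac{c_A'''(e)}{c_A''(e)}+1-e$ (a quotient with $c_A''(e)=0$ is read as $0$); (iii) $e\mapsto e\,c_A'(e)$ is strictly convex on $[0,1]$. The type distribution $F$ is a probability measure on $\mathbb R$ whose support has minimum $\underline x$ and maximum $\bar x$. \textbf{Mechanisms.} A mechanism $m$ consists of functions $(e_A,e_P,r_A,r_P,r_\emptyset)$ on $[\underline x,\bar x]$ with $e_A(y),e_P(y)\in[0,1]$ and $r_A(y),r_P(y),r_\emptyset(y)\in[0,y+\tau]$. Let $R_{NA}=e_Pr_P+(1-e_P)r_\emptyset$; the evidence rent is $\rho=e_A\,(r_A-R_{NA})-c_A(e_A)$ (it equals $u_A(e_A)$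 whenever $e_A<1$ is optimal for the agent), and $$U_m=R_{NA}+\rho,\qquad \Pi_m(x)=x-R_{NA}(x)-\rho(x)-c_A(e_A(x))-(1-e_A(x))\,c_P(e_P(x)),$$ $$\lambda_m(x)=\inf_{y\in[\underline x,x]} e_P(y)x+(1-e_P(y))(y-r_\emptyset(y)).$$ A mechanism is required to be incentive compatible: for all $x$, $e_A(x)$ maximizes $\tilde e\,(r_A(x)-R_{NA}(x))-c_A(\tilde e)$ over $\tilde e\in[0,1]$, and $U_m(x)\ge x-\lambda_m(x)$. The mechanism $m$ is \emph{tight} if every mechanism $m'$ with $\Pi_m\le\Pi_{m'}$ and $\lambda_m\le\lambda_{m'}$ pointwise on $[\underline x,\bar x]$ satisfies $(\Pi_{m'},\lambda_{m'})=(\Pi_m,\lambda_m)$. It is \emph{optimal} if its profit is $F$-measurable and it maximizes $\int\Pi_m\,dF$ among all mechanisms with $F$-measurable profit. \textbf{Global concavity.} Let $\Lambda$ be the set of increasing concave $\lambda:[\underline x,\bar x]\to\mathbb R$ with $\lambda(\underline x)=\underline x$ and $\lambda\le\mathrm{id}$. For $\lambda\in\Lambda$ let $\alpha_\lambda(y)=\max\{0,\sup_{x\in(y,\bar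 x]}\frac{\lambda(x)-y}{x-y}\}$ for $y<\bar x$, $\alpha_\lambda(\bar x)=0$, let $\beta_\lambda(y,e)=\max\{0,\max_{x\in[\underline x,\bar x]}\frac{\lambda(x)-\lambda(y)-u_A(e)}{x+\tau}\}$, and let $\underline\pi(y,e,\lambda)$ be the minimum of $y-u_A(e)-c_A(e)-(1-e)c_P(\alpha_\lambda(y))$, $\lambda(y)-c_A(e)-(1-e)c_P(\alpha_\lambda(y))$ and $\lambda(y)-c_A(e)-(1-e)c_P(\beta_\lambda(y,e))$. Global concavity means that there is $\bar e_A\in[0,1]$ such that for all $y\in[\underline x,\bar x]$: every maximizer of $\underline\pi(y,\cdot,\lambda)$ on $[0,1]$, for every $\lambda\in\Lambda$, is at most $\bar e_A$; and $(e,\lambda)\mapsto\underline\pi(y,e,\lambda)$ is concave on $[0,\bar e_A]\times\Lambda$. \textbf{Intervals and impacts.} For a tight mechanism $m$ put $\lambda=\lambda_m$, $d_1(y)=y-u_A(e_A(y))-\lambda(y)$ and $d_2(y)=(1-\alpha_\lambda(y))y-u_A(e_A(y))-\lambda(y)-\alpha_\lambda(y)\tau$. The set of $y\in[\underline x,\bar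 x]$ with $e_P(y)\in(0,1)$ is divided into SuperLow ($d_1<0$), Low ($d_2<0=d_1$), Middle ($d_2<0<d_1$), High ($d_2=0<d_1$) and SuperHigh ($0<d_2$). The binding IC correspondence is $$\hat X(y)=\{x\in[y,\bar x]:\lambda_m(x)=e_P(y)x+(1-e_P(y))(y-r_\emptyset(y))\}.$$ Given a selection $\hat x$, let $D(y)=\frac{c_A'(e_A(y))-c_P(e_P(y))}{u_A'(e_A(y))}$, and with $K(y)=(1-e_A(y))\,c_P'(e_P(y))$ let $$I(y)=\begin{cases}\frac{K(y)}{\hat x(y)-y},& y\in \text{SuperLow}\cup\text{Low}\cup\text{Middle},\\ \frac{K(y)}{\hat x(y)-y}-\frac{y+\tau}{\hat x(y)-y}D(y),& y\in\text{High},\\ \frac{K(y)}{\hat x(y)+\tau},& y\in\text{SuperHigh}.\end{cases}$$ \textbf{Theorem.} Suppose $F$ is absolutely continuous with full support $[\underline x,\bar x]$ and global concavity holds. Let $m$ be a tight mechanism with $e_P(y)\in(0,1)$ for all $y\in[\underline x,\bar x)$. Suppose there is a continuous, strictly increasing $\hat x:(\underline x,\bar x)\to(\underline x,\bar x)$ with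 $\hat x(y)\in\hat X(y)$ for all $y$, with $\inf_{y\in(\underline x,\bar x)}\hat x(y)=\sup\text{SuperLow}$, and such that $$\int_{[a,b]}I\,dF=\int_{[\hat x(a),\hat x(b)]}(1+D)\,dF\quad\text{for all }[a,b]\subset(\underline x,\bar x),$$ $D=-1$ on SuperLow, $D=0$ on Middle, and $D=I$ on SuperHigh. Then $m$ is optimal. -/

import Mathlib

open Set MeasureTheory

noncomputable section

/-- Derivative of a function on the unit interval `[0, 1]` (one-sided at the endpoints). -/
def dUnit (c : ℝ → ℝ) : ℝ → ℝ := derivWithin c (Icc 0 1)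

/-- A cost function on `[0, 1]`: thrice differentiable, strictly increasing, strictly convex,
with `c 0 = c' 0 = 0`. -/
structure IsEvidenceCost (c : ℝ → ℝ) : Prop where
  differentiable_one : DifferentiableOn ℝ c (Icc 0 1)
  differentiable_two : DifferentiableOn ℝ (dUnit c) (Icc 0 1)
  differentiable_three : DifferentiableOn ℝ (dUnit (dUnit c)) (Icc 0 1)
  strictMono : StrictMonoOn c (Icc 0 1)
  strictConvex : StrictConvexOn ℝ (Icc 0 1) c
  zero : c 0 = 0
  deriv_zero : dUnit c 0 = 0

/-- The primitives: the lowest and highest type, the principal's funds `τ`, the agent's and the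
principal's evidence costs (only their values on `[0, 1]` matter), and the type distribution. -/
structure TaxModel where
  xlo : ℝ
  xhi : ℝ
  τ : ℝ
  cA : ℝ → ℝ
  cP : ℝ → ℝ
  F : Measure ℝ

/-- A tax mechanism `(e_A, e_P, r_A, r_P, r_∅)`; only the values on the type space matter. -/
structure TaxMechanism where
  eA : ℝ → ℝ
  eP : ℝ → ℝ
  rA : ℝ → ℝ
  rP : ℝ → ℝ
  rN : ℝ → ℝ

namespace TaxModel

/-- The type space `[xlo, xhi]`. -/
def types (M : TaxModel) : Set ℝ := Icc M.xlo M.xhi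

/-- `u_A(e) = e c_A'(e) - c_A(e)`. -/
def uA (M : TaxModel) (e : ℝ) : ℝ := e * dUnit M.cA e - M.cA e

/-- The standing assumptions of the model. -/
structure StandingAssumptions (M : TaxModel) : Prop where
  xlo_nonneg : 0 ≤ M.xlo
  xlo_lt_xhi : M.xlo < M.xhi
  tau_pos : 0 < M.τ
  isProbability : IsProbabilityMeasure M.F
  min_support : IsLeast M.F.support M.xlo
  max_support : IsGreatest M.F.support M.xhi
  costA : IsEvidenceCost M.cA
  costP : IsEvidenceCost M.cP
  budget : dUnit M.cA 1 ≤ M.τ ∧ M.cP 1 < dUnit M.cA 1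
  regularity : ∀ e ∈ Icc (0 : ℝ) 1,
    (M.xlo + M.τ) / dUnit M.cP 1 + e
      > e * (1 - e) * (dUnit (dUnit (dUnit M.cA)) e / dUnit (dUnit M.cA) e) + (1 - e)
  rent_regularity : StrictConvexOn ℝ (Icc 0 1) (fun e => e * dUnit M.cA e)

/-! ### Mechanisms -/

/-- Expected refund when the agent provides no evidence. -/
def RNA (m : TaxMechanism) (x : ℝ) : ℝ := m.eP x * m.rP x + (1 - m.eP x) * m.rN x

/-- Evidence rent of type `x`: the extra refund net of effort costs. -/
def evidenceRent (M : TaxModel) (m : TaxMechanism) (x : ℝ) : ℝ :=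
  m.eA x * (m.rA x - RNA m x) - M.cA (m.eA x)

/-- Interim utility of type `x` from advancing the full surplus. -/
def utility (M : TaxModel) (m : TaxMechanism) (x : ℝ) : ℝ := RNA m x + M.evidenceRent m x

/-- The principal's profit from type `x`. -/
def profit (M : TaxModel) (m : TaxMechanism) (x : ℝ) : ℝ :=
  x - RNA m x - M.evidenceRent m x - M.cA (m.eA x) - (1 - m.eA x) * M.cP (m.eP x)

/-- Expected loss of type `x` from advancing only `y`. -/
def deviationLoss (m : TaxMechanism) (y x : ℝ) : ℝ := m.eP y * x + (1 - m.eP y) * (y - m.rN y)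

/-- The loss function of a mechanism: the infimum of the losses over `y ∈ [xlo, x]`. -/
def loss (M : TaxModel) (m : TaxMechanism) (x : ℝ) : ℝ :=
  sInf ((fun y => deviationLoss m y x) '' Icc M.xlo x)

def IsFeasible (M : TaxModel) (m : TaxMechanism) : Prop :=
  ∀ y ∈ M.types, m.eA y ∈ Icc (0 : ℝ) 1 ∧ m.eP y ∈ Icc (0 : ℝ) 1 ∧
    m.rA y ∈ Icc 0 (y + M.τ) ∧ m.rP y ∈ Icc 0 (y + M.τ) ∧ m.rN y ∈ Icc 0 (y + M.τ)

/-- Incentive compatibility: the recommended effort is optimal for the agent, and advancing the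
full surplus is at least as good as the best deviation. -/
def IsIC (M : TaxModel) (m : TaxMechanism) : Prop :=
  (∀ x ∈ M.types,
    IsMaxOn (fun e => e * (m.rA x - RNA m x) - M.cA e) (Icc 0 1) (m.eA x)) ∧
  ∀ x ∈ M.types, x - M.loss m x ≤ M.utility m x

/-- A mechanism in the sense of the text: feasible and incentive compatible. -/
def IsMechanism (M : TaxModel) (m : TaxMechanism) : Prop := M.IsFeasible m ∧ M.IsIC m

/-- As long as the agent's effort is below one, the evidence rent of a mechanism is `u_A(e_A)`. -/
theorem evidenceRent_eq_uA {M : TaxModel} (hM : M.StandingAssumptions) {m : TaxMechanism}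
    (hm : M.IsMechanism m) {x : ℝ} (hx : x ∈ M.types) (h1 : m.eA x < 1) :
    M.evidenceRent m x = M.uA (m.eA x) := by
  have h0 : 0 ≤ m.eA x := (hm.1 x hx).1.1
  rcases h0.eq_or_lt with h | h
  · simp [evidenceRent, uA, ← h]
  · have hnhds : Icc (0 : ℝ) 1 ∈ nhds (m.eA x) := Icc_mem_nhds h h1
    have hd : HasDerivAt M.cA (dUnit M.cA (m.eA x)) (m.eA x) :=
      ((hM.costA.differentiable_one _ ⟨h.le, h1.le⟩).hasDerivWithinAt).hasDerivAt hnhds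
    have hf := ((hasDerivAt_id (m.eA x)).mul_const (m.rA x - RNA m x)).sub hd
    have hz := ((hm.2.1 x hx).isLocalMax hnhds).hasDerivAt_eq_zero hf
    have : m.rA x - RNA m x = dUnit M.cA (m.eA x) := by linarith
    simp [evidenceRent, uA, this]

/-- `m'` is tighter than `m`. -/
def IsTighter (M : TaxModel) (m' m : TaxMechanism) : Prop :=
  ∀ x ∈ M.types, M.profit m x ≤ M.profit m' x ∧ M.loss m x ≤ M.loss m' x

/-- `m` is tight: it is tighter than every mechanism that is tighter than `m`. -/
def IsTight (M : TaxModel) (m : TaxMechanism) : Prop :=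
  M.IsMechanism m ∧ ∀ m', M.IsMechanism m' → M.IsTighter m' m → M.IsTighter m m'

/-- `m` is optimal: it maximizes the expected profit across all mechanisms with measurable
profit. (The profit of a mechanism is bounded on the type space, hence integrable.) -/
def IsOptimal (M : TaxModel) (m : TaxMechanism) : Prop :=
  M.IsMechanism m ∧ AEMeasurable (M.profit m) M.F ∧
    ∀ m', M.IsMechanism m' → AEMeasurable (M.profit m') M.F →
      ∫ x, M.profit m' x ∂M.F ≤ ∫ x, M.profit m x ∂M.F

/-! ### Auxiliary profits and the global concavity assumption -/

/-- The set `Λ` of increasing concave `l` on the type space with `l xlo = xlo` and `l ≤ id`. -/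
def Lam (M : TaxModel) : Set (ℝ → ℝ) :=
  {l | MonotoneOn l M.types ∧ ConcaveOn ℝ M.types l ∧ l M.xlo = M.xlo ∧ ∀ x ∈ M.types, l x ≤ x}

def alpha (M : TaxModel) (l : ℝ → ℝ) (y : ℝ) : ℝ :=
  if y < M.xhi then max 0 (sSup ((fun x => (l x - y) / (x - y)) '' Ioc y M.xhi)) else 0

def beta (M : TaxModel) (l : ℝ → ℝ) (y e : ℝ) : ℝ :=
  max 0 (sSup ((fun x => (l x - l y - M.uA e) / (x + M.τ)) '' M.types))

def pi1 (M : TaxModel) (l : ℝ → ℝ) (y e : ℝ) : ℝ :=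
  y - M.uA e - M.cA e - (1 - e) * M.cP (M.alpha l y)

def pi2 (M : TaxModel) (l : ℝ → ℝ) (y e : ℝ) : ℝ :=
  l y - M.cA e - (1 - e) * M.cP (M.alpha l y)

def pi3 (M : TaxModel) (l : ℝ → ℝ) (y e : ℝ) : ℝ :=
  l y - M.cA e - (1 - e) * M.cP (M.beta l y e)

/-- The pointwise minimum of the three auxiliary profits. -/
def piMin (M : TaxModel) (l : ℝ → ℝ) (y e : ℝ) : ℝ :=
  min (M.pi1 l y e) (min (M.pi2 l y e) (M.pi3 l y e))

/-- Global concavity: there is a bound on the maximizing agent efforts such that below this bound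
`(e, l) ↦ piMin l y e` is jointly concave. -/
def GlobalConcavity (M : TaxModel) : Prop :=
  ∃ ebar ∈ Icc (0 : ℝ) 1,
    (∀ y ∈ M.types, ∀ l ∈ M.Lam, ∀ e ∈ Icc (0 : ℝ) 1,
      IsMaxOn (M.piMin l y) (Icc 0 1) e → e ≤ ebar) ∧
    ∀ y ∈ M.types, ConcaveOn ℝ (Icc 0 ebar ×ˢ M.Lam)
      (fun p : ℝ × (ℝ → ℝ) => M.piMin p.2 y p.1)

/-! ### The five intervals of a mechanism -/

/-- The types with interior principal effort. -/
def interiorAudit (M : TaxModel) (m : TaxMechanism) : Set ℝ :=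
  {y ∈ M.types | m.eP y ∈ Ioo (0 : ℝ) 1}

/-- `d₁(y, e_A(y))`. -/
def d1 (M : TaxModel) (m : TaxMechanism) (y : ℝ) : ℝ :=
  y - M.uA (m.eA y) - M.loss m y

/-- `d₂(y, e_A(y))`. -/
def d2 (M : TaxModel) (m : TaxMechanism) (y : ℝ) : ℝ :=
  (1 - M.alpha (M.loss m) y) * y - M.uA (m.eA y) - M.loss m y - M.alpha (M.loss m) y * M.τ

def SuperLow (M : TaxModel) (m : TaxMechanism) : Set ℝ :=
  {y ∈ M.interiorAudit m | M.d1 m y < 0}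

def Low (M : TaxModel) (m : TaxMechanism) : Set ℝ :=
  {y ∈ M.interiorAudit m | M.d2 m y < 0 ∧ M.d1 m y = 0}

def Middle (M : TaxModel) (m : TaxMechanism) : Set ℝ :=
  {y ∈ M.interiorAudit m | M.d2 m y < 0 ∧ 0 < M.d1 m y}

def High (M : TaxModel) (m : TaxMechanism) : Set ℝ :=
  {y ∈ M.interiorAudit m | M.d2 m y = 0 ∧ 0 < M.d1 m y}

def SuperHigh (M : TaxModel) (m : TaxMechanism) : Set ℝ :=
  {y ∈ M.interiorAudit m | 0 < M.d2 m y}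

/-! ### Binding incentive constraints and impacts -/

/-- The binding IC correspondence: types `x ≥ y` whose best deviation is to `y`. -/
def bindingIC (M : TaxModel) (m : TaxMechanism) (y : ℝ) : Set ℝ :=
  {x ∈ Icc y M.xhi | M.loss m x = deviationLoss m y x}

/-- The direct impact `D`. -/
def directImpact (M : TaxModel) (m : TaxMechanism) (y : ℝ) : ℝ :=
  (dUnit M.cA (m.eA y) - M.cP (m.eP y)) / dUnit M.uA (m.eA y)

open Classical in
/-- The indirect impact `I`; the last branch is the one for `y ∈ SuperHigh`, since the five
intervals of a tight mechanism partition the types with interior principal effort. -/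
def indirectImpact (M : TaxModel) (m : TaxMechanism) (xhat : ℝ → ℝ) (y : ℝ) : ℝ :=
  if y ∈ M.SuperLow m ∪ M.Low m ∪ M.Middle m then
    (1 - m.eA y) * dUnit M.cP (m.eP y) / (xhat y - y)
  else if y ∈ M.High m then
    (1 - m.eA y) * dUnit M.cP (m.eP y) / (xhat y - y)
      - (y + M.τ) / (xhat y - y) * M.directImpact m y
  else
    (1 - m.eA y) * dUnit M.cP (m.eP y) / (xhat y + M.τ)

/-- A continuous, strictly increasing selection `(xlo, xhi) → (xlo, xhi)` from the binding IC
correspondence. -/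
structure IsBindingSelection (M : TaxModel) (m : TaxMechanism) (xhat : ℝ → ℝ) : Prop where
  mapsTo : MapsTo xhat (Ioo M.xlo M.xhi) (Ioo M.xlo M.xhi)
  continuousOn : ContinuousOn xhat (Ioo M.xlo M.xhi)
  strictMonoOn : StrictMonoOn xhat (Ioo M.xlo M.xhi)
  binding : ∀ y ∈ Ioo M.xlo M.xhi, xhat y ∈ M.bindingIC m y

end TaxModel

end

/-! The problem reduces to comparing loss functions. Let `l'` be the least increasing concave
majorant of the loss of a rival `m'`. Then `m'` earns at most `piMin l' y e` from type `y`, where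
`e` is its effort there (`IsLamHull.profit_le`). Conversely, every `l` in `Λ` and every effort
function can be implemented at profit at least `piMin` (`exists_mechanism`). A tight `m` therefore
has its loss in `Λ`, earns exactly `piMin`, and its effort maximizes `piMin`.

By joint concavity, the gain of `m'` over `m` at `y` is at most a directional derivative of `piMin`
at `m`, towards `l'` and a maximizing effort for it. Freezing the tangency point at `xhat y` turns
the audit probability into a smooth function that bounds it from below. Stationarity of `e_A`
removes the effort term, and with `φ` the difference of the two losses the bound becomes `(1 + D(y))
φ(y) - I(y) φ(xhat y)` (`IsImpactSelection.impactBounds`). Where two auxiliary profits tie (Low,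
High), the impact `D` supplies the weights of a convex combination of their two derivative bounds.
On High this can fail only at countably many types, a null set.

The balance condition says that `xhat` pushes `I dF` forward to `(1 + D) dF` above the infimum of
`xhat` (`map_withDensity_eq`). Below that infimum all types are SuperLow, where `1 + D = 0`. Hence
the integral of the bound is zero and no rival earns more.

The integrals require a measurable `e_A`. This follows from uniqueness of the maximizing effort
(`eq_of_isMaxOn_piMin`), which rests on the regularity conditions (ii) and (iii). -/

namespace IsEvidenceCost

/-! ### Calculus of evidence costs. -/

variable {c : ℝ → ℝ}

theorem hasDeriv (h : IsEvidenceCost c) {e : ℝ} (he : e ∈ Icc (0 : ℝ) 1) :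
    HasDerivWithinAt c (dUnit c e) (Icc 0 1) e :=
  (h.differentiable_one e he).hasDerivWithinAt

theorem hasDeriv_two (h : IsEvidenceCost c) {e : ℝ} (he : e ∈ Icc (0 : ℝ) 1) :
    HasDerivWithinAt (dUnit c) (dUnit (dUnit c) e) (Icc 0 1) e :=
  (h.differentiable_two e he).hasDerivWithinAt

theorem hasDeriv_three (h : IsEvidenceCost c) {e : ℝ} (he : e ∈ Icc (0 : ℝ) 1) :
    HasDerivWithinAt (dUnit (dUnit c)) (dUnit (dUnit (dUnit c)) e) (Icc 0 1) e :=
  (h.differentiable_three e he).hasDerivWithinAt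

theorem strictMono_deriv (h : IsEvidenceCost c) : StrictMonoOn (dUnit c) (Icc 0 1) :=
  h.strictConvex.strictMonoOn_derivWithin h.differentiable_one

theorem tangent_le (h : IsEvidenceCost c) {e e' : ℝ} (he : e ∈ Icc (0 : ℝ) 1)
    (he' : e' ∈ Icc (0 : ℝ) 1) : c e + dUnit c e * (e' - e) ≤ c e' := by
  rcases lt_trichotomy e e' with hlt | rfl | hlt
  · have := h.strictConvex.convexOn.derivWithin_le_slope he he' hlt (h.differentiable_one e he)
    rw [slope_def_field, le_div_iff₀ (by linarith)] at this
    change dUnit c e * (e' - e) ≤ _ at this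
    linarith
  · simp
  · have := h.strictConvex.convexOn.slope_le_derivWithin he' he hlt (h.differentiable_one e he)
    rw [slope_def_field, div_le_iff₀ (by linarith)] at this
    change _ ≤ dUnit c e * (e - e') at this
    linarith

theorem deriv_nonneg (h : IsEvidenceCost c) {e : ℝ} (he : e ∈ Icc (0 : ℝ) 1) :
    0 ≤ dUnit c e := by
  have := h.strictMono_deriv.monotoneOn (left_mem_Icc.2 zero_le_one) he he.1
  rwa [h.deriv_zero] at this

theorem nonneg (h : IsEvidenceCost c) {e : ℝ} (he : e ∈ Icc (0 : ℝ) 1) : 0 ≤ c e := by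
  have := h.strictMono.monotoneOn (left_mem_Icc.2 zero_le_one) he he.1
  rwa [h.zero] at this

theorem pos (h : IsEvidenceCost c) {e : ℝ} (he : e ∈ Ioc (0 : ℝ) 1) : 0 < c e := by
  have := h.strictMono (left_mem_Icc.2 zero_le_one) (Ioc_subset_Icc_self he) he.1
  rwa [h.zero] at this

theorem deriv_pos (h : IsEvidenceCost c) {e : ℝ} (he : e ∈ Ioc (0 : ℝ) 1) : 0 < dUnit c e := by
  have := h.strictMono_deriv (left_mem_Icc.2 zero_le_one) (Ioc_subset_Icc_self he) he.1
  rwa [h.deriv_zero] at this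

theorem deriv_two_nonneg (h : IsEvidenceCost c) (e : ℝ) : 0 ≤ dUnit (dUnit c) e :=
  h.strictMono_deriv.monotoneOn.derivWithin_nonneg

theorem monotone (h : IsEvidenceCost c) {e e' : ℝ} (h0 : 0 ≤ e) (h1 : e ≤ e') (h2 : e' ≤ 1) :
    c e ≤ c e' :=
  h.strictMono.monotoneOn ⟨h0, h1.trans h2⟩ ⟨h0.trans h1, h2⟩ h1

theorem continuousOn (h : IsEvidenceCost c) : ContinuousOn c (Icc 0 1) :=
  h.differentiable_one.continuousOn

/-- On every nondegenerate subinterval the second derivative is somewhere nonzero. -/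
theorem exists_deriv_two_ne_zero (h : IsEvidenceCost c) {a b : ℝ} (ha : 0 ≤ a) (hab : a < b)
    (hb : b ≤ 1) : ∃ e ∈ Ioo a b, dUnit (dUnit c) e ≠ 0 := by
  have hsub : Icc a b ⊆ Icc 0 1 := Icc_subset_Icc ha hb
  obtain ⟨e, he, heq⟩ := exists_hasDerivAt_eq_slope (dUnit c) (dUnit (dUnit c)) hab
    (h.differentiable_two.continuousOn.mono hsub) (fun x hx =>
      (h.hasDeriv_two (hsub (Ioo_subset_Icc_self hx))).hasDerivAt
        (Icc_mem_nhds (ha.trans_lt hx.1) (hx.2.trans_le hb)))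
  refine ⟨e, he, ?_⟩
  rw [heq]
  have := h.strictMono_deriv (hsub (left_mem_Icc.2 hab.le)) (hsub (right_mem_Icc.2 hab.le)) hab
  exact (div_pos (by linarith) (by linarith)).ne'

end IsEvidenceCost

/-! ### The agent's rent `u_A`. -/

namespace TaxModel

variable {M : TaxModel}

section Rent

theorem uA_hasDeriv (hM : M.StandingAssumptions) {e : ℝ} (he : e ∈ Icc (0 : ℝ) 1) :
    HasDerivWithinAt M.uA (e * dUnit (dUnit M.cA) e) (Icc 0 1) e := by
  have := ((hasDerivWithinAt_id e (Icc (0 : ℝ) 1)).mul (hM.costA.hasDeriv_two he)).sub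
    (hM.costA.hasDeriv he)
  refine this.congr_deriv ?_
  simp

theorem dUnit_uA (hM : M.StandingAssumptions) {e : ℝ} (he : e ∈ Icc (0 : ℝ) 1) :
    dUnit M.uA e = e * dUnit (dUnit M.cA) e :=
  (uA_hasDeriv hM he).derivWithin (uniqueDiffOn_Icc zero_lt_one e he)

theorem uA_continuousOn (hM : M.StandingAssumptions) : ContinuousOn M.uA (Icc 0 1) :=
  fun _ he => (uA_hasDeriv hM he).continuousWithinAt

theorem uA_zero (hM : M.StandingAssumptions) : M.uA 0 = 0 := by
  simp [uA, hM.costA.zero]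

theorem uA_monotoneOn (hM : M.StandingAssumptions) : MonotoneOn M.uA (Icc 0 1) := by
  intro a ha b hb hab
  have h1 := hM.costA.tangent_le hb ha
  have h2 := hM.costA.strictMono_deriv.monotoneOn ha hb hab
  have h3 := mul_le_mul_of_nonneg_left h2 ha.1
  simp only [uA]
  linarith

theorem uA_nonneg (hM : M.StandingAssumptions) {e : ℝ} (he : e ∈ Icc (0 : ℝ) 1) :
    0 ≤ M.uA e := by
  have := uA_monotoneOn hM (left_mem_Icc.2 zero_le_one) he he.1
  rwa [uA_zero hM] at this

/-- The tangents at `e` and at `e / 2` bound `c_A(e)` by the average of `e c_A'(e)` and `e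
c_A'(e/2)`, and `c_A'` is strictly increasing. -/
theorem uA_pos (hM : M.StandingAssumptions) {e : ℝ} (he : e ∈ Ioc (0 : ℝ) 1) : 0 < M.uA e := by
  have hh : e / 2 ∈ Icc (0 : ℝ) 1 := ⟨by linarith [he.1], by linarith [he.1, he.2]⟩
  have he' : e ∈ Icc (0 : ℝ) 1 := Ioc_subset_Icc_self he
  have h1 := hM.costA.tangent_le he' hh
  have h2 := hM.costA.strictMono_deriv hh he' (by linarith [he.1])
  have h3 := hM.costA.tangent_le hh (left_mem_Icc.2 zero_le_one)
  rw [hM.costA.zero] at h3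
  have h4 := mul_lt_mul_of_pos_left h2 (show 0 < e / 2 by linarith [he.1])
  simp only [uA]
  linarith

/-- The derivative of `e c_A'(e)`. -/
theorem marginal_strictMono (hM : M.StandingAssumptions) :
    StrictMonoOn (fun e => dUnit M.cA e + dUnit M.uA e) (Icc 0 1) := by
  have hd : ∀ e ∈ Icc (0 : ℝ) 1, HasDerivWithinAt (fun e => e * dUnit M.cA e)
      (dUnit M.cA e + dUnit M.uA e) (Icc 0 1) e := by
    intro e he
    rw [dUnit_uA hM he]
    have := (hasDerivWithinAt_id e (Icc (0 : ℝ) 1)).mul (hM.costA.hasDeriv_two he)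
    exact this.congr_deriv (by simp)
  have := hM.rent_regularity.strictMonoOn_derivWithin fun e he => (hd e he).differentiableWithinAt
  refine this.congr fun e he => (hd e he).derivWithin (uniqueDiffOn_Icc zero_lt_one e he)

theorem dUnit_uA_nonneg (hM : M.StandingAssumptions) {e : ℝ} (he : e ∈ Icc (0 : ℝ) 1) :
    0 ≤ dUnit M.uA e := by
  rw [dUnit_uA hM he]
  exact mul_nonneg he.1 (hM.costA.deriv_two_nonneg e)

/-- The left side is the tangent at `e` evaluated at `1`, so it is at most `c_A(1) ≤ c_A'(1) ≤ τ`.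
It keeps the constructed refund `r_A` within the budget. -/
theorem cA_one_le (hM : M.StandingAssumptions) {e : ℝ} (he : e ∈ Icc (0 : ℝ) 1) :
    M.cA e + (1 - e) * dUnit M.cA e ≤ M.τ := by
  have h1 := hM.costA.tangent_le he (right_mem_Icc.2 zero_le_one)
  have h2 := hM.costA.tangent_le (right_mem_Icc.2 zero_le_one) (left_mem_Icc.2 zero_le_one)
  rw [hM.costA.zero] at h2
  linarith [hM.budget.1]

end Rent

/-! ### The audit probabilities `alpha` and `beta`, and continuity of `piMin`. -/

section Bounds

variable {l : ℝ → ℝ}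

theorem lo_mem (hM : M.StandingAssumptions) : M.xlo ∈ M.types := left_mem_Icc.2 hM.xlo_lt_xhi.le

theorem hi_mem (hM : M.StandingAssumptions) : M.xhi ∈ M.types := right_mem_Icc.2 hM.xlo_lt_xhi.le

theorem types_nonneg (hM : M.StandingAssumptions) {x : ℝ} (hx : x ∈ M.types) : 0 ≤ x :=
  hM.xlo_nonneg.trans hx.1

theorem add_tau_pos (hM : M.StandingAssumptions) {x : ℝ} (hx : x ∈ M.types) : 0 < x + M.τ := by
  linarith [types_nonneg hM hx, hM.tau_pos]

theorem Lam.lo_le (hM : M.StandingAssumptions) (hl : l ∈ M.Lam) {x : ℝ} (hx : x ∈ M.types) :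
    M.xlo ≤ l x := by
  have := hl.1 (lo_mem hM) hx hx.1
  rwa [hl.2.2.1] at this

theorem alpha_nonneg (l : ℝ → ℝ) (y : ℝ) : 0 ≤ M.alpha l y := by
  unfold alpha; split_ifs
  · exact le_max_left _ _
  · exact le_rfl

/-- With `le_alpha_line`: `alpha` is the least nonnegative slope of a line through `(y, y)` that
stays above `l` to the right of `y`. -/
theorem alpha_le_of_forall {y p : ℝ} (hp : 0 ≤ p)
    (h : ∀ x ∈ Ioc y M.xhi, l x ≤ y + p * (x - y)) : M.alpha l y ≤ p := by
  unfold alpha; split_ifs with hy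
  · refine max_le hp (csSup_le ((nonempty_Ioc.2 hy).image _) ?_)
    rintro _ ⟨x, hx, rfl⟩
    change (l x - y) / (x - y) ≤ p
    rw [div_le_iff₀ (by linarith [hx.1])]
    linarith [h x hx]
  · exact hp

theorem le_alpha_line {y x : ℝ} (hy : y ∈ M.types) (hl : ∀ x ∈ M.types, l x ≤ x)
    (hx : x ∈ Icc y M.xhi) : l x ≤ y + M.alpha l y * (x - y) := by
  rcases hx.1.eq_or_lt with rfl | hlt
  · simpa using hl y hy
  · have hyx : y < M.xhi := hlt.trans_le hx.2
    have : (l x - y) / (x - y) ≤ M.alpha l y := by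
      unfold alpha
      rw [if_pos hyx]
      refine le_max_of_le_right (le_csSup ⟨1, ?_⟩ ⟨x, ⟨hlt, hx.2⟩, rfl⟩)
      rintro _ ⟨z, hz, rfl⟩
      change (l z - y) / (z - y) ≤ 1
      rw [div_le_one (by linarith [hz.1])]
      linarith [hl z ⟨hy.1.trans hz.1.le, hz.2⟩]
    rw [div_le_iff₀ (by linarith)] at this
    linarith

theorem alpha_le_one {y : ℝ} (hy : y ∈ M.types) (hl : ∀ x ∈ M.types, l x ≤ x) :
    M.alpha l y ≤ 1 :=
  alpha_le_of_forall zero_le_one fun x hx => by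
    linarith [hl x ⟨hy.1.trans hx.1.le, hx.2⟩]

theorem alpha_antitoneOn (hl : ∀ x ∈ M.types, l x ≤ x) : AntitoneOn (M.alpha l) M.types := by
  intro a ha b hb hab
  refine alpha_le_of_forall (alpha_nonneg l a) fun x hx => ?_
  have h1 := le_alpha_line ha hl ⟨hab.trans hx.1.le, hx.2⟩
  have h2 := alpha_le_one ha hl
  nlinarith

theorem beta_nonneg (l : ℝ → ℝ) (y e : ℝ) : 0 ≤ M.beta l y e := le_max_left _ _

/-- With `le_beta_line`: `beta` is the least nonnegative slope of a line through the pivot `(-τ, l y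
+ u_A(e))` that stays above `l` on the type space. -/
theorem beta_le_of_forall (hM : M.StandingAssumptions) {y e p : ℝ} (hp : 0 ≤ p)
    (h : ∀ x ∈ M.types, l x - l y - M.uA e ≤ p * (x + M.τ)) : M.beta l y e ≤ p := by
  refine max_le hp (csSup_le (Set.Nonempty.image _ ⟨_, lo_mem hM⟩) ?_)
  rintro _ ⟨x, hx, rfl⟩
  change (l x - l y - M.uA e) / (x + M.τ) ≤ p
  rw [div_le_iff₀ (add_tau_pos hM hx)]
  exact h x hx

theorem le_beta_line (hM : M.StandingAssumptions) (hl : l ∈ M.Lam) {y e x : ℝ}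
    (hy : y ∈ M.types) (he : e ∈ Icc (0 : ℝ) 1) (hx : x ∈ M.types) :
    l x - l y - M.uA e ≤ M.beta l y e * (x + M.τ) := by
  rw [← div_le_iff₀ (add_tau_pos hM hx)]
  refine le_max_of_le_right (le_csSup ⟨1, ?_⟩ ⟨x, hx, rfl⟩)
  rintro _ ⟨z, hz, rfl⟩
  change (l z - l y - M.uA e) / (z + M.τ) ≤ 1
  rw [div_le_one (add_tau_pos hM hz)]
  linarith [hl.2.2.2 z hz, Lam.lo_le hM hl hy, hM.xlo_nonneg, uA_nonneg hM he, hM.tau_pos]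

theorem beta_le_one (hM : M.StandingAssumptions) (hl : l ∈ M.Lam) {y e : ℝ}
    (hy : y ∈ M.types) (he : e ∈ Icc (0 : ℝ) 1) : M.beta l y e ≤ 1 :=
  beta_le_of_forall hM zero_le_one fun z hz => by
    linarith [hl.2.2.2 z hz, Lam.lo_le hM hl hy, hM.xlo_nonneg, uA_nonneg hM he, hM.tau_pos]

theorem beta_antitoneOn_effort (hM : M.StandingAssumptions) (hl : l ∈ M.Lam) {y : ℝ}
    (hy : y ∈ M.types) : AntitoneOn (M.beta l y) (Icc 0 1) := by
  intro a ha b hb hab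
  refine beta_le_of_forall hM (beta_nonneg _ _ _) fun x hx => ?_
  linarith [le_beta_line hM hl hy ha hx, uA_monotoneOn hM ha hb hab]

/-- Since `x + τ ≥ τ`, `beta` is Lipschitz in `u_A(e)` with constant `1 / τ`. -/
theorem beta_sub_le (hM : M.StandingAssumptions) (hl : l ∈ M.Lam) {y a b : ℝ}
    (hy : y ∈ M.types) (ha : a ∈ Icc (0 : ℝ) 1) :
    M.beta l y b ≤ M.beta l y a + |M.uA b - M.uA a| / M.τ := by
  have hpos : 0 ≤ |M.uA b - M.uA a| / M.τ := div_nonneg (abs_nonneg _) hM.tau_pos.le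
  refine beta_le_of_forall hM (add_nonneg (beta_nonneg _ _ _) hpos) fun x hx => ?_
  have h1 := le_beta_line hM hl hy ha hx
  have h2 : |M.uA b - M.uA a| / M.τ * M.τ ≤ |M.uA b - M.uA a| / M.τ * (x + M.τ) :=
    mul_le_mul_of_nonneg_left (by linarith [types_nonneg hM hx]) hpos
  rw [div_mul_cancel₀ _ hM.tau_pos.ne'] at h2
  linarith [neg_abs_le (M.uA b - M.uA a)]

theorem beta_continuousOn (hM : M.StandingAssumptions) (hl : l ∈ M.Lam) {y : ℝ}
    (hy : y ∈ M.types) : ContinuousOn (M.beta l y) (Icc 0 1) := by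
  intro a ha
  have hu : Filter.Tendsto (fun b => |M.uA b - M.uA a| / M.τ) (nhdsWithin a (Icc 0 1))
      (nhds 0) := by
    have := (((uA_continuousOn hM a ha).sub_const (M.uA a)).abs).div_const M.τ
    simpa [ContinuousWithinAt] using this
  refine tendsto_iff_dist_tendsto_zero.2 (squeeze_zero' (.of_forall fun _ => dist_nonneg) ?_ hu)
  filter_upwards [self_mem_nhdsWithin] with b hb
  rw [Real.dist_eq, abs_le]
  have h1 := beta_sub_le hM hl hy ha (b := b)
  have h2 := beta_sub_le hM hl hy hb (b := a)
  rw [abs_sub_comm] at h2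
  constructor <;> linarith

theorem piMin_continuousOn (hM : M.StandingAssumptions) (hl : l ∈ M.Lam) {y : ℝ}
    (hy : y ∈ M.types) : ContinuousOn (M.piMin l y) (Icc 0 1) := by
  have hc := hM.costA.continuousOn
  have hu := uA_continuousOn hM
  have hb : ContinuousOn (fun e => M.cP (M.beta l y e)) (Icc 0 1) :=
    hM.costP.continuousOn.comp (beta_continuousOn hM hl hy)
      fun e he => ⟨beta_nonneg _ _ _, beta_le_one hM hl hy he⟩
  unfold piMin pi1 pi2 pi3
  fun_prop

theorem exists_piMin_isMaxOn (hM : M.StandingAssumptions) (hl : l ∈ M.Lam) {y : ℝ}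
    (hy : y ∈ M.types) : ∃ e ∈ Icc (0 : ℝ) 1, IsMaxOn (M.piMin l y) (Icc 0 1) e :=
  isCompact_Icc.exists_isMaxOn (nonempty_Icc.2 zero_le_one) (piMin_continuousOn hM hl hy)

/-- `min (pi2, pi3)` charges the larger of the two audit probabilities. -/
theorem min_pi2_pi3 (hM : M.StandingAssumptions) (hl : l ∈ M.Lam) {y e : ℝ}
    (hy : y ∈ M.types) (he : e ∈ Icc (0 : ℝ) 1) :
    min (M.pi2 l y e) (M.pi3 l y e)
      = l y - M.cA e - (1 - e) * M.cP (max (M.alpha l y) (M.beta l y e)) := by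
  have h1 : 0 ≤ 1 - e := by linarith [he.2]
  unfold pi2 pi3
  rcases le_total (M.alpha l y) (M.beta l y e) with h | h
  · rw [max_eq_right h, min_eq_right]
    have := mul_le_mul_of_nonneg_left
      (hM.costP.monotone (alpha_nonneg _ _) h (beta_le_one hM hl hy he)) h1
    linarith
  · rw [max_eq_left h, min_eq_left]
    have := mul_le_mul_of_nonneg_left
      (hM.costP.monotone (beta_nonneg _ _ _) h (alpha_le_one hy hl.2.2.2)) h1
    linarith

end Bounds

end TaxModel

/-! ### Loss functions and evidence rents of mechanisms. -/

namespace TaxModel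

variable {M : TaxModel} {m : TaxMechanism}

section Loss

theorem neg_tau_le_deviationLoss (hM : M.StandingAssumptions) (hm : M.IsFeasible m) {y x : ℝ}
    (hy : y ∈ M.types) (hx : x ∈ M.types) : -M.τ ≤ deviationLoss m y x := by
  obtain ⟨-, hP, -, -, hN⟩ := hm y hy
  have h1 := mul_nonneg hP.1 (types_nonneg hM hx)
  have h2 : (1 - m.eP y) * (y - m.rN y + M.τ) ≥ 0 :=
    mul_nonneg (by linarith [hP.2]) (by linarith [hN.2])
  have h3 := mul_nonneg hP.1 hM.tau_pos.le
  unfold deviationLoss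
  linarith

theorem loss_le_deviationLoss (hM : M.StandingAssumptions) (hm : M.IsFeasible m) {y x : ℝ}
    (hy : y ∈ M.types) (hx : x ∈ Icc y M.xhi) : M.loss m x ≤ deviationLoss m y x := by
  refine csInf_le ⟨-M.τ, ?_⟩ ⟨y, ⟨hy.1, hx.1⟩, rfl⟩
  rintro _ ⟨z, hz, rfl⟩
  exact neg_tau_le_deviationLoss hM hm ⟨hz.1, hz.2.trans hx.2⟩ ⟨hy.1.trans hx.1, hx.2⟩

theorem le_loss_of_forall {x v : ℝ} (hx : x ∈ M.types)
    (h : ∀ y ∈ Icc M.xlo x, v ≤ deviationLoss m y x) : v ≤ M.loss m x := by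
  refine le_csInf (Set.Nonempty.image _ ⟨x, hx.1, le_rfl⟩) ?_
  rintro _ ⟨z, hz, rfl⟩
  exact h z hz

theorem loss_le_self (hM : M.StandingAssumptions) (hm : M.IsFeasible m) {x : ℝ}
    (hx : x ∈ M.types) : M.loss m x ≤ x := by
  have h := loss_le_deviationLoss hM hm hx ⟨le_rfl, hx.2⟩
  obtain ⟨-, hP, -, -, hN⟩ := hm x hx
  have := mul_nonneg (show 0 ≤ 1 - m.eP x by linarith [hP.2]) hN.1
  unfold deviationLoss at h
  linarith

/-- At effort one the agent's optimality is only one-sided: slopes from the left give `r_A - R_NA ≥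
c_A'(1)`, so equality with `u_A` weakens to an inequality. -/
theorem uA_le_evidenceRent (hM : M.StandingAssumptions) (hm : M.IsMechanism m) {x : ℝ}
    (hx : x ∈ M.types) : M.uA (m.eA x) ≤ M.evidenceRent m x := by
  rcases (hm.1 x hx).1.2.lt_or_eq with h | h
  · exact (evidenceRent_eq_uA hM hm hx h).ge
  · have hmax := hm.2.1 x hx
    rw [h] at hmax
    have h1 : (1 : ℝ) ∈ Icc (0 : ℝ) 1 := right_mem_Icc.2 zero_le_one
    have hslope : dUnit M.cA 1 ≤ m.rA x - RNA m x := by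
      have ht := hasDerivWithinAt_iff_tendsto_slope.1 (hM.costA.hasDeriv h1)
      have hne : (nhdsWithin (1 : ℝ) (Icc 0 1 \ {1})).NeBot := by
        rw [Icc_sdiff_right, ← mem_closure_iff_nhdsWithin_neBot, closure_Ico (by norm_num)]
        exact h1
      refine le_of_tendsto ht ?_
      filter_upwards [self_mem_nhdsWithin] with e he
      have hlt : e < 1 := lt_of_le_of_ne he.1.2 he.2
      have := hmax he.1
      simp only [mem_ofPred_eq] at this
      rw [slope_def_field, div_le_iff_of_neg (by linarith)]
      linarith
    unfold evidenceRent uA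
    rw [h]
    linarith

end Loss

/-! ### Increasing concave majorants. -/

section Hull

/-- The least increasing concave majorant of `f` and the constant `xlo` on the type space. -/
noncomputable def hull (M : TaxModel) (f : ℝ → ℝ) (x : ℝ) : ℝ :=
  sInf {v | ∃ p q : ℝ, 0 ≤ p ∧ (∀ z ∈ M.types, f z ≤ p * z + q ∧ M.xlo ≤ p * z + q) ∧
    v = p * x + q}

variable {f : ℝ → ℝ}

theorem hull_le {p q : ℝ} (hp : 0 ≤ p)
    (h : ∀ z ∈ M.types, f z ≤ p * z + q ∧ M.xlo ≤ p * z + q) {x : ℝ} (hx : x ∈ M.types) :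
    M.hull f x ≤ p * x + q := by
  refine csInf_le ⟨M.xlo, ?_⟩ ⟨p, q, hp, h, rfl⟩
  rintro _ ⟨p, q, -, h, rfl⟩
  exact (h x hx).2

theorem le_hull_of_forall (hf : ∀ x ∈ M.types, f x ≤ x) {x v : ℝ}
    (h : ∀ p q : ℝ, 0 ≤ p → (∀ z ∈ M.types, f z ≤ p * z + q ∧ M.xlo ≤ p * z + q) →
      v ≤ p * x + q) : v ≤ M.hull f x := by
  refine le_csInf ⟨1 * x + 0, 1, 0, zero_le_one, fun z hz => ?_, rfl⟩ ?_
  -- The identity is an admissible affine majorant, so the infimum is over a nonempty set.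
  · have := hf z hz
    constructor <;> linarith [hz.1]
  · rintro _ ⟨p, q, hp, hpq, rfl⟩
    exact h p q hp hpq

theorem le_hull (hf : ∀ x ∈ M.types, f x ≤ x) {x : ℝ} (hx : x ∈ M.types) : f x ≤ M.hull f x :=
  le_hull_of_forall hf fun _ _ _ h => (h x hx).1

theorem hull_le_self (hf : ∀ x ∈ M.types, f x ≤ x) {x : ℝ} (hx : x ∈ M.types) :
    M.hull f x ≤ x := by
  have := hull_le (M := M) (f := f) (p := 1) (q := 0) zero_le_one (fun z hz => by
    have := hf z hz
    constructor <;> linarith [hz.1]) hx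
  linarith

theorem hull_mem_Lam (hM : M.StandingAssumptions) (hf : ∀ x ∈ M.types, f x ≤ x) :
    M.hull f ∈ M.Lam := by
  refine ⟨fun a ha b hb hab => ?_, ⟨convex_Icc _ _, fun a ha b hb s t hs ht hst => ?_⟩, ?_,
    fun x hx => hull_le_self hf hx⟩
  · refine le_hull_of_forall hf fun p q hp h => (hull_le hp h ha).trans ?_
    linarith [mul_le_mul_of_nonneg_left hab hp]
  · refine le_hull_of_forall hf fun p q hp h => ?_
    have h1 := mul_le_mul_of_nonneg_left (hull_le hp h ha) hs
    have h2 := mul_le_mul_of_nonneg_left (hull_le hp h hb) ht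
    simp only [smul_eq_mul]
    calc _ ≤ s * (p * a + q) + t * (p * b + q) := add_le_add h1 h2
      _ = p * (s * a + t * b) + (s + t) * q := by ring
      _ = _ := by rw [hst, one_mul]
  · exact le_antisymm (hull_le_self hf (lo_mem hM))
      (le_hull_of_forall hf fun p q _ h => (h _ (lo_mem hM)).2)

end Hull

/-! ### `piMin` as an upper bound on profit. -/

section UpperBound

/-- `l` is an increasing concave majorant of `f`, below every increasing affine majorant of `f`
and `xlo`. -/
structure IsLamHull (M : TaxModel) (f l : ℝ → ℝ) : Prop where
  mem : l ∈ M.Lam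
  le : ∀ x ∈ M.types, f x ≤ l x
  le_affine : ∀ p q : ℝ, 0 ≤ p → (∀ z ∈ M.types, f z ≤ p * z + q ∧ M.xlo ≤ p * z + q) →
    ∀ x ∈ M.types, l x ≤ p * x + q

theorem isLamHull_hull (hM : M.StandingAssumptions) {f : ℝ → ℝ} (hf : ∀ x ∈ M.types, f x ≤ x) :
    M.IsLamHull f (M.hull f) :=
  ⟨hull_mem_Lam hM hf, fun _ => le_hull hf, fun _ _ hp h _ => hull_le hp h⟩

theorem isLamHull_self {f : ℝ → ℝ} (hf : f ∈ M.Lam) : M.IsLamHull f f :=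
  ⟨hf, fun _ _ => le_rfl, fun _ _ _ h x hx => (h x hx).1⟩

variable {l : ℝ → ℝ}

/-- The line through `(y, y)` with slope `e_P(y)` majorizes the loss: right of `y` because deviating
to `y` is possible and `r_∅ ≥ 0`, left of `y` because the loss is below the identity. It then
majorizes `l` as well. -/
theorem IsLamHull.alpha_le (hM : M.StandingAssumptions) (hm : M.IsMechanism m)
    (hl : M.IsLamHull (M.loss m) l) {y : ℝ} (hy : y ∈ M.types) : M.alpha l y ≤ m.eP y := by
  obtain ⟨-, hP, -, -, hN⟩ := hm.1 y hy
  refine alpha_le_of_forall hP.1 fun x hx => ?_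
  have := hl.le_affine (m.eP y) ((1 - m.eP y) * y) hP.1 (fun z hz => ?_) x
    ⟨hy.1.trans hx.1.le, hx.2⟩
  · linarith
  · have h1 : 0 ≤ (1 - m.eP y) * (y - M.xlo) := mul_nonneg (by linarith [hP.2]) (by linarith [hy.1])
    have h2 := mul_le_mul_of_nonneg_left hz.1 hP.1
    refine ⟨?_, by linarith⟩
    rcases le_total y z with hyz | hzy
    · have := loss_le_deviationLoss hM hm.1 hy ⟨hyz, hz.2⟩
      have h3 := mul_nonneg (show 0 ≤ 1 - m.eP y by linarith [hP.2]) hN.1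
      unfold deviationLoss at this
      linarith
    · have := loss_le_self hM hm.1 hz
      have h3 := mul_nonneg (show 0 ≤ 1 - m.eP y by linarith [hP.2]) (sub_nonneg.2 hzy)
      linarith

/-- Incentive compatibility at `y` forces a refund `R_NA ≥ y - loss y - u_A`, of which audits can
carry at most `e_P (y + τ)`. The rest is paid without audit and lowers the loss from deviating to
`y`, so the line of slope `e_P` through the pivot of `beta` majorizes the loss. Effort below one
makes the rent exactly `u_A`. -/
theorem IsLamHull.beta_le (hM : M.StandingAssumptions) (hm : M.IsMechanism m)
    (hl : M.IsLamHull (M.loss m) l) {y : ℝ} (hy : y ∈ M.types) (h1 : m.eA y < 1) :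
    M.beta l y (m.eA y) ≤ m.eP y := by
  obtain ⟨hA, hP, -, hrP, hN⟩ := hm.1 y hy
  have hu := uA_nonneg hM hA
  have hIC := hm.2.2 y hy
  unfold utility at hIC
  rw [evidenceRent_eq_uA hM hm hy h1] at hIC
  refine beta_le_of_forall hM hP.1 fun x hx => ?_
  have := hl.le_affine (m.eP y) (m.eP y * M.τ + l y + M.uA (m.eA y)) hP.1 (fun z hz => ?_) x hx
  · linarith
  · have h0 := mul_nonneg hP.1 (add_tau_pos hM hz).le
    have hlo := Lam.lo_le hM hl.mem hy
    refine ⟨?_, by linarith⟩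
    rcases le_total y z with hyz | hzy
    · have h2 := loss_le_deviationLoss hM hm.1 hy ⟨hyz, hz.2⟩
      have h3 := mul_le_mul_of_nonneg_left hrP.2 hP.1
      have h4 := hl.le y hy
      unfold deviationLoss at h2
      unfold RNA at hIC
      linarith
    · linarith [hl.le z hz, hl.mem.1 hz hy hzy]

/-- The bound `pi1` comes from `R_NA ≥ 0` and a rent of at least `u_A`; `pi2` and `pi3` come from
incentive compatibility at `y`, each with its lower bound on `e_P`. At effort one the audit cost
vanishes, so the missing `beta` bound does not matter. -/
theorem IsLamHull.profit_le (hM : M.StandingAssumptions) (hm : M.IsMechanism m)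
    (hl : M.IsLamHull (M.loss m) l) {y : ℝ} (hy : y ∈ M.types) :
    M.profit m y ≤ M.piMin l y (m.eA y) := by
  obtain ⟨hA, hP, -, hrP, hN⟩ := hm.1 y hy
  have hIC := hm.2.2 y hy
  have hll := hl.le y hy
  have hu := uA_le_evidenceRent hM hm hy
  have hR : 0 ≤ RNA m y := add_nonneg (mul_nonneg hP.1 hrP.1)
    (mul_nonneg (by linarith [hP.2]) hN.1)
  have h1 : 0 ≤ 1 - m.eA y := by linarith [hA.2]
  have ha := mul_le_mul_of_nonneg_left
    (hM.costP.monotone (alpha_nonneg _ _) (hl.alpha_le hM hm hy) hP.2) h1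
  unfold utility at hIC
  unfold profit piMin pi1 pi2 pi3
  refine le_min ?_ (le_min ?_ ?_)
  · linarith
  · linarith
  · rcases hA.2.lt_or_eq with h | h
    · have hb := mul_le_mul_of_nonneg_left
        (hM.costP.monotone (beta_nonneg _ _ _) (hl.beta_le hM hm hy h) hP.2) h1
      linarith
    · rw [h]
      linarith

end UpperBound

/-! ### Implementing a given loss function and effort. -/

section Construction

variable {l : ℝ → ℝ}

/-- The bonus `r_A - R_NA = c_A'(e)` makes `e` optimal. If its rent already covers `y - l y`, no
further refund is needed and auditing with `alpha` suffices. Otherwise the gap `R` is refunded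
exactly, after audits as far as the budget allows. -/
theorem exists_contract (hM : M.StandingAssumptions) (hl : l ∈ M.Lam) {y e : ℝ}
    (hy : y ∈ M.types) (he : e ∈ Icc (0 : ℝ) 1) :
    ∃ p rA rP rN : ℝ, p ∈ Icc (0 : ℝ) 1 ∧ rA ∈ Icc 0 (y + M.τ) ∧ rP ∈ Icc 0 (y + M.τ) ∧
      rN ∈ Icc 0 (y + M.τ) ∧ rA - (p * rP + (1 - p) * rN) = dUnit M.cA e ∧
      y - l y ≤ p * rP + (1 - p) * rN + M.uA e ∧
      (∀ x ∈ Icc y M.xhi, l x ≤ p * x + (1 - p) * (y - rN)) ∧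
      M.piMin l y e ≤
        y - (p * rP + (1 - p) * rN) - M.uA e - M.cA e - (1 - e) * M.cP p := by
  have hd0 := hM.costA.deriv_nonneg he
  have hc1 := cA_one_le hM he
  have hlo := Lam.lo_le hM hl hy
  have hly := hl.2.2.2 y hy
  have hy0 := types_nonneg hM hy
  have hyt := add_tau_pos hM hy
  have hα0 := alpha_nonneg (M := M) l y
  have hα1 := alpha_le_one hy hl.2.2.2
  rcases le_or_gt (y - l y - M.uA e) 0 with hd | hd
  · refine ⟨M.alpha l y, dUnit M.cA e, 0, 0, ⟨hα0, hα1⟩, ⟨hd0, ?_⟩, ⟨le_rfl, hyt.le⟩,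
      ⟨le_rfl, hyt.le⟩, by ring, by linarith, fun x hx => ?_, ?_⟩
    · have := hM.costA.strictMono_deriv.monotoneOn he (right_mem_Icc.2 zero_le_one) he.2
      linarith [hM.budget.1]
    · have := le_alpha_line hy hl.2.2.2 hx
      linarith
    · refine (min_le_left _ _).trans (le_of_eq ?_)
      unfold pi1
      ring
  · set R := y - l y - M.uA e with hRdef
    set p := max (M.alpha l y) (M.beta l y e) with hpdef
    have hp0 : 0 ≤ p := hα0.trans (le_max_left _ _)
    have hp1 : p ≤ 1 := max_le hα1 (beta_le_one hM hl hy he)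
    have hu := uA_nonneg hM he
    have hRy : R ≤ y := by linarith [hM.xlo_nonneg]
    have hrA : R + dUnit M.cA e ∈ Icc 0 (y + M.τ) := by
      refine ⟨by linarith, ?_⟩
      have : M.uA e = e * dUnit M.cA e - M.cA e := rfl
      linarith [hM.xlo_nonneg]
    have hprofit : M.piMin l y e ≤ y - R - M.uA e - M.cA e - (1 - e) * M.cP p := by
      refine (min_le_right _ _).trans (le_of_eq ?_)
      rw [min_pi2_pi3 hM hl hy he, hRdef]
      ring
    -- If audits can carry all of `R`, then `r_∅ = 0` and the deviation loss is the line through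
    -- `(y, y)` of slope `p ≥ alpha`. Otherwise `r_P = y + τ`, the remainder goes to `r_∅`, and the
    -- deviation loss is the line through the pivot of slope `p ≥ beta`.
    rcases le_or_gt R (p * (y + M.τ)) with hle | hgt
    · have hp : 0 < p := by
        by_contra hcon
        have : p = 0 := le_antisymm (not_lt.1 hcon) hp0
        rw [this] at hle
        linarith
      have hR : p * (R / p) + (1 - p) * 0 = R := by field_simp; ring
      refine ⟨p, R + dUnit M.cA e, R / p, 0, ⟨hp0, hp1⟩, hrA, ⟨by positivity, ?_⟩,
        ⟨le_rfl, hyt.le⟩, ?_, ?_, fun x hx => ?_, ?_⟩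
      · rw [div_le_iff₀ hp]; linarith
      · rw [hR]; ring
      · rw [hR]; linarith
      · have h1 := le_alpha_line hy hl.2.2.2 hx
        have h2 := mul_le_mul_of_nonneg_right (le_max_left (M.alpha l y) (M.beta l y e))
          (sub_nonneg.2 hx.1)
        rw [← hpdef] at h2
        linarith
      · rw [hR]; exact hprofit
    · have hp : p < 1 := by
        refine lt_of_le_of_ne hp1 fun h => ?_
        rw [h] at hgt
        linarith [hM.tau_pos]
      have hq : 0 < 1 - p := by linarith
      have hN : (1 - p) * ((R - p * (y + M.τ)) / (1 - p)) = R - p * (y + M.τ) := by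
        field_simp
      have hR : p * (y + M.τ) + (1 - p) * ((R - p * (y + M.τ)) / (1 - p)) = R := by
        rw [hN]; ring
      refine ⟨p, R + dUnit M.cA e, y + M.τ, (R - p * (y + M.τ)) / (1 - p), ⟨hp0, hp1⟩, hrA,
        ⟨hyt.le, le_rfl⟩, ⟨div_nonneg (by linarith) hq.le, ?_⟩, ?_, ?_, fun x hx => ?_, ?_⟩
      · rw [div_le_iff₀ hq]; linarith [hM.tau_pos]
      · rw [hR]; ring
      · rw [hR]; linarith
      · have hx' : x ∈ M.types := ⟨hy.1.trans hx.1, hx.2⟩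
        have h1 := le_beta_line hM hl hy he hx'
        have h2 := mul_le_mul_of_nonneg_right (le_max_right (M.alpha l y) (M.beta l y e))
          (add_tau_pos hM hx').le
        rw [← hpdef] at h2
        rw [mul_sub, hN]
        linarith
      · rw [hR]; exact hprofit

/-- Every loss function in `Λ` and effort function can be implemented at the profit `piMin`. -/
theorem exists_mechanism (hM : M.StandingAssumptions) (hl : l ∈ M.Lam) {E : ℝ → ℝ}
    (hE : ∀ y ∈ M.types, E y ∈ Icc (0 : ℝ) 1) :
    ∃ m, M.IsMechanism m ∧ (∀ x ∈ M.types, l x ≤ M.loss m x) ∧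
      ∀ x ∈ M.types, M.piMin l x (E x) ≤ M.profit m x := by
  have hex := fun y (hy : y ∈ M.types) => exists_contract hM hl hy (hE y hy)
  choose! p rA rP rN hp hrA hrP hrN hd hU hline hprof using hex
  have hmem : ∀ {y x : ℝ}, x ∈ M.types → y ∈ Icc M.xlo x → y ∈ M.types ∧ x ∈ Icc y M.xhi :=
    fun hx hy => ⟨⟨hy.1, hy.2.trans hx.2⟩, hy.2, hx.2⟩
  have hloss : ∀ x ∈ M.types, l x ≤ M.loss ⟨E, p, rA, rP, rN⟩ x := fun x hx =>
    le_loss_of_forall hx fun y hy => hline y (hmem hx hy).1 x (hmem hx hy).2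
  have hrent : ∀ x ∈ M.types, M.evidenceRent ⟨E, p, rA, rP, rN⟩ x = M.uA (E x) := by
    intro x hx
    have := hd x hx
    simp only [evidenceRent, RNA, this, uA]
  refine ⟨⟨E, p, rA, rP, rN⟩, ⟨fun y hy => ⟨hE y hy, hp y hy, hrA y hy, hrP y hy, hrN y hy⟩,
    fun x hx e he => ?_, fun x hx => ?_⟩, hloss, fun x hx => ?_⟩
  · have := hd x hx
    simp only [RNA, this, mem_ofPred_eq]
    linarith [hM.costA.tangent_le (hE x hx) he]
  · have h1 := hloss x hx
    have h2 := hU x hx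
    unfold utility
    rw [hrent x hx]
    simp only [RNA]
    linarith
  · have h2 := hprof x hx
    unfold profit
    rw [hrent x hx]
    simpa only [RNA] using h2

end Construction

/-! ### Tight mechanisms attain `piMin`. -/

section Tight

/-- Implementing the hull of the loss with the same effort gives a tighter mechanism, so tightness
forces the loss to equal its hull. -/
theorem IsTight.loss_mem_Lam (hM : M.StandingAssumptions) (hm : M.IsTight m) :
    M.loss m ∈ M.Lam := by
  have hf : ∀ x ∈ M.types, M.loss m x ≤ x := fun x hx => loss_le_self hM hm.1.1 hx
  have hh := isLamHull_hull hM hf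
  obtain ⟨m', hm', hl, hp⟩ := exists_mechanism hM hh.mem fun y hy => (hm.1.1 y hy).1
  have ht := hm.2 m' hm' fun x hx =>
    ⟨(hh.profit_le hM hm.1 hx).trans (hp x hx), (hh.le x hx).trans (hl x hx)⟩
  have heq : EqOn (M.hull (M.loss m)) (M.loss m) M.types := fun x hx =>
    le_antisymm ((hl x hx).trans (ht x hx).2) (hh.le x hx)
  refine ⟨hh.mem.1.congr heq, hh.mem.2.1.congr heq, ?_, hf⟩
  rw [← heq (lo_mem hM)]
  exact hh.mem.2.2.1

/-- Otherwise changing the effort at the single type `y`, with the same loss function, would yield a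
tighter mechanism with strictly more profit at `y`. -/
theorem IsTight.piMin_le_profit (hM : M.StandingAssumptions) (hm : M.IsTight m) {y e : ℝ}
    (hy : y ∈ M.types) (he : e ∈ Icc (0 : ℝ) 1) :
    M.piMin (M.loss m) y e ≤ M.profit m y := by
  have hh := isLamHull_self (hm.loss_mem_Lam hM)
  have hE : ∀ x ∈ M.types, Function.update m.eA y e x ∈ Icc (0 : ℝ) 1 := by
    intro x hx
    rcases eq_or_ne x y with rfl | hne
    · simpa using he
    · simpa [hne] using (hm.1.1 x hx).1
  by_contra! hcon
  obtain ⟨m', hm', hl, hp⟩ := exists_mechanism hM hh.mem hE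
  have ht := hm.2 m' hm' fun x hx => by
    refine ⟨le_trans ?_ (hp x hx), hl x hx⟩
    rcases eq_or_ne x y with rfl | hne
    · simpa using hcon.le
    · simpa [hne] using hh.profit_le hM hm.1 hx
  have h1 := hp y hy
  rw [Function.update_self] at h1
  linarith [(ht y hy).1]

theorem IsTight.profit_eq (hM : M.StandingAssumptions) (hm : M.IsTight m) {y : ℝ}
    (hy : y ∈ M.types) : M.profit m y = M.piMin (M.loss m) y (m.eA y) :=
  le_antisymm ((isLamHull_self (hm.loss_mem_Lam hM)).profit_le hM hm.1 hy)
    (hm.piMin_le_profit hM hy (hm.1.1 y hy).1)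

theorem IsTight.isMaxOn (hM : M.StandingAssumptions) (hm : M.IsTight m) {y : ℝ}
    (hy : y ∈ M.types) : IsMaxOn (M.piMin (M.loss m) y) (Icc 0 1) (m.eA y) := by
  intro e he
  rw [mem_ofPred_eq, ← hm.profit_eq hM hy]
  exact hm.piMin_le_profit hM hy he

end Tight

end TaxModel

/-! ### One-sided first-order conditions and derivatives of the auxiliary profits. -/

namespace TaxModel

variable {M : TaxModel} {m : TaxMechanism} {l : ℝ → ℝ}

section FirstOrder

theorem hasDerivAt_nonpos_of_eventually_le {f : ℝ → ℝ} {f' x : ℝ} (hf : HasDerivAt f f' x)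
    (h : ∀ᶠ z in nhdsWithin x (Ioi x), f z ≤ f x) : f' ≤ 0 := by
  have ht := (hasDerivWithinAt_iff_tendsto_slope' (by simp)).1
    (hf.hasDerivWithinAt (s := Ioi x))
  refine le_of_tendsto ht ?_
  filter_upwards [h, self_mem_nhdsWithin] with z hz hxz
  rw [slope_def_field]
  exact div_nonpos_of_nonpos_of_nonneg (by linarith) (sub_nonneg.2 (le_of_lt hxz))

theorem hasDerivAt_nonneg_of_eventually_le {f : ℝ → ℝ} {f' x : ℝ} (hf : HasDerivAt f f' x)
    (h : ∀ᶠ z in nhdsWithin x (Iio x), f z ≤ f x) : 0 ≤ f' := by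
  have ht := (hasDerivWithinAt_iff_tendsto_slope' (by simp)).1
    (hf.hasDerivWithinAt (s := Iio x))
  refine ge_of_tendsto ht ?_
  filter_upwards [h, self_mem_nhdsWithin] with z hz hxz
  rw [slope_def_field]
  exact div_nonneg_of_nonpos (by linarith) (sub_nonpos.2 (le_of_lt hxz))

theorem _root_.IsEvidenceCost.hasDerivAt {c : ℝ → ℝ} (h : IsEvidenceCost c) {e : ℝ}
    (he : e ∈ Ioo (0 : ℝ) 1) : HasDerivAt c (dUnit c e) e :=
  (h.hasDeriv (Ioo_subset_Icc_self he)).hasDerivAt (Icc_mem_nhds he.1 he.2)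

theorem uA_hasDerivAt (hM : M.StandingAssumptions) {e : ℝ} (he : e ∈ Ioo (0 : ℝ) 1) :
    HasDerivAt M.uA (dUnit M.uA e) e := by
  rw [dUnit_uA hM (Ioo_subset_Icc_self he)]
  exact (uA_hasDeriv hM (Ioo_subset_Icc_self he)).hasDerivAt (Icc_mem_nhds he.1 he.2)

theorem pi2_hasDerivAt (hM : M.StandingAssumptions) (l : ℝ → ℝ) (y : ℝ) {e : ℝ}
    (he : e ∈ Ioo (0 : ℝ) 1) :
    HasDerivAt (M.pi2 l y) (M.cP (M.alpha l y) - dUnit M.cA e) e := by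
  have h1 := (hM.costA.hasDerivAt he).const_sub (l y)
  have h2 := ((hasDerivAt_id e).const_sub 1).mul_const (M.cP (M.alpha l y))
  exact (h1.sub h2).congr_deriv (by ring)

theorem pi1_hasDerivAt (hM : M.StandingAssumptions) (l : ℝ → ℝ) (y : ℝ) {e : ℝ}
    (he : e ∈ Ioo (0 : ℝ) 1) :
    HasDerivAt (M.pi1 l y) (M.cP (M.alpha l y) - dUnit M.cA e - dUnit M.uA e) e := by
  have h1 := ((uA_hasDerivAt hM he).const_sub y).sub (hM.costA.hasDerivAt he)
  have h2 := ((hasDerivAt_id e).const_sub 1).mul_const (M.cP (M.alpha l y))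
  exact (h1.sub h2).congr_deriv (by ring)

end FirstOrder

/-! ### Which auxiliary profit is the minimum. -/

section Regions

/-- The quantity `d₂` is the height at `-τ` of the `alpha` line minus the height of the pivot of
`beta`. If it is nonpositive, the line of slope `alpha` through the pivot lies above the `alpha`
line and hence above `l` right of `y`; left of `y` monotonicity of `l` suffices. -/
theorem beta_le_alpha (hM : M.StandingAssumptions) (hl : l ∈ M.Lam) {y e : ℝ}
    (hy : y ∈ M.types) (he : e ∈ Icc (0 : ℝ) 1)
    (hd : (1 - M.alpha l y) * y - M.uA e - l y - M.alpha l y * M.τ ≤ 0) :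
    M.beta l y e ≤ M.alpha l y := by
  refine beta_le_of_forall hM (alpha_nonneg _ _) fun x hx => ?_
  rcases le_total y x with hyx | hxy
  · linarith [le_alpha_line hy hl.2.2.2 ⟨hyx, hx.2⟩]
  · have := mul_nonneg (alpha_nonneg (M := M) l y) (add_tau_pos hM hx).le
    linarith [hl.1 hx hy hxy, uA_nonneg hM he]

theorem alpha_le_beta (hM : M.StandingAssumptions) (hl : l ∈ M.Lam) {y e : ℝ}
    (hy : y ∈ M.types) (he : e ∈ Icc (0 : ℝ) 1)
    (hd : 0 ≤ (1 - M.alpha l y) * y - M.uA e - l y - M.alpha l y * M.τ) :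
    M.alpha l y ≤ M.beta l y e := by
  by_contra! hcon
  refine hcon.not_ge (alpha_le_of_forall (beta_nonneg _ _ _) fun x hx => ?_)
  have h1 := le_beta_line hM hl hy he (x := x) ⟨hy.1.trans hx.1.le, hx.2⟩
  have h2 := mul_le_mul_of_nonneg_right hcon.le (add_tau_pos hM hy).le
  linarith

theorem piMin_eq_pi2 (hM : M.StandingAssumptions) (hl : l ∈ M.Lam) {y e : ℝ}
    (hy : y ∈ M.types) (he : e ∈ Icc (0 : ℝ) 1) (h1 : 0 ≤ y - M.uA e - l y)
    (h2 : (1 - M.alpha l y) * y - M.uA e - l y - M.alpha l y * M.τ ≤ 0) :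
    M.piMin l y e = M.pi2 l y e := by
  unfold piMin
  rw [min_pi2_pi3 hM hl hy he, max_eq_left (beta_le_alpha hM hl hy he h2), min_eq_right]
  · rfl
  · unfold pi1
    linarith

theorem piMin_eq_pi1 (hM : M.StandingAssumptions) (hl : l ∈ M.Lam) {y e : ℝ}
    (hy : y ∈ M.types) (he : e ∈ Icc (0 : ℝ) 1) (h1 : y - M.uA e - l y ≤ 0) :
    M.piMin l y e = M.pi1 l y e := by
  have h2 := mul_nonneg (alpha_nonneg (M := M) l y) (add_tau_pos hM hy).le
  unfold piMin
  rw [min_pi2_pi3 hM hl hy he, max_eq_left (beta_le_alpha hM hl hy he (by linarith)),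
    min_eq_left]
  unfold pi1
  linarith

theorem piMin_eq_pi3 (hM : M.StandingAssumptions) (hl : l ∈ M.Lam) {y e : ℝ}
    (hy : y ∈ M.types) (he : e ∈ Icc (0 : ℝ) 1)
    (h2 : 0 ≤ (1 - M.alpha l y) * y - M.uA e - l y - M.alpha l y * M.τ) :
    M.piMin l y e = M.pi3 l y e := by
  have h3 := mul_nonneg (alpha_nonneg (M := M) l y) (add_tau_pos hM hy).le
  have h4 := mul_le_mul_of_nonneg_left (hM.costP.monotone (alpha_nonneg _ _)
    (alpha_le_beta hM hl hy he h2) (beta_le_one hM hl hy he)) (show 0 ≤ 1 - e by linarith [he.2])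
  unfold piMin
  rw [min_pi2_pi3 hM hl hy he, max_eq_right (alpha_le_beta hM hl hy he h2), min_eq_right]
  · rfl
  · unfold pi1
    linarith

end Regions

/-! ### Interior maximizing efforts and attained audit bounds. -/

section Maximizers

/-- Slightly below effort one, the saving is about `c_A'(1)` per unit while the extra audit cost is
at most `c_P(1) < c_A'(1)`. -/
theorem lt_one_of_isMaxOn (hM : M.StandingAssumptions) (hl : l ∈ M.Lam) {y e : ℝ}
    (hy : y ∈ M.types) (he : e ∈ Icc (0 : ℝ) 1) (hmax : IsMaxOn (M.piMin l y) (Icc 0 1) e) :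
    e < 1 := by
  refine lt_of_le_of_ne he.2 ?_
  rintro rfl
  have ht := hasDerivWithinAt_iff_tendsto_slope.1 (hM.costA.hasDeriv he)
  have hne : (nhdsWithin (1 : ℝ) (Icc 0 1 \ {1})).NeBot := by
    rw [Icc_sdiff_right, ← mem_closure_iff_nhdsWithin_neBot, closure_Ico (by norm_num)]
    exact he
  obtain ⟨e, hlt', hmem⟩ :=
    ((ht.eventually (lt_mem_nhds hM.budget.2)).and self_mem_nhdsWithin).exists
  have hlt : e < 1 := lt_of_le_of_ne hmem.1.2 hmem.2
  rw [slope_def_field, lt_div_iff_of_neg (by linarith)] at hlt'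
  have h0 : 0 ≤ 1 - e := by linarith
  have ha := mul_le_mul_of_nonneg_left
    (hM.costP.monotone (alpha_nonneg _ _) (alpha_le_one hy hl.2.2.2) le_rfl) h0
  have hb := mul_le_mul_of_nonneg_left
    (hM.costP.monotone (beta_nonneg _ _ _) (beta_le_one hM hl hy hmem.1) le_rfl) h0
  have hu := uA_monotoneOn hM hmem.1 he hlt.le
  have := hmax hmem.1
  rw [mem_ofPred_eq] at this
  refine absurd this (not_le.2 ?_)
  have h1 : M.piMin l y 1 ≤ M.pi1 l y 1 := min_le_left _ _
  have h2 : M.piMin l y 1 ≤ M.pi2 l y 1 := (min_le_right _ _).trans (min_le_left _ _)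
  have h3 : M.piMin l y 1 ≤ M.pi3 l y 1 := (min_le_right _ _).trans (min_le_right _ _)
  unfold pi1 at h1
  unfold pi2 at h2
  unfold pi3 at h3
  refine lt_min ?_ (lt_min ?_ ?_)
  · unfold pi1; linarith
  · unfold pi2; linarith
  · unfold pi3; linarith

/-- Slightly above effort zero, effort and rent together cost `e c_A'(e)` with `c_A'(0) = 0`, while
at least `c_P(p)` of audit cost is saved per unit. -/
theorem pos_of_isMaxOn (hM : M.StandingAssumptions) (hl : l ∈ M.Lam) {y e : ℝ}
    (hy : y ∈ M.types) (he : e ∈ Icc (0 : ℝ) 1) (hmax : IsMaxOn (M.piMin l y) (Icc 0 1) e)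
    (hp : 0 < max (M.alpha l y) (M.beta l y e)) : 0 < e := by
  refine lt_of_le_of_ne he.1 ?_
  rintro rfl
  set p := max (M.alpha l y) (M.beta l y 0) with hpdef
  have hα1 := alpha_le_one hy hl.2.2.2
  have hp1 : p ≤ 1 := max_le hα1 (beta_le_one hM hl hy he)
  have hcp : dUnit M.cA 0 < M.cP p := by
    rw [hM.costA.deriv_zero]
    exact hM.costP.pos ⟨hp, hp1⟩
  have hne : (nhdsWithin (0 : ℝ) (Icc 0 1 \ {0})).NeBot := by
    rw [Icc_sdiff_left, ← mem_closure_iff_nhdsWithin_neBot, closure_Ioc (by norm_num)]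
    exact he
  have hcont : Filter.Tendsto (dUnit M.cA) (nhdsWithin 0 (Icc 0 1 \ {0}))
      (nhds (dUnit M.cA 0)) :=
    (hM.costA.differentiable_two.continuousOn 0 he).mono_left (nhdsWithin_mono _ sdiff_subset)
  obtain ⟨e, hlt', hmem⟩ :=
    ((hcont.eventually (gt_mem_nhds hcp)).and self_mem_nhdsWithin).exists
  have hlt : 0 < e := lt_of_le_of_ne hmem.1.1 (Ne.symm hmem.2)
  have h0 : 0 ≤ 1 - e := by linarith [hmem.1.2]
  have ha := mul_le_mul_of_nonneg_left
    (hM.costP.monotone (alpha_nonneg _ _) (le_max_left _ _) hp1) h0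
  have hb := mul_le_mul_of_nonneg_left
    (hM.costP.monotone (beta_nonneg _ _ _)
      ((beta_antitoneOn_effort hM hl hy he hmem.1 hlt.le).trans (le_max_right _ _)) hp1) h0
  have hu := uA_nonneg hM hmem.1
  have hly := hl.2.2.2 y hy
  have hue : M.uA e = e * dUnit M.cA e - M.cA e := rfl
  have hstrict := mul_lt_mul_of_pos_left hlt' hlt
  have := hmax hmem.1
  rw [mem_ofPred_eq] at this
  refine absurd this (not_le.2 ?_)
  have h1 : M.piMin l y 0 ≤ l y - M.cP p := by
    refine (min_le_right _ _).trans (le_of_eq ?_)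
    rw [min_pi2_pi3 hM hl hy he, hM.costA.zero]
    ring
  refine h1.trans_lt (lt_min ?_ (lt_min ?_ ?_))
  · unfold pi1; linarith
  · unfold pi2; linarith
  · unfold pi3; linarith

/-- The effort bound in global concavity applies to maximizers, and below it `piMin` is concave. -/
theorem GlobalConcavity.concaveOn_piMin {ebar y : ℝ}
    (h : ConcaveOn ℝ (Icc 0 ebar ×ˢ M.Lam) (fun p : ℝ × (ℝ → ℝ) => M.piMin p.2 y p.1))
    (hl : l ∈ M.Lam) : ConcaveOn ℝ (Icc 0 ebar) (M.piMin l y) := by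
  refine ⟨convex_Icc _ _, fun a ha b hb s t hs ht hst => ?_⟩
  have := h.2 (x := (a, l)) ⟨ha, hl⟩ (y := (b, l)) ⟨hb, hl⟩ hs ht hst
  simpa [← add_smul, hst] using this

/-- Concavity covers the interior. At `xlo` the function is squeezed between `xlo` and the identity,
at `xhi` between its chord and `l xhi`. -/
theorem Lam.continuousOn (hM : M.StandingAssumptions) (hl : l ∈ M.Lam) :
    ContinuousOn l M.types := by
  have hlt := hM.xlo_lt_xhi
  intro x hx
  rcases hx.1.eq_or_lt with rfl | hx1
  · have hid : Filter.Tendsto (fun x : ℝ => x) (nhdsWithin M.xlo M.types) (nhds M.xlo) :=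
      Filter.tendsto_id.mono_left nhdsWithin_le_nhds
    unfold ContinuousWithinAt
    rw [hl.2.2.1]
    refine tendsto_of_tendsto_of_tendsto_of_le_of_le' tendsto_const_nhds hid ?_ ?_
    · filter_upwards [self_mem_nhdsWithin] with z hz using Lam.lo_le hM hl hz
    · filter_upwards [self_mem_nhdsWithin] with z hz using hl.2.2.2 z hz
  rcases hx.2.eq_or_lt with rfl | hx2
  · have hlin : Filter.Tendsto (fun z : ℝ => (M.xhi - z) / (M.xhi - M.xlo) * M.xlo
        + (z - M.xlo) / (M.xhi - M.xlo) * l M.xhi) (nhdsWithin M.xhi M.types)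
        (nhds (l M.xhi)) := by
      have hc : Continuous (fun z : ℝ => (M.xhi - z) / (M.xhi - M.xlo) * M.xlo
        + (z - M.xlo) / (M.xhi - M.xlo) * l M.xhi) := by fun_prop
      have := hc.tendsto M.xhi
      simp only [sub_self, zero_div, zero_mul, zero_add,
        div_self (sub_pos.2 hlt).ne', one_mul] at this
      exact this.mono_left nhdsWithin_le_nhds
    refine tendsto_of_tendsto_of_tendsto_of_le_of_le' hlin tendsto_const_nhds ?_ ?_
    · filter_upwards [self_mem_nhdsWithin] with z hz
      have hpos := sub_pos.2 hlt
      have hcv := hl.2.1.2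
      have := hcv (lo_mem hM) (hi_mem hM) (a := (M.xhi - z) / (M.xhi - M.xlo))
        (b := (z - M.xlo) / (M.xhi - M.xlo)) (div_nonneg (sub_nonneg.2 hz.2) hpos.le)
        (div_nonneg (sub_nonneg.2 hz.1) hpos.le) (by field_simp; ring)
      simp only [smul_eq_mul, hl.2.2.1] at this
      refine this.trans (le_of_eq (congrArg l ?_))
      field_simp
      ring
    · filter_upwards [self_mem_nhdsWithin] with z hz using hl.1 hz (hi_mem hM) hz.2
  · have hint : x ∈ interior M.types := by
      rw [types, interior_Icc]; exact ⟨hx1, hx2⟩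
    exact ((hl.2.1.continuousOn_interior).continuousAt
      (isOpen_interior.mem_nhds hint)).continuousWithinAt

theorem exists_beta_binding (hM : M.StandingAssumptions) (hl : l ∈ M.Lam) {y e : ℝ}
    (hb : 0 < M.beta l y e) :
    ∃ x ∈ M.types, l x - l y - M.uA e = M.beta l y e * (x + M.τ) := by
  have hc : ContinuousOn (fun x => (l x - l y - M.uA e) / (x + M.τ)) M.types := by
    refine ContinuousOn.div ?_ (by fun_prop) fun x hx => (add_tau_pos hM hx).ne'
    have := Lam.continuousOn hM hl
    fun_prop
  obtain ⟨x, hx, hmax⟩ := isCompact_Icc.exists_isMaxOn ⟨_, lo_mem hM⟩ hc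
  refine ⟨x, hx, ?_⟩
  have hg : IsGreatest ((fun x => (l x - l y - M.uA e) / (x + M.τ)) '' M.types)
      ((l x - l y - M.uA e) / (x + M.τ)) := by
    refine ⟨⟨x, hx, rfl⟩, ?_⟩
    rintro _ ⟨z, hz, rfl⟩
    exact hmax hz
  have hbeta : M.beta l y e = max 0 ((l x - l y - M.uA e) / (x + M.τ)) := by
    unfold beta; rw [hg.csSup_eq]
  rw [hbeta] at hb ⊢
  rw [max_eq_right ((lt_max_iff.1 hb).resolve_left (lt_irrefl _)).le,
    div_mul_cancel₀ _ (add_tau_pos hM hx).ne']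

end Maximizers

end TaxModel

/-! ### Uniqueness of the maximizing effort. -/

namespace TaxModel

variable {M : TaxModel} {m : TaxMechanism} {l : ℝ → ℝ}

section Unique

theorem pi3_smooth_hasDerivAt (hM : M.StandingAssumptions) (v k T : ℝ) {e : ℝ}
    (he : e ∈ Ioo (0 : ℝ) 1) (hp : (k - M.uA e) / T ∈ Ioo (0 : ℝ) 1) :
    HasDerivAt (fun e => v - M.cA e - (1 - e) * M.cP ((k - M.uA e) / T))
      (M.cP ((k - M.uA e) / T) - dUnit M.cA e
        + (1 - e) * dUnit M.cP ((k - M.uA e) / T) * dUnit M.uA e / T) e := by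
  have h1 := (hM.costA.hasDerivAt he).const_sub v
  have h2 := (hM.costP.hasDerivAt hp).comp e
    (((uA_hasDerivAt hM he).const_sub k).div_const T)
  have h3 := ((hasDerivAt_id e).const_sub 1).mul h2
  refine (h1.sub h3).congr_deriv ?_
  simp only [Function.comp_apply, id]
  ring

/-- Condition (ii) makes the second derivative negative at a point with `c_A'' ≠ 0`. A local minimum
would then also be a local maximum, so the function would be locally constant there. -/
theorem not_isLocalMin_pi3_smooth (hM : M.StandingAssumptions) (v k T : ℝ) {e : ℝ}
    (he : e ∈ Ioo (0 : ℝ) 1) (hp : (k - M.uA e) / T ∈ Ioo (0 : ℝ) 1) (hT : M.xlo + M.τ ≤ T)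
    (hc : dUnit (dUnit M.cA) e ≠ 0) :
    ¬ IsLocalMin (fun e => v - M.cA e - (1 - e) * M.cP ((k - M.uA e) / T)) e := by
  intro hmin
  set S := fun e => v - M.cA e - (1 - e) * M.cP ((k - M.uA e) / T) with hS
  set p := (k - M.uA e) / T with hpdef
  have he' := Ioo_subset_Icc_self he
  have hp' := Ioo_subset_Icc_self hp
  have hlo := hM.xlo_nonneg
  have hτ := hM.tau_pos
  have hTpos : 0 < T := by linarith
  have hc2 : 0 < dUnit (dUnit M.cA) e :=
    lt_of_le_of_ne (hM.costA.deriv_two_nonneg e) (Ne.symm hc)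
  have huA := uA_hasDerivAt hM he
  have hpe : ∀ᶠ z in nhds e, (k - M.uA z) / T ∈ Ioo (0 : ℝ) 1 :=
    ((huA.continuousAt.const_sub k).div_const T).eventually_mem (isOpen_Ioo.mem_nhds hp)
  have hderiv : deriv S =ᶠ[nhds e] fun z => M.cP ((k - M.uA z) / T) - dUnit M.cA z
        + (1 - z) * dUnit M.cP ((k - M.uA z) / T) * (z * dUnit (dUnit M.cA) z) / T := by
    filter_upwards [hpe, isOpen_Ioo.mem_nhds he] with z hz hz1
    rw [(pi3_smooth_hasDerivAt hM v k T hz1 hz).deriv, dUnit_uA hM (Ioo_subset_Icc_self hz1)]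
  have hcA2 := (hM.costA.hasDeriv_two he').hasDerivAt (Icc_mem_nhds he.1 he.2)
  have hcA3 := (hM.costA.hasDeriv_three he').hasDerivAt (Icc_mem_nhds he.1 he.2)
  have hcP2 := (hM.costP.hasDeriv_two hp').hasDerivAt (Icc_mem_nhds hp.1 hp.2)
  have hin := (huA.const_sub k).div_const T
  have hdd := ((((hM.costP.hasDerivAt hp).comp e hin).sub hcA2).add
    ((((((hasDerivAt_id e).const_sub 1).mul (hcP2.comp e hin)).mul
      ((hasDerivAt_id e).mul hcA3))).div_const T))
  have hdS := hdd.congr_of_eventuallyEq hderiv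
  simp only [Function.comp_apply, id, dUnit_uA hM he', ← hpdef] at hdS
  have hreg := hM.regularity e he'
  have hcP1 : 0 < dUnit M.cP p := hM.costP.deriv_pos ⟨hp.1, hp.2.le⟩
  have hcP1' : dUnit M.cP p ≤ dUnit M.cP 1 :=
    hM.costP.strictMono_deriv.monotoneOn hp' (right_mem_Icc.2 zero_le_one) hp.2.le
  have hcPP := hM.costP.deriv_two_nonneg p
  set a := dUnit (dUnit M.cA) e with ha
  set b := dUnit (dUnit (dUnit M.cA)) e with hb
  set q := dUnit M.cP p with hq
  set r := dUnit (dUnit M.cP) p with hr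
  have hTq : (M.xlo + M.τ) / dUnit M.cP 1 ≤ T / q :=
    div_le_div₀ hTpos.le hT hcP1 hcP1'
  -- Condition (ii) multiplied by `c_A''(e)`, with `(xlo + τ) / c_P'(1)` enlarged to `T / q`.
  have hreg2 : e * (1 - e) * b + (1 - e) * a < T / q * a + e * a := by
    have h := mul_lt_mul_of_pos_right (hreg.trans_le' le_rfl : _ > _) hc2
    have h5 : (e * (1 - e) * (b / a) + (1 - e)) * a = e * (1 - e) * b + (1 - e) * a := by
      field_simp
    rw [h5] at h
    have h6 := mul_le_mul_of_nonneg_right hTq hc2.le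
    linarith
  have hreg3 : q * (e * (1 - e) * b + (1 - e) * a) < T * a + q * (e * a) := by
    have h := mul_lt_mul_of_pos_left hreg2 hcP1
    have : q * (T / q * a + e * a) = T * a + q * (e * a) := by field_simp
    linarith
  have hneg : deriv (deriv S) e < 0 := by
    rw [hdS.deriv]
    have h7 : 0 ≤ (1 - e) * r * (e * a) ^ 2 / T :=
      div_nonneg (mul_nonneg (mul_nonneg (by linarith [he.2]) hcPP) (sq_nonneg _)) hTpos.le
    have h8 : 0 ≤ q * (e * a) :=
      mul_nonneg hcP1.le (mul_nonneg he.1.le hc2.le)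
    have key : q * (-(e * a) / T) - a + ((-1 * q + (1 - e) * (r * (-(e * a) / T))) * (e * a) +
        (1 - e) * q * (1 * a + e * b)) / T
        = (q * (e * (1 - e) * b + (1 - e) * a) - T * a - q * (e * a) - q * (e * a)) / T
          - (1 - e) * r * (e * a) ^ 2 / T / T := by
      field_simp
      ring
    have h9 : (q * (e * (1 - e) * b + (1 - e) * a) - T * a - q * (e * a) - q * (e * a)) / T < 0 :=
      div_neg_of_neg_of_pos (by linarith) hTpos
    have h10 := div_nonneg h7 hTpos.le
    refine lt_of_eq_of_lt key (by linarith)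
  have hmax : IsLocalMax S e := isLocalMax_of_deriv_deriv_neg hneg hmin.deriv_eq_zero
    (pi3_smooth_hasDerivAt hM v k T he hp).continuousAt
  have hconst : S =ᶠ[nhds e] fun _ => S e := by
    filter_upwards [hmin, hmax] with z h1 h2 using le_antisymm h2 h1
  have := hconst.deriv.deriv_eq
  rw [this] at hneg
  simp at hneg

/-- Concavity makes `piMin` constant between two maximizers. Since `pi1` and `pi2` are strictly
concave in effort, strictly between them only `pi3` can attain the minimum. Freezing the point where
`beta` binds gives a smooth majorant of `pi3` near `e` that touches it at `e`, hence has a local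
minimum, which the second-order condition excludes. -/
theorem eq_of_isMaxOn_piMin (hM : M.StandingAssumptions) (hconc : M.GlobalConcavity)
    (hl : l ∈ M.Lam) {y e₁ e₂ : ℝ} (hy : y ∈ M.types) (h₁ : e₁ ∈ Icc (0 : ℝ) 1)
    (h₂ : e₂ ∈ Icc (0 : ℝ) 1) (hm₁ : IsMaxOn (M.piMin l y) (Icc 0 1) e₁)
    (hm₂ : IsMaxOn (M.piMin l y) (Icc 0 1) e₂) : e₁ = e₂ := by
  wlog hle : e₁ ≤ e₂ generalizing e₁ e₂
  · exact (this h₂ h₁ hm₂ hm₁ (le_of_not_ge hle)).symm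
  by_contra hne
  have hlt : e₁ < e₂ := lt_of_le_of_ne hle hne
  obtain ⟨ebar, -, hbar, hcc⟩ := hconc
  have hcon := GlobalConcavity.concaveOn_piMin (hcc y hy) hl
  set c := M.piMin l y e₁ with hcdef
  have hc2 : M.piMin l y e₂ = c := le_antisymm (hm₁ h₂) (hm₂ h₁)
  have hge : ∀ e ∈ Icc e₁ e₂, c ≤ M.piMin l y e := by
    intro e he
    have := hcon.min_le_of_mem_Icc ⟨h₁.1, hbar y hy l hl e₁ h₁ hm₁⟩
      ⟨h₂.1, hbar y hy l hl e₂ h₂ hm₂⟩ he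
    rwa [hc2, ← hcdef, min_self] at this
  have hsub : Icc e₁ e₂ ⊆ Icc 0 1 := Icc_subset_Icc h₁.1 h₂.2
  obtain ⟨e, he, hce⟩ := hM.costA.exists_deriv_two_ne_zero h₁.1 hlt h₂.2
  have he1 : e ∈ Icc (0 : ℝ) 1 := hsub (Ioo_subset_Icc_self he)
  have he' : e ∈ Ioo (0 : ℝ) 1 := ⟨h₁.1.trans_lt he.1, he.2.trans_le h₂.2⟩
  have hval : M.piMin l y e = c :=
    le_antisymm (hm₁ he1) (hge e (Ioo_subset_Icc_self he))
  obtain ⟨s, t, hs, ht, hst, hcomb⟩ : ∃ s t : ℝ, 0 < s ∧ 0 < t ∧ s + t = 1 ∧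
      s * e₁ + t * e₂ = e := by
    have hpos : 0 < e₂ - e₁ := sub_pos.2 hlt
    refine ⟨(e₂ - e) / (e₂ - e₁), (e - e₁) / (e₂ - e₁), div_pos (sub_pos.2 he.2) hpos,
      div_pos (sub_pos.2 he.1) hpos, ?_, ?_⟩
    · field_simp; ring
    · field_simp; ring
  have h11 : c ≤ M.pi1 l y e₁ := min_le_left _ _
  have h12 : c ≤ M.pi1 l y e₂ := hc2.symm.le.trans (min_le_left _ _)
  have h21 : c ≤ M.pi2 l y e₁ := (min_le_right _ _).trans (min_le_left _ _)
  have h22 : c ≤ M.pi2 l y e₂ :=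
    hc2.symm.le.trans ((min_le_right _ _).trans (min_le_left _ _))
  have hsum : s * c + t * c = c := by rw [← add_mul, hst, one_mul]
  have hp1 : c < M.pi1 l y e := by
    have hsc := hM.rent_regularity.2 h₁ h₂ hne hs ht hst
    simp only [smul_eq_mul, hcomb] at hsc
    have ha := mul_le_mul_of_nonneg_left h11 hs.le
    have hb := mul_le_mul_of_nonneg_left h12 ht.le
    unfold pi1 uA at ha hb ⊢
    have hid : s * (y - (e₁ * dUnit M.cA e₁ - M.cA e₁) - M.cA e₁
          - (1 - e₁) * M.cP (M.alpha l y))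
        + t * (y - (e₂ * dUnit M.cA e₂ - M.cA e₂) - M.cA e₂ - (1 - e₂) * M.cP (M.alpha l y))
        = (s + t) * y - (s * (e₁ * dUnit M.cA e₁) + t * (e₂ * dUnit M.cA e₂))
          - ((s + t) - (s * e₁ + t * e₂)) * M.cP (M.alpha l y) := by ring
    rw [hst, hcomb] at hid
    linarith
  have hp2 : c < M.pi2 l y e := by
    have hsc := hM.costA.strictConvex.2 h₁ h₂ hne hs ht hst
    simp only [smul_eq_mul, hcomb] at hsc
    have ha := mul_le_mul_of_nonneg_left h21 hs.le
    have hb := mul_le_mul_of_nonneg_left h22 ht.le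
    unfold pi2 at ha hb ⊢
    have hid : s * (l y - M.cA e₁ - (1 - e₁) * M.cP (M.alpha l y))
        + t * (l y - M.cA e₂ - (1 - e₂) * M.cP (M.alpha l y))
        = (s + t) * l y - (s * M.cA e₁ + t * M.cA e₂)
          - ((s + t) - (s * e₁ + t * e₂)) * M.cP (M.alpha l y) := by ring
    rw [hst, hcomb] at hid
    linarith
  have hp3 : M.pi3 l y e = c := by
    have h : M.piMin l y e = min (M.pi1 l y e) (min (M.pi2 l y e) (M.pi3 l y e)) := rfl
    rw [hval] at h
    rcases min_choice (M.pi1 l y e) (min (M.pi2 l y e) (M.pi3 l y e)) with h' | h' <;>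
      rw [h'] at h
    · exact absurd h hp1.ne
    · rcases min_choice (M.pi2 l y e) (M.pi3 l y e) with h'' | h'' <;> rw [h''] at h
      · exact absurd h hp2.ne
      · exact h.symm
  -- With a zero audit probability `pi3` would be at least `pi2`, contradicting `pi2 > c = pi3`.
  have hβ : 0 < M.beta l y e := by
    by_contra! hcon
    have hβ0 : M.beta l y e = 0 := le_antisymm hcon (beta_nonneg _ _ _)
    have hα := mul_nonneg (show 0 ≤ 1 - e by linarith [he'.2])
      (hM.costP.nonneg ⟨alpha_nonneg l y, alpha_le_one hy hl.2.2.2⟩)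
    rw [← hp3] at hp2
    unfold pi2 pi3 at hp2
    rw [hβ0, hM.costP.zero] at hp2
    linarith
  obtain ⟨x, hx, hbind⟩ := exists_beta_binding hM hl hβ
  have hxτ := add_tau_pos hM hx
  have hβeq : (l x - l y - M.uA e) / (x + M.τ) = M.beta l y e := by
    rw [hbind, mul_div_cancel_right₀ _ hxτ.ne']
  have hp : (l x - l y - M.uA e) / (x + M.τ) ∈ Ioo (0 : ℝ) 1 := by
    refine ⟨by rwa [hβeq], ?_⟩
    rw [div_lt_one hxτ]
    linarith [hl.2.2.2 x hx, Lam.lo_le hM hl hy, hM.xlo_nonneg, uA_nonneg hM he1, hM.tau_pos]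
  refine not_isLocalMin_pi3_smooth hM (l y) (l x - l y) (x + M.τ) he' hp
    (by linarith [hx.1]) hce ?_
  have hpe : ∀ᶠ z in nhds e, (l x - l y - M.uA z) / (x + M.τ) ∈ Ioo (0 : ℝ) 1 :=
    (((uA_hasDerivAt hM he').continuousAt.const_sub _).div_const _).eventually_mem
      (isOpen_Ioo.mem_nhds hp)
  filter_upwards [hpe, isOpen_Ioo.mem_nhds he] with z hz hz1
  have hz2 := hsub (Ioo_subset_Icc_self hz1)
  have h1 := (hge z (Ioo_subset_Icc_self hz1)).trans
    ((min_le_right _ _).trans (min_le_right _ _))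
  have h2 : (l x - l y - M.uA z) / (x + M.τ) ≤ M.beta l y z := by
    rw [div_le_iff₀ hxτ]; exact le_beta_line hM hl hy hz2 hx
  have h3 := mul_le_mul_of_nonneg_left
    (hM.costP.monotone hz.1.le h2 (beta_le_one hM hl hy hz2)) (show 0 ≤ 1 - z by linarith [hz2.2])
  unfold pi3 at h1 hp3
  rw [hβeq]
  linarith

end Unique

end TaxModel

/-! ### Stationarity of the maximizing effort by region. -/

namespace TaxModel

variable {M : TaxModel} {m : TaxMechanism} {l : ℝ → ℝ}

section Stationarity

theorem eventually_nhds_of_uA {e : ℝ} (hM : M.StandingAssumptions) (he : e ∈ Ioo (0 : ℝ) 1)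
    {a : ℝ} (h : M.uA e < a) : ∀ᶠ z in nhds e, M.uA z < a :=
  (uA_hasDerivAt hM he).continuousAt.eventually (gt_mem_nhds h)

/-- On Low, `piMin` has a kink in effort: raising effort lowers `d₁` and moves onto `pi1`, while
lowering it moves onto `pi2`. Only one-sided conditions hold; this is the right-hand one. -/
theorem cP_alpha_le_of_low (hM : M.StandingAssumptions) (hl : l ∈ M.Lam) {y e : ℝ}
    (hy : y ∈ M.types) (he : e ∈ Ioo (0 : ℝ) 1) (hmax : IsMaxOn (M.piMin l y) (Icc 0 1) e)
    (h1 : y - M.uA e - l y = 0) :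
    M.cP (M.alpha l y) ≤ dUnit M.cA e + dUnit M.uA e := by
  have he' := Ioo_subset_Icc_self he
  have := hasDerivAt_nonpos_of_eventually_le (pi1_hasDerivAt hM l y he) ?_
  · linarith
  filter_upwards [self_mem_nhdsWithin,
    nhdsWithin_le_nhds (isOpen_Ioo.mem_nhds he)] with z hz hz1
  have hz' := Ioo_subset_Icc_self hz1
  have hu := uA_monotoneOn hM he' hz' (le_of_lt hz)
  rw [← piMin_eq_pi1 hM hl hy hz' (by linarith), ← piMin_eq_pi1 hM hl hy he' h1.le]
  exact hmax hz'

theorem cP_alpha_le_of_middle_high (hM : M.StandingAssumptions) (hl : l ∈ M.Lam) {y e : ℝ}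
    (hy : y ∈ M.types) (he : e ∈ Ioo (0 : ℝ) 1) (hmax : IsMaxOn (M.piMin l y) (Icc 0 1) e)
    (h1 : 0 < y - M.uA e - l y)
    (h2 : (1 - M.alpha l y) * y - M.uA e - l y - M.alpha l y * M.τ ≤ 0) :
    M.cP (M.alpha l y) ≤ dUnit M.cA e := by
  have he' := Ioo_subset_Icc_self he
  have := hasDerivAt_nonpos_of_eventually_le (pi2_hasDerivAt hM l y he) ?_
  · linarith
  filter_upwards [self_mem_nhdsWithin, nhdsWithin_le_nhds (isOpen_Ioo.mem_nhds he),
    nhdsWithin_le_nhds (eventually_nhds_of_uA hM he (a := y - l y) (by linarith))] with z hz hz1 hz2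
  have hz' := Ioo_subset_Icc_self hz1
  have hu := uA_monotoneOn hM he' hz' (le_of_lt hz)
  rw [← piMin_eq_pi2 hM hl hy hz' (by linarith) (by linarith),
    ← piMin_eq_pi2 hM hl hy he' h1.le h2]
  exact hmax hz'

theorem le_cP_alpha_of_low_middle (hM : M.StandingAssumptions) (hl : l ∈ M.Lam) {y e : ℝ}
    (hy : y ∈ M.types) (he : e ∈ Ioo (0 : ℝ) 1) (hmax : IsMaxOn (M.piMin l y) (Icc 0 1) e)
    (h1 : 0 ≤ y - M.uA e - l y)
    (h2 : (1 - M.alpha l y) * y - M.uA e - l y - M.alpha l y * M.τ < 0) :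
    dUnit M.cA e ≤ M.cP (M.alpha l y) := by
  have he' := Ioo_subset_Icc_self he
  have := hasDerivAt_nonneg_of_eventually_le (pi2_hasDerivAt hM l y he) ?_
  · linarith
  have hcont : ∀ᶠ z in nhds e, (1 - M.alpha l y) * y - l y - M.alpha l y * M.τ < M.uA z :=
    (uA_hasDerivAt hM he).continuousAt.eventually (lt_mem_nhds (by linarith))
  filter_upwards [self_mem_nhdsWithin, nhdsWithin_le_nhds (isOpen_Ioo.mem_nhds he),
    nhdsWithin_le_nhds hcont] with z hz hz1 hz2
  have hz' := Ioo_subset_Icc_self hz1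
  have hu := uA_monotoneOn hM hz' he' (le_of_lt hz)
  rw [← piMin_eq_pi2 hM hl hy hz' (by linarith) (by linarith),
    ← piMin_eq_pi2 hM hl hy he' h1 h2.le]
  exact hmax hz'

/-- Left stationarity where the two audit constraints coincide, with a tangency point `x` of the
line through `(y, y)` whose left neighbours `w` are strictly below that line. -/
theorem le_cP_alpha_of_high_aux (hM : M.StandingAssumptions) (hl : l ∈ M.Lam) {y e x w : ℝ}
    (hy : y ∈ M.types) (he : e ∈ Ioo (0 : ℝ) 1) (hmax : IsMaxOn (M.piMin l y) (Icc 0 1) e)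
    (h2 : (1 - M.alpha l y) * y - M.uA e - l y - M.alpha l y * M.τ = 0)
    (hα : M.alpha l y ∈ Ioo (0 : ℝ) 1) (hx : x ∈ M.types) (hw : w ∈ M.types) (hwx : w < x)
    (hbind : l x = y + M.alpha l y * (x - y)) (hlt : l w < y + M.alpha l y * (w - y)) :
    dUnit M.cA e ≤ M.cP (M.alpha l y)
      + (1 - e) * dUnit M.cP (M.alpha l y) * dUnit M.uA e / (w + M.τ) := by
  have he' := Ioo_subset_Icc_self he
  set p := M.alpha l y with hp
  have hwτ := add_tau_pos hM hw
  have hβ : M.beta l y e = p :=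
    le_antisymm (beta_le_alpha hM hl hy he' h2.le) (alpha_le_beta hM hl hy he' h2.ge)
  -- This `k` makes the frozen audit probability equal `p` at `e`.
  set k := p * (w + M.τ) + M.uA e with hk
  have hke : (k - M.uA e) / (w + M.τ) = p := by
    rw [hk, add_sub_cancel_right, mul_div_cancel_right₀ _ hwτ.ne']
  have hd := pi3_smooth_hasDerivAt hM (l y) k (w + M.τ) he (by rwa [hke])
  have := hasDerivAt_nonneg_of_eventually_le hd ?_
  · rw [hke] at this
    linarith
  have hpe : ∀ᶠ z in nhds e, (k - M.uA z) / (w + M.τ) ∈ Ioo (0 : ℝ) 1 :=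
    (((uA_hasDerivAt hM he).continuousAt.const_sub _).div_const _).eventually_mem
      (isOpen_Ioo.mem_nhds (by rwa [hke]))
  have hη : ∀ᶠ z in nhds e, M.uA e - (y + p * (w - y) - l w) < M.uA z :=
    (uA_hasDerivAt hM he).continuousAt.eventually (lt_mem_nhds (by linarith))
  filter_upwards [self_mem_nhdsWithin, nhdsWithin_le_nhds (isOpen_Ioo.mem_nhds he),
    nhdsWithin_le_nhds hpe, nhdsWithin_le_nhds hη] with z hz hz1 hz2 hz3
  have hz' := Ioo_subset_Icc_self hz1
  have hu := uA_monotoneOn hM hz' he' (le_of_lt hz)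
  -- Lowering effort raises the required audit probability by at most the rate at `w`. Points right
  -- of `w` require a smaller increase; at points left of `w`, by concavity, the slack below the
  -- `alpha` line is at least the slack at `w`, which absorbs the change in rent.
  have hβz : M.beta l y z ≤ (k - M.uA z) / (w + M.τ) := by
    refine beta_le_of_forall hM hz2.1.le fun v hv => ?_
    have hkz : (k - M.uA z) / (w + M.τ) = p + (M.uA e - M.uA z) / (w + M.τ) := by
      rw [← hke, ← add_div]; ring
    have hr : 0 ≤ (M.uA e - M.uA z) / (w + M.τ) := div_nonneg (by linarith) hwτ.le
    have hrw : (M.uA e - M.uA z) / (w + M.τ) * (w + M.τ) = M.uA e - M.uA z :=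
      div_mul_cancel₀ _ hwτ.ne'
    rw [hkz]
    rcases le_total w v with hwv | hvw
    · have h3 := le_beta_line hM hl hy he' hv
      rw [hβ] at h3
      have h4 := mul_le_mul_of_nonneg_left (show w + M.τ ≤ v + M.τ by linarith) hr
      linarith
    · have h5 : l v - (y + p * (v - y)) ≤ l w - (y + p * (w - y)) := by
        rcases hvw.eq_or_lt with rfl | hvw
        · exact le_rfl
        have hvx : 0 < x - v := by linarith
        have hcv := hl.2.1.2
        have := hcv hv hx (a := (x - w) / (x - v)) (b := (w - v) / (x - v))
          (div_nonneg (by linarith) hvx.le) (div_nonneg (by linarith) hvx.le)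
          (by field_simp; ring)
        simp only [smul_eq_mul] at this
        have hcomb : (x - w) / (x - v) * v + (w - v) / (x - v) * x = w := by field_simp; ring
        rw [hcomb, hbind] at this
        have hpos : 0 < x - w := by linarith
        have h6 : (x - w) / (x - v) * (l v - (y + p * (v - y)))
            ≤ l w - (y + p * (w - y)) := by
          refine le_trans (le_of_eq ?_) (sub_le_sub_right this _)
          field_simp
          ring
        have h7 : (x - w) / (x - v) ≤ 1 := by rw [div_le_one hvx]; linarith
        have h8 : (x - w) / (x - v) * (l v - (y + p * (v - y))) < 0 := by linarith
        have h9 : l v - (y + p * (v - y)) < 0 := by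
          by_contra! hc
          exact h8.not_ge (mul_nonneg (div_nonneg hpos.le hvx.le) hc)
        nlinarith
      have h10 := mul_nonneg hr (add_tau_pos hM hv).le
      have h11 : l v - l y - M.uA e = p * (v + M.τ) + (l v - (y + p * (v - y))) := by
        linarith
      linarith
  have h12 := mul_le_mul_of_nonneg_left
    (hM.costP.monotone (beta_nonneg _ _ _) hβz hz2.2.le) (show 0 ≤ 1 - z by linarith [hz'.2])
  have h13 := hmax hz'
  rw [mem_ofPred_eq, piMin_eq_pi3 hM hl hy hz' (by linarith),
    piMin_eq_pi3 hM hl hy he' h2.ge] at h13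
  unfold pi3 at h13
  rw [hβ] at h13
  rw [hke]
  linarith

end Stationarity

/-! ### Audits, refunds and binding constraints of a tight mechanism. -/

section Tight

theorem IsTight.eA_lt_one (hM : M.StandingAssumptions) (hm : M.IsTight m) {y : ℝ}
    (hy : y ∈ M.types) : m.eA y < 1 :=
  lt_one_of_isMaxOn hM (hm.loss_mem_Lam hM) hy (hm.1.1 y hy).1 (hm.isMaxOn hM hy)

/-- Both lower bounds on `e_P` hold for any mechanism with effort below one. Conversely the profit
equals `piMin`, which charges at most `c_P` of the larger bound, and the weight `1 - e_A` is
positive. -/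
theorem IsTight.eP_eq (hM : M.StandingAssumptions) (hm : M.IsTight m) {y : ℝ}
    (hy : y ∈ M.types) :
    m.eP y = max (M.alpha (M.loss m) y) (M.beta (M.loss m) y (m.eA y)) := by
  have hl := hm.loss_mem_Lam hM
  have hh := isLamHull_self hl
  have h1 := hm.eA_lt_one hM hy
  obtain ⟨hA, hP, -, hrP, hN⟩ := hm.1.1 y hy
  have hge := max_le (hh.alpha_le hM hm.1 hy) (hh.beta_le hM hm.1 hy h1)
  refine le_antisymm ?_ hge
  have hmax0 := (alpha_nonneg (M.loss m) y).trans
    (le_max_left (M.alpha (M.loss m) y) (M.beta (M.loss m) y (m.eA y)))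
  rw [← hM.costP.strictMono.le_iff_le hP ⟨hmax0, hge.trans hP.2⟩]
  have hprof := hm.profit_eq hM hy
  have hIC := hm.1.2.2 y hy
  have hR : 0 ≤ RNA m y := add_nonneg (mul_nonneg hP.1 hrP.1)
    (mul_nonneg (by linarith [hP.2]) hN.1)
  have ha := mul_le_mul_of_nonneg_left (hM.costP.monotone (alpha_nonneg (M := M) (M.loss m) y)
    (le_max_left _ (M.beta (M.loss m) y (m.eA y))) (hge.trans hP.2))
    (show 0 ≤ 1 - m.eA y by linarith)
  refine le_of_mul_le_mul_left ?_ (show 0 < 1 - m.eA y by linarith)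
  unfold piMin at hprof
  rw [min_pi2_pi3 hM hl hy hA] at hprof
  unfold utility at hIC
  unfold profit at hprof
  rw [evidenceRent_eq_uA hM hm.1 hy h1] at hprof hIC
  rcases min_choice (M.pi1 (M.loss m) y (m.eA y)) (M.loss m y - M.cA (m.eA y) - (1 - m.eA y) *
    M.cP (max (M.alpha (M.loss m) y) (M.beta (M.loss m) y (m.eA y)))) with h | h <;>
  rw [h] at hprof
  · unfold pi1 at hprof
    linarith
  · linarith

theorem IsTight.eA_pos (hM : M.StandingAssumptions) (hm : M.IsTight m) {y : ℝ}
    (hy : y ∈ M.types) (hp : 0 < m.eP y) : 0 < m.eA y :=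
  pos_of_isMaxOn hM (hm.loss_mem_Lam hM) hy (hm.1.1 y hy).1 (hm.isMaxOn hM hy)
    (by rwa [← hm.eP_eq hM hy])

theorem IsTight.RNA_le (hM : M.StandingAssumptions) (hm : M.IsTight m) {y : ℝ}
    (hy : y ∈ M.types) (hd : 0 ≤ y - M.uA (m.eA y) - M.loss m y) :
    RNA m y ≤ y - M.uA (m.eA y) - M.loss m y := by
  have hl := hm.loss_mem_Lam hM
  have h1 := hm.eA_lt_one hM hy
  obtain ⟨hA, hP, -, hrP, hN⟩ := hm.1.1 y hy
  have hprof := hm.profit_eq hM hy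
  have heP := hm.eP_eq hM hy
  have ha := mul_le_mul_of_nonneg_left (hM.costP.monotone (alpha_nonneg (M := M) (M.loss m) y)
    (le_max_left _ (M.beta (M.loss m) y (m.eA y))) (heP ▸ hP.2))
    (show 0 ≤ 1 - m.eA y by linarith)
  unfold piMin at hprof
  rw [min_pi2_pi3 hM hl hy hA, min_eq_right (by unfold pi1; linarith), ← heP] at hprof
  unfold profit at hprof
  rw [evidenceRent_eq_uA hM hm.1 hy h1] at hprof
  linarith

/-- If the audit probability is the slope of the tangent from `(y, y)`, binding constraints are
tangency points. -/
theorem IsTight.loss_eq_of_bindingIC (hM : M.StandingAssumptions) (hm : M.IsTight m) {y x : ℝ}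
    (hy : y ∈ M.types) (hyx : y < M.xhi) (hp : m.eP y ∈ Ioo (0 : ℝ) 1)
    (hα : m.eP y = M.alpha (M.loss m) y) (hx : x ∈ M.bindingIC m y) :
    M.loss m x = y + m.eP y * (x - y) := by
  obtain ⟨-, hP, -, -, hN⟩ := hm.1.1 y hy
  have hδ := mul_nonneg (show 0 ≤ 1 - m.eP y by linarith [hP.2]) hN.1
  have hbind := hx.2
  unfold deviationLoss at hbind
  rcases hδ.eq_or_lt with h0 | hpos
  · linarith
  exfalso
  set δ := (1 - m.eP y) * m.rN y with hδdef
  have hlen : 0 < M.xhi - y := sub_pos.2 hyx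
  have hq : 0 < δ / (M.xhi - y) := div_pos hpos hlen
  have hmul : δ / (M.xhi - y) * (M.xhi - y) = δ := div_mul_cancel₀ _ hlen.ne'
  -- A positive `δ` would put the deviation line strictly below the `alpha` line, so a flatter line
  -- through `(y, y)` would still majorize the loss.
  have : M.alpha (M.loss m) y ≤ max 0 (m.eP y - δ / (M.xhi - y)) := by
    refine alpha_le_of_forall (le_max_left _ _) fun z hz => ?_
    have h1 := loss_le_deviationLoss hM hm.1.1 hy ⟨hz.1.le, hz.2⟩
    unfold deviationLoss at h1
    have h2 := mul_le_mul_of_nonneg_right (le_max_right 0 (m.eP y - δ / (M.xhi - y)))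
      (show 0 ≤ z - y by linarith [hz.1])
    have h3 := mul_le_mul_of_nonneg_left (show z - y ≤ M.xhi - y by linarith [hz.2]) hq.le
    linarith
  rw [← hα] at this
  rcases le_max_iff.1 this with h | h
  · exact h.not_gt hp.1
  · linarith

/-- At a point `x₀` where `beta` binds, feasibility of the deviation forces the largest refund `r_P
= y + τ`. The deviation loss is then the `beta` line itself, so every binding constraint lies on it.
-/
theorem IsTight.loss_eq_of_bindingIC_superHigh (hM : M.StandingAssumptions) (hm : M.IsTight m)
    {y x : ℝ} (hy : y ∈ M.types) (hp : m.eP y ∈ Ioo (0 : ℝ) 1) (hd : 0 ≤ M.d2 m y)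
    (hx : x ∈ M.bindingIC m y) :
    M.loss m x - M.loss m y - M.uA (m.eA y) = m.eP y * (x + M.τ) := by
  have hl := hm.loss_mem_Lam hM
  have h1 := hm.eA_lt_one hM hy
  obtain ⟨hA, hP, -, hrP, hN⟩ := hm.1.1 y hy
  have hατ := mul_nonneg (alpha_nonneg (M := M) (M.loss m) y) (add_tau_pos hM hy).le
  unfold d2 at hd
  have hR := hm.RNA_le hM hy (by linarith)
  have hIC := hm.1.2.2 y hy
  unfold utility at hIC
  rw [evidenceRent_eq_uA hM hm.1 hy h1] at hIC
  have heP : M.beta (M.loss m) y (m.eA y) = m.eP y := by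
    rw [hm.eP_eq hM hy, max_eq_right (alpha_le_beta hM hl hy hA hd)]
  obtain ⟨x₀, hx₀, hb₀⟩ := exists_beta_binding hM hl (y := y) (e := m.eA y) (heP ▸ hp.1)
  rw [heP] at hb₀
  have hpos := mul_pos hp.1 (add_tau_pos hM hx₀)
  have hyx₀ : y ≤ x₀ := by
    by_contra! hlt
    linarith [hl.1 hx₀ hy hlt.le, uA_nonneg hM hA]
  have h2 := loss_le_deviationLoss hM hm.1.1 hy ⟨hyx₀, hx₀.2⟩
  have hbind := hx.2
  unfold deviationLoss at h2 hbind
  unfold RNA at hR hIC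
  have h3 : m.eP y * (y + M.τ) ≤ m.eP y * m.rP y := by linarith
  have h4 : m.rP y = y + M.τ := le_antisymm hrP.2 (le_of_mul_le_mul_left h3 hp.1)
  rw [h4] at hR hIC
  linarith

end Tight

end TaxModel

/-! ### Supergradient inequalities for `piMin`. -/

namespace TaxModel

variable {M : TaxModel} {m : TaxMechanism} {l l' : ℝ → ℝ}

section Supergradient

/-- Joint concavity of `(e, l) ↦ piMin l y e` on `[0, ebar] × Λ`. -/
def JointConcave (M : TaxModel) (ebar y : ℝ) : Prop :=
  ConcaveOn ℝ (Icc 0 ebar ×ˢ M.Lam) (fun p : ℝ × (ℝ → ℝ) => M.piMin p.2 y p.1)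

variable {ebar y e e' : ℝ}

/-- Along the segment, concavity bounds `t` times the total increment by the increment up to `t`,
hence by `W t - W 0`. Here `W` is a differentiable majorant touching at `0`, so `piMin` itself need
not be differentiable. -/
theorem JointConcave.sub_le_of_hasDerivAt (hcon : M.JointConcave ebar y) (hl : l ∈ M.Lam)
    (hl' : l' ∈ M.Lam) (he : e ∈ Icc 0 ebar) (he' : e' ∈ Icc 0 ebar) {W : ℝ → ℝ} {W' : ℝ}
    (hW : HasDerivAt W W' 0) (h0 : W 0 = M.piMin l y e)
    (hev : ∀ᶠ t in nhds (0 : ℝ), t ∈ Ioo (0 : ℝ) 1 → (1 - t) • l + t • l' ∈ M.Lam →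
      M.piMin ((1 - t) • l + t • l') y (e + t * (e' - e)) ≤ W t) :
    M.piMin l' y e' - M.piMin l y e ≤ W' := by
  have ht := (hasDerivWithinAt_iff_tendsto_slope' (by simp)).1
    (hW.hasDerivWithinAt (s := Ioi 0))
  refine ge_of_tendsto ht ?_
  filter_upwards [nhdsWithin_le_nhds hev, self_mem_nhdsWithin,
    nhdsWithin_le_nhds (gt_mem_nhds (zero_lt_one : (0 : ℝ) < 1))] with t h1 h2 h3
  have h2' : 0 < t := h2
  have h4 : 0 ≤ 1 - t := by linarith
  have hmem := hcon.1 (x := (e, l)) ⟨he, hl⟩ (y := (e', l')) ⟨he', hl'⟩ h4 h2'.le (by ring)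
  have h5 := h1 ⟨h2, h3⟩ hmem.2
  have h6 := hcon.2 (x := (e, l)) ⟨he, hl⟩ (y := (e', l')) ⟨he', hl'⟩ h4 h2'.le (by ring)
  simp only [smul_eq_mul, Prod.smul_mk, Prod.mk_add_mk] at h6
  rw [show (1 - t) * e + t * e' = e + t * (e' - e) by ring] at h6
  rw [slope_def_field, h0, le_div_iff₀ (by linarith)]
  linarith

theorem effort_hasDerivAt (e e' : ℝ) : HasDerivAt (fun t : ℝ => e + t * (e' - e)) (e' - e) 0 := by
  simpa using ((hasDerivAt_id (0 : ℝ)).mul_const (e' - e)).const_add e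

theorem comp_effort_hasDerivAt {f : ℝ → ℝ} {f' : ℝ} (hf : HasDerivAt f f' e) (e' : ℝ) :
    HasDerivAt (fun t : ℝ => f (e + t * (e' - e))) (f' * (e' - e)) 0 :=
  HasDerivAt.comp (0 : ℝ) (h₂ := f) (by simpa using hf) (effort_hasDerivAt e e')

theorem affine_hasDerivAt (a b : ℝ) : HasDerivAt (fun t : ℝ => a + t * b) b 0 := by
  simpa using ((hasDerivAt_id (0 : ℝ)).mul_const b).const_add a

/-- The bound on the audit probability along a segment given by a tangency point `x`. -/
theorem cP_alpha_segment (hM : M.StandingAssumptions) {x p t : ℝ}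
    (hy : y ∈ M.types) (hx : x ∈ Ioc y M.xhi) (hbind : l x = y + p * (x - y))
    (hmem : (1 - t) • l + t • l' ∈ M.Lam)
    (hp : 0 ≤ p + t * ((l' x - l x) / (x - y))) :
    M.cP (p + t * ((l' x - l x) / (x - y))) ≤ M.cP (M.alpha ((1 - t) • l + t • l') y) := by
  refine hM.costP.monotone hp ?_ (alpha_le_one hy hmem.2.2.2)
  have h := le_alpha_line hy hmem.2.2.2 (Ioc_subset_Icc_self hx)
  simp only [Pi.add_apply, Pi.smul_apply, smul_eq_mul] at h
  have hxy : 0 < x - y := sub_pos.2 hx.1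
  refine le_of_mul_le_mul_right ?_ hxy
  have h3 : (p + t * ((l' x - l x) / (x - y))) * (x - y) = p * (x - y) + t * (l' x - l x) := by
    field_simp
  rw [h3]
  linarith

theorem eventually_affine_mem {p a : ℝ} (hp : p ∈ Ioo (0 : ℝ) 1) :
    ∀ᶠ t in nhds (0 : ℝ), p + t * a ∈ Ioo (0 : ℝ) 1 :=
  (affine_hasDerivAt p a).continuousAt.eventually_mem (isOpen_Ioo.mem_nhds (by simpa using hp))

theorem eventually_effort_mem (he : e ∈ Ioo (0 : ℝ) 1) (e' : ℝ) :
    ∀ᶠ t in nhds (0 : ℝ), e + t * (e' - e) ∈ Ioo (0 : ℝ) 1 := eventually_affine_mem he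

theorem audit_hasDerivAt (hM : M.StandingAssumptions) {p a : ℝ} (hp : p ∈ Ioo (0 : ℝ) 1)
    (e e' : ℝ) :
    HasDerivAt (fun t => (1 - (e + t * (e' - e))) * M.cP (p + t * a))
      (-(e' - e) * M.cP p + (1 - e) * dUnit M.cP p * a) 0 := by
  have h1 := (effort_hasDerivAt e e').const_sub 1
  have h2 : HasDerivAt (fun t => M.cP (p + t * a)) (dUnit M.cP p * a) 0 :=
    HasDerivAt.comp (0 : ℝ) (h₂ := M.cP) (by simpa using hM.costP.hasDerivAt hp)
      (affine_hasDerivAt p a)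
  exact (h1.mul h2).congr_deriv (by simp; ring)

theorem JointConcave.sub_le_pi1 (hM : M.StandingAssumptions) (hcon : M.JointConcave ebar y)
    (hl : l ∈ M.Lam) (hl' : l' ∈ M.Lam) (he : e ∈ Icc 0 ebar) (he' : e' ∈ Icc 0 ebar)
    (heI : e ∈ Ioo (0 : ℝ) 1) {x p : ℝ} (hy : y ∈ M.types) (hx : x ∈ Ioc y M.xhi)
    (hp : p ∈ Ioo (0 : ℝ) 1) (hα : M.alpha l y = p) (hbind : l x = y + p * (x - y))
    (hpi : M.piMin l y e = M.pi1 l y e) :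
    M.piMin l' y e' - M.piMin l y e ≤ (e' - e) * (M.cP p - dUnit M.cA e - dUnit M.uA e)
      - (1 - e) * dUnit M.cP p / (x - y) * (l' x - l x) := by
  have hW := (((comp_effort_hasDerivAt (uA_hasDerivAt hM heI) e').const_sub y).sub
    (comp_effort_hasDerivAt (hM.costA.hasDerivAt heI) e')).sub
    (audit_hasDerivAt hM (a := (l' x - l x) / (x - y)) hp e e')
  refine (hcon.sub_le_of_hasDerivAt hl hl' he he' hW ?_ ?_).trans (le_of_eq ?_)
  · rw [hpi]; simp [pi1, hα]
  · filter_upwards [eventually_affine_mem (a := (l' x - l x) / (x - y)) hp,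
      eventually_effort_mem heI e'] with t h1 h2 _ hmem
    have h4 := mul_le_mul_of_nonneg_left
      (cP_alpha_segment hM hy hx hbind hmem h1.1.le) (sub_nonneg.2 h2.2.le)
    refine (min_le_left _ _).trans ?_
    simp only [pi1, Pi.sub_apply]
    linarith
  · ring

theorem JointConcave.sub_le_pi2 (hM : M.StandingAssumptions) (hcon : M.JointConcave ebar y)
    (hl : l ∈ M.Lam) (hl' : l' ∈ M.Lam) (he : e ∈ Icc 0 ebar) (he' : e' ∈ Icc 0 ebar)
    (heI : e ∈ Ioo (0 : ℝ) 1) {x p : ℝ} (hy : y ∈ M.types) (hx : x ∈ Ioc y M.xhi)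
    (hp : p ∈ Ioo (0 : ℝ) 1) (hα : M.alpha l y = p) (hbind : l x = y + p * (x - y))
    (hpi : M.piMin l y e = M.pi2 l y e) :
    M.piMin l' y e' - M.piMin l y e ≤ (e' - e) * (M.cP p - dUnit M.cA e)
      + (l' y - l y) - (1 - e) * dUnit M.cP p / (x - y) * (l' x - l x) := by
  have hW := ((affine_hasDerivAt (l y) (l' y - l y)).sub
    (comp_effort_hasDerivAt (hM.costA.hasDerivAt heI) e')).sub
    (audit_hasDerivAt hM (a := (l' x - l x) / (x - y)) hp e e')
  refine (hcon.sub_le_of_hasDerivAt hl hl' he he' hW ?_ ?_).trans (le_of_eq ?_)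
  · rw [hpi]; simp [pi2, hα]
  · filter_upwards [eventually_affine_mem (a := (l' x - l x) / (x - y)) hp,
      eventually_effort_mem heI e'] with t h1 h2 _ hmem
    have h4 := mul_le_mul_of_nonneg_left
      (cP_alpha_segment hM hy hx hbind hmem h1.1.le) (sub_nonneg.2 h2.2.le)
    refine ((min_le_right _ _).trans (min_le_left _ _)).trans ?_
    simp only [pi2, Pi.sub_apply, Pi.add_apply, Pi.smul_apply, smul_eq_mul]
    linarith
  · ring

/-- With the binding point `x` frozen, `B t` is a smooth lower bound for `beta` along the segment.
Unlike `alpha`, it also reacts to effort and to `l y`, which produces the extra terms. -/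
theorem JointConcave.sub_le_pi3 (hM : M.StandingAssumptions) (hcon : M.JointConcave ebar y)
    (hl : l ∈ M.Lam) (hl' : l' ∈ M.Lam) (he : e ∈ Icc 0 ebar) (he' : e' ∈ Icc 0 ebar)
    (heI : e ∈ Ioo (0 : ℝ) 1) {x p : ℝ} (hy : y ∈ M.types) (hx : x ∈ M.types)
    (hp : p ∈ Ioo (0 : ℝ) 1) (hβ : M.beta l y e = p)
    (hbind : l x - l y - M.uA e = p * (x + M.τ))
    (hpi : M.piMin l y e = M.pi3 l y e) :
    M.piMin l' y e' - M.piMin l y e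
      ≤ (e' - e) * (M.cP p - dUnit M.cA e + (1 - e) * dUnit M.cP p / (x + M.τ) * dUnit M.uA e)
      + (l' y - l y)
      - (1 - e) * dUnit M.cP p / (x + M.τ) * ((l' x - l x) - (l' y - l y)) := by
  have hxτ := add_tau_pos hM hx
  set B : ℝ → ℝ := fun t => (l x - l y + t * ((l' x - l x) - (l' y - l y))
    - M.uA (e + t * (e' - e))) / (x + M.τ) with hBdef
  have hB0 : B 0 = p := by
    simp only [hBdef, zero_mul, add_zero, hbind, mul_div_cancel_right₀ _ hxτ.ne']
  have hB : HasDerivAt B (((l' x - l x) - (l' y - l y)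
      - dUnit M.uA e * (e' - e)) / (x + M.τ)) 0 :=
    ((affine_hasDerivAt (l x - l y) _).sub
      (comp_effort_hasDerivAt (uA_hasDerivAt hM heI) e')).div_const _
  have hcB : HasDerivAt (fun t => M.cP (B t)) (dUnit M.cP p * (((l' x - l x) - (l' y - l y)
      - dUnit M.uA e * (e' - e)) / (x + M.τ))) 0 :=
    HasDerivAt.comp (0 : ℝ) (h₂ := M.cP) (by rw [hB0]; exact hM.costP.hasDerivAt hp) hB
  have hW := ((affine_hasDerivAt (l y) (l' y - l y)).sub
    (comp_effort_hasDerivAt (hM.costA.hasDerivAt heI) e')).sub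
    (((effort_hasDerivAt e e').const_sub 1).mul hcB)
  refine (hcon.sub_le_of_hasDerivAt hl hl' he he' hW ?_ ?_).trans (le_of_eq ?_)
  · rw [hpi]; simp [pi3, hβ, hB0]
  · have hBe : ∀ᶠ t in nhds (0 : ℝ), B t ∈ Ioo (0 : ℝ) 1 :=
      hB.continuousAt.eventually_mem (isOpen_Ioo.mem_nhds (by rwa [hB0]))
    filter_upwards [hBe, eventually_effort_mem heI e'] with t h1 h2 _ hmem
    have h2' := Ioo_subset_Icc_self h2
    have h3 : B t ≤ M.beta ((1 - t) • l + t • l') y (e + t * (e' - e)) := by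
      have := le_beta_line hM hmem hy h2' hx
      simp only [Pi.add_apply, Pi.smul_apply, smul_eq_mul] at this
      rw [hBdef, div_le_iff₀ hxτ]
      linarith
    have h4 := mul_le_mul_of_nonneg_left
      (hM.costP.monotone h1.1.le h3 (beta_le_one hM hmem hy h2')) (sub_nonneg.2 h2.2.le)
    refine ((min_le_right _ _).trans (min_le_right _ _)).trans ?_
    simp only [pi3, Pi.sub_apply, Pi.add_apply, Pi.smul_apply, Pi.mul_apply, smul_eq_mul]
    linarith
  · simp only [hB0, zero_mul, add_zero]
    ring

end Supergradient

end TaxModel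

/-! ### Binding selections and exceptional types. -/

namespace TaxModel

variable {M : TaxModel} {m : TaxMechanism} {xhat : ℝ → ℝ}

/-- The pointwise hypotheses on a binding selection and its impacts. -/
structure IsImpactSelection (M : TaxModel) (m : TaxMechanism) (xhat : ℝ → ℝ) : Prop where
  selection : M.IsBindingSelection m xhat
  interior : ∀ y ∈ Ico M.xlo M.xhi, m.eP y ∈ Ioo (0 : ℝ) 1
  sInf_eq : sInf (xhat '' Ioo M.xlo M.xhi) = sSup (M.SuperLow m)
  superLow : ∀ x ∈ M.SuperLow m, M.directImpact m x = -1
  superHigh : ∀ x ∈ M.SuperHigh m, M.directImpact m x = M.indirectImpact m xhat x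

section Selection

theorem IsTight.eP_eq_alpha (hM : M.StandingAssumptions) (hm : M.IsTight m) {y : ℝ}
    (hy : y ∈ M.types) (hd : M.d2 m y ≤ 0) : m.eP y = M.alpha (M.loss m) y := by
  rw [hm.eP_eq hM hy,
    max_eq_left (beta_le_alpha hM (hm.loss_mem_Lam hM) hy (hm.1.1 y hy).1 hd)]

theorem IsTight.eP_eq_beta (hM : M.StandingAssumptions) (hm : M.IsTight m) {y : ℝ}
    (hy : y ∈ M.types) (hd : 0 ≤ M.d2 m y) : m.eP y = M.beta (M.loss m) y (m.eA y) := by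
  rw [hm.eP_eq hM hy,
    max_eq_right (alpha_le_beta hM (hm.loss_mem_Lam hM) hy (hm.1.1 y hy).1 hd)]

theorem d2_eq (M : TaxModel) (m : TaxMechanism) (y : ℝ) :
    M.d2 m y = M.d1 m y - M.alpha (M.loss m) y * (y + M.τ) := by
  unfold d1 d2; ring

theorem IsTight.d2_neg (hM : M.StandingAssumptions) (hm : M.IsTight m) {y : ℝ}
    (hy : y ∈ M.types) (hp : 0 < m.eP y) (hd : M.d1 m y ≤ 0) : M.d2 m y < 0 := by
  have hyτ := add_tau_pos hM hy
  have h1 := mul_nonneg (alpha_nonneg (M := M) (M.loss m) y) hyτ.le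
  have h2 := d2_eq M m y
  have h3 := hm.eP_eq_alpha hM hy (by linarith)
  have h4 := mul_pos hp hyτ
  rw [h3] at h4
  linarith

theorem bddAbove_superLow : BddAbove (M.SuperLow m) := ⟨M.xhi, fun _ h => h.1.1.2⟩

theorem bddBelow_image (hs : M.IsBindingSelection m xhat) :
    BddBelow (xhat '' Ioo M.xlo M.xhi) := by
  refine ⟨M.xlo, ?_⟩
  rintro _ ⟨z, hz, rfl⟩
  exact (hs.mapsTo hz).1.le

/-- If `xhat y = y`, the binding constraint gives `loss y = y`, so `y` is SuperLow (the case `d₂ ≥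
0` contradicts positivity of rent and audit). But `xhat` at a smaller type is below `y`, although
its infimum is the supremum of SuperLow. -/
theorem IsImpactSelection.lt_xhat (hM : M.StandingAssumptions) (hm : M.IsTight m)
    (hs : M.IsImpactSelection m xhat) {y : ℝ} (hy : y ∈ Ioo M.xlo M.xhi) : y < xhat y := by
  have hyT : y ∈ M.types := Ioo_subset_Icc_self hy
  have hp := hs.interior y (Ioo_subset_Ico_self hy)
  have hb := hs.selection.binding y hy
  refine lt_of_le_of_ne hb.1.1 fun heq => ?_
  rw [← heq] at hb
  have he := hm.eA_pos hM hyT hp.1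
  have hu := uA_pos hM ⟨he, (hm.eA_lt_one hM hyT).le⟩
  rcases le_or_gt 0 (M.d2 m y) with hd | hd
  · have h1 := hm.loss_eq_of_bindingIC_superHigh hM hyT hp hd hb
    have h2 := mul_pos hp.1 (add_tau_pos hM hyT)
    linarith
  · have h1 := hm.loss_eq_of_bindingIC hM hyT hy.2 hp (hm.eP_eq_alpha hM hyT hd.le) hb
    have hSL : y ∈ M.SuperLow m := by
      refine ⟨⟨hyT, hp⟩, ?_⟩
      unfold d1
      linarith
    have hz : (M.xlo + y) / 2 ∈ Ioo M.xlo M.xhi :=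
      ⟨by linarith [hy.1], by linarith [hy.1, hy.2]⟩
    have h2 := hs.selection.strictMonoOn hz hy (by linarith [hy.1])
    have h3 := csInf_le (bddBelow_image hs.selection) (mem_image_of_mem xhat hz)
    have h4 := le_csSup bddAbove_superLow hSL
    rw [hs.sInf_eq] at h3
    linarith

/-- The points of `High` with several binding constraints to the left of the selection. -/
def kinks (M : TaxModel) (m : TaxMechanism) (xhat : ℝ → ℝ) : Set ℝ :=
  {y ∈ Ioo M.xlo M.xhi | y ∈ M.High m ∧
    ∃ w ∈ Ioo y (xhat y), M.loss m w = y + m.eP y * (w - y)}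

/-- At a kink the loss agrees with the tangent line from `(y, y)` on the whole open interval `(w y,
xhat y)`. These intervals are disjoint, because an overlap would make the two lines equal. -/
theorem IsImpactSelection.countable_kinks (hM : M.StandingAssumptions) (hm : M.IsTight m)
    (hs : M.IsImpactSelection m xhat) : (M.kinks m xhat).Countable := by
  have hl := hm.loss_mem_Lam hM
  have hex : ∀ y : ℝ, ∃ w, y ∈ M.kinks m xhat →
      w ∈ Ioo y (xhat y) ∧ M.loss m w = y + m.eP y * (w - y) := by
    intro y
    by_cases hy : y ∈ M.kinks m xhat
    · obtain ⟨w, hw⟩ := hy.2.2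
      exact ⟨w, fun _ => hw⟩
    · exact ⟨0, fun h => absurd h hy⟩
  choose w hw using hex
  have hline : ∀ y ∈ M.kinks m xhat, ∀ z ∈ Ioo (w y) (xhat y),
      M.loss m z = y + m.eP y * (z - y) := by
    intro y hy z hz
    have hyT : y ∈ M.types := Ioo_subset_Icc_self hy.1
    have hp := hs.interior y (Ioo_subset_Ico_self hy.1)
    have hα := hm.eP_eq_alpha hM hyT hy.2.1.2.1.le
    have hb := hs.selection.binding y hy.1
    have hx := hm.loss_eq_of_bindingIC hM hyT hy.1.2 hp hα hb
    obtain ⟨hwI, hwl⟩ := hw y hy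
    have hzx : z ≤ M.xhi := hz.2.le.trans hb.1.2
    refine le_antisymm ?_ ?_
    · have := le_alpha_line hyT hl.2.2.2 (x := z) ⟨(hwI.1.trans hz.1).le, hzx⟩
      rwa [← hα] at this
    · have hpos : 0 < xhat y - w y := sub_pos.2 hwI.2
      have hcv := hl.2.1.2
      have := hcv (x := w y) ⟨hyT.1.trans hwI.1.le, hwI.2.le.trans hb.1.2⟩ (y := xhat y)
        ⟨hyT.1.trans hb.1.1, hb.1.2⟩ (a := (xhat y - z) / (xhat y - w y))
        (b := (z - w y) / (xhat y - w y)) (div_nonneg (by linarith [hz.2]) hpos.le)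
        (div_nonneg (by linarith [hz.1]) hpos.le) (by field_simp; ring)
      simp only [smul_eq_mul, hwl, hx] at this
      have hc : (xhat y - z) / (xhat y - w y) * w y + (z - w y) / (xhat y - w y) * xhat y = z := by
        field_simp; ring
      rw [hc] at this
      refine le_trans (le_of_eq ?_) this
      field_simp
      ring
  refine PairwiseDisjoint.countable_of_isOpen (s := fun y => Ioo (w y) (xhat y)) ?_
    (fun _ _ => isOpen_Ioo) (fun y hy => nonempty_Ioo.2 (hw y hy).1.2)
  intro y₁ h₁ y₂ h₂ hne
  refine Set.disjoint_left.2 fun z hz₁ hz₂ => hne ?_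
  obtain ⟨z', hz', hzu⟩ : ∃ z', z < z' ∧ z' < min (xhat y₁) (xhat y₂) :=
    exists_between (lt_min hz₁.2 hz₂.2)
  have e1 := hline y₁ h₁ z hz₁
  have e2 := hline y₂ h₂ z hz₂
  have e3 := hline y₁ h₁ z' ⟨hz₁.1.trans hz', hzu.trans_le (min_le_left _ _)⟩
  have e4 := hline y₂ h₂ z' ⟨hz₂.1.trans hz', hzu.trans_le (min_le_right _ _)⟩
  have hp : m.eP y₁ = m.eP y₂ := by
    have : (m.eP y₁ - m.eP y₂) * (z' - z) = 0 := by linarith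
    rcases mul_eq_zero.1 this with h | h <;> linarith
  -- A line of slope below one meets the diagonal only once.
  have hp1 := (hs.interior y₁ (Ioo_subset_Ico_self h₁.1)).2
  have : (1 - m.eP y₁) * (y₁ - y₂) = 0 := by rw [← hp] at e2; linarith
  rcases mul_eq_zero.1 this with h | h <;> linarith

end Selection

/-! ### Bounds on the impacts and the pointwise comparison. -/

section Pointwise

/-- Bounds on the impacts at `y`, and the supergradient inequality they provide. -/
structure ImpactBounds (M : TaxModel) (m : TaxMechanism) (xhat : ℝ → ℝ) (y : ℝ) : Prop where
  direct_ge : -1 ≤ M.directImpact m y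
  direct_le : M.directImpact m y ≤ dUnit M.cP 1 / M.τ
  indirect_nonneg : 0 ≤ M.indirectImpact m xhat y
  indirect_le : M.indirectImpact m xhat y ≤ dUnit M.cP 1 / (xhat y - y)
  cP_le : M.d1 m y < 0 ∨
    M.cP (M.alpha (M.loss m) y) ≤ dUnit M.cA (m.eA y) + dUnit M.uA (m.eA y)
  sub_le : ∀ ebar : ℝ, M.JointConcave ebar y → m.eA y ≤ ebar → ∀ l' ∈ M.Lam,
    ∀ e' ∈ Icc 0 ebar, M.piMin l' y e' - M.piMin (M.loss m) y (m.eA y)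
      ≤ (1 + M.directImpact m y) * (l' y - M.loss m y)
        - M.indirectImpact m xhat y * (l' (xhat y) - M.loss m (xhat y))

/-- When `u_A'(e_A) = 0` the quotient defining `D` is zero by default, so the identity needs a
vanishing numerator there. -/
theorem directImpact_mul {y : ℝ}
    (h : dUnit M.uA (m.eA y) = 0 → dUnit M.cA (m.eA y) = M.cP (m.eP y)) :
    M.directImpact m y * dUnit M.uA (m.eA y) = dUnit M.cA (m.eA y) - M.cP (m.eP y) := by
  unfold directImpact
  rcases eq_or_ne (dUnit M.uA (m.eA y)) 0 with h0 | h0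
  · rw [h0, mul_zero, h h0, sub_self]
  · rw [div_mul_cancel₀ _ h0]

theorem uA_deriv_ne_zero_of_directImpact {y : ℝ} (h : M.directImpact m y ≠ 0) :
    dUnit M.uA (m.eA y) ≠ 0 := by
  intro h0
  apply h
  rw [directImpact, h0, div_zero]

/-- In each region the supergradient of the active auxiliary profit, or a convex combination of two
on Low and High, has effort coefficient zero, which is the identity `D u_A' = c_A' - c_P`. The
remaining coefficients on the loss at `y` and at `xhat y` are `1 + D` and `-I`. -/
theorem IsImpactSelection.impactBounds (hM : M.StandingAssumptions) (hm : M.IsTight m)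
    (hs : M.IsImpactSelection m xhat) {y : ℝ} (hy : y ∈ Ioo M.xlo M.xhi)
    (hk : y ∉ M.kinks m xhat) : M.ImpactBounds m xhat y := by
  have hyT : y ∈ M.types := Ioo_subset_Icc_self hy
  have hl := hm.loss_mem_Lam hM
  have hp := hs.interior y (Ioo_subset_Ico_self hy)
  have hb := hs.selection.binding y hy
  have hlt := hs.lt_xhat hM hm hy
  have hxT : xhat y ∈ M.types := ⟨hyT.1.trans hlt.le, hb.1.2⟩
  have he : m.eA y ∈ Ioo (0 : ℝ) 1 := ⟨hm.eA_pos hM hyT hp.1, hm.eA_lt_one hM hyT⟩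
  have heI := Ioo_subset_Icc_self he
  have hmax := hm.isMaxOn hM hyT
  have hu0 := dUnit_uA_nonneg hM heI
  have hyτ := add_tau_pos hM hyT
  have hxτ := add_tau_pos hM hxT
  have hτ := hM.tau_pos
  have hxy : 0 < xhat y - y := sub_pos.2 hlt
  have hcP : 0 < dUnit M.cP (m.eP y) := hM.costP.deriv_pos ⟨hp.1, hp.2.le⟩
  have hcP1 : dUnit M.cP (m.eP y) ≤ dUnit M.cP 1 := hM.costP.strictMono_deriv.monotoneOn
    (Ioo_subset_Icc_self hp) (right_mem_Icc.2 zero_le_one) hp.2.le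
  have hcP10 : 0 < dUnit M.cP 1 := hcP.trans_le hcP1
  have hτ0 : 0 ≤ dUnit M.cP 1 / M.τ := (div_pos hcP10 hτ).le
  set K := (1 - m.eA y) * dUnit M.cP (m.eP y) with hK
  have hKpos : 0 < K := mul_pos (by linarith [he.2]) hcP
  have hK1 : K ≤ dUnit M.cP 1 := by nlinarith [he.1]
  have hKx0 : 0 < K / (xhat y - y) := div_pos hKpos hxy
  have hKx1 : K / (xhat y - y) ≤ dUnit M.cP 1 / (xhat y - y) :=
    div_le_div_of_nonneg_right hK1 hxy.le
  have hKτ : K / (xhat y + M.τ) ≤ dUnit M.cP 1 / M.τ :=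
    div_le_div₀ hcP10.le hK1 hτ (by linarith [types_nonneg hM hxT])
  have hIfirst : y ∈ M.SuperLow m ∪ M.Low m ∪ M.Middle m →
      M.indirectImpact m xhat y = K / (xhat y - y) := fun h => by
    unfold indirectImpact; rw [if_pos h]
  rcases lt_or_ge 0 (M.d2 m y) with hd2 | hd2
  -- SuperHigh
  · have hSH : y ∈ M.SuperHigh m := ⟨⟨hyT, hp⟩, hd2⟩
    have hd1 : 0 < M.d1 m y := by
      have := mul_nonneg (alpha_nonneg (M := M) (M.loss m) y) hyτ.le
      linarith [d2_eq M m y]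
    have hI : M.indirectImpact m xhat y = K / (xhat y + M.τ) := by
      unfold indirectImpact
      rw [if_neg, if_neg]
      · rintro ⟨-, h, -⟩; exact hd2.ne' h
      · rintro ((⟨-, h⟩ | ⟨-, h, -⟩) | ⟨-, h, -⟩) <;> linarith
    have hI0 : 0 < K / (xhat y + M.τ) := div_pos hKpos hxτ
    have hD := hs.superHigh y hSH
    rw [hI] at hD
    have hDu := directImpact_mul (M := M) (m := m) (y := y) fun h => absurd h
      (uA_deriv_ne_zero_of_directImpact (by rw [hD]; exact hI0.ne'))
    have hβ := hm.eP_eq_beta hM hyT hd2.le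
    refine ⟨by linarith, by rw [hD]; exact hKτ, by rw [hI]; exact hI0.le, ?_, Or.inr ?_, ?_⟩
    · rw [hI]
      refine (div_le_div_of_nonneg_left hKpos.le hxy ?_).trans hKx1
      linarith [types_nonneg hM hyT]
    · have h1 : M.alpha (M.loss m) y ≤ m.eP y := by
        rw [hm.eP_eq hM hyT]; exact le_max_left _ _
      have h2 := hM.costP.monotone (alpha_nonneg _ _) h1 hp.2.le
      have h3 := mul_nonneg (hD.symm ▸ hI0.le : 0 ≤ M.directImpact m y) hu0
      linarith
    · intro ebar hcon hebar l' hl' e' he'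
      have := hcon.sub_le_pi3 hM hl hl' ⟨he.1.le, hebar⟩ he' he hyT hxT hp hβ.symm
        (hm.loss_eq_of_bindingIC_superHigh hM hyT hp hd2.le hb)
        (piMin_eq_pi3 hM hl hyT heI hd2.le)
      rw [← hK, ← hD, show M.cP (m.eP y) - dUnit M.cA (m.eA y)
        + M.directImpact m y * dUnit M.uA (m.eA y) = 0 by linarith, mul_zero] at this
      rw [hI, ← hD]
      linarith
  have hα := hm.eP_eq_alpha hM hyT hd2
  have hbind := hm.loss_eq_of_bindingIC hM hyT hy.2 hp hα hb
  have hxI : xhat y ∈ Ioc y M.xhi := ⟨hlt, hb.1.2⟩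
  rcases lt_or_ge (M.d1 m y) 0 with hd1 | hd1
  -- SuperLow
  · have hSL : y ∈ M.SuperLow m := ⟨⟨hyT, hp⟩, hd1⟩
    have hI := hIfirst (Or.inl (Or.inl hSL))
    have hD := hs.superLow y hSL
    have hDu := directImpact_mul (M := M) (m := m) (y := y) fun h => absurd h
      (uA_deriv_ne_zero_of_directImpact (by rw [hD]; norm_num))
    refine ⟨hD.ge, by rw [hD]; linarith, by rw [hI]; exact hKx0.le, by rw [hI]; exact hKx1,
      Or.inl hd1, ?_⟩
    intro ebar hcon hebar l' hl' e' he'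
    have := hcon.sub_le_pi1 hM hl hl' ⟨he.1.le, hebar⟩ he' he hyT hxI hp hα.symm hbind
      (piMin_eq_pi1 hM hl hyT heI hd1.le)
    rw [hD] at hDu
    rw [← hK, show M.cP (m.eP y) - dUnit M.cA (m.eA y) - dUnit M.uA (m.eA y) = 0 by linarith,
      mul_zero] at this
    rw [hI, hD]
    linarith
  have hpi2 := piMin_eq_pi2 hM hl hyT heI hd1 hd2
  rcases hd1.eq_or_lt' with hd1 | hd1
  -- Low
  · have hd2' := hm.d2_neg hM hyT hp.1 hd1.le
    have hI := hIfirst (Or.inl (Or.inr ⟨⟨hyT, hp⟩, hd2', hd1⟩))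
    have hf1 := cP_alpha_le_of_low hM hl hyT he hmax hd1
    have hf2 := le_cP_alpha_of_low_middle hM hl hyT he hmax hd1.ge hd2'
    have hcP_le := hf1
    rw [← hα] at hf1 hf2
    have hDu := directImpact_mul (M := M) (m := m) (y := y) fun h => by linarith
    have hD0 : M.directImpact m y ≤ 0 := by
      unfold directImpact; exact div_nonpos_of_nonpos_of_nonneg (by linarith) hu0
    have hD1 : -1 ≤ M.directImpact m y := by
      rcases hu0.eq_or_lt with h0 | h0
      · unfold directImpact; rw [← h0, div_zero]; norm_num
      · unfold directImpact; rw [le_div_iff₀ h0]; linarith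
    refine ⟨hD1, hD0.trans hτ0, by rw [hI]; exact hKx0.le, by rw [hI]; exact hKx1,
      Or.inr hcP_le, ?_⟩
    intro ebar hcon hebar l' hl' e' he'
    have h1 := hcon.sub_le_pi1 hM hl hl' ⟨he.1.le, hebar⟩ he' he hyT hxI hp hα.symm hbind
      (piMin_eq_pi1 hM hl hyT heI hd1.le)
    have h2 := hcon.sub_le_pi2 hM hl hl' ⟨he.1.le, hebar⟩ he' he hyT hxI hp hα.symm hbind hpi2
    rw [← hK] at h1 h2
    -- The weights are `-D` on `pi1` and `1 + D` on `pi2`; both are nonnegative by the two one-sided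
    -- conditions.
    have h3 := mul_le_mul_of_nonneg_left h1 (neg_nonneg.2 hD0)
    have h4 := mul_le_mul_of_nonneg_left h2 (show 0 ≤ 1 + M.directImpact m y by linarith)
    have h5 : (e' - m.eA y) * (M.directImpact m y * dUnit M.uA (m.eA y))
        = (e' - m.eA y) * (dUnit M.cA (m.eA y) - M.cP (m.eP y)) := by rw [hDu]
    rw [hI]
    linarith
  have hf1 := cP_alpha_le_of_middle_high hM hl hyT he hmax hd1 hd2
  have hcP_le := hf1.trans (le_add_of_nonneg_right hu0)
  rcases hd2.lt_or_eq with hd2 | hd2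
  -- Middle
  · have hI := hIfirst (Or.inr ⟨⟨hyT, hp⟩, hd2, hd1⟩)
    have hf2 := le_cP_alpha_of_low_middle hM hl hyT he hmax hd1.le hd2
    rw [← hα] at hf1 hf2
    have hD : M.directImpact m y = 0 := by
      unfold directImpact; rw [le_antisymm hf2 hf1, sub_self, zero_div]
    refine ⟨by rw [hD]; norm_num, by rw [hD]; exact hτ0, by rw [hI]; exact hKx0.le,
      by rw [hI]; exact hKx1, Or.inr hcP_le, ?_⟩
    intro ebar hcon hebar l' hl' e' he'
    have h2 := hcon.sub_le_pi2 hM hl hl' ⟨he.1.le, hebar⟩ he' he hyT hxI hp hα.symm hbind hpi2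
    rw [← hK, le_antisymm hf2 hf1, sub_self, mul_zero] at h2
    rw [hI, hD]
    linarith
  -- High
  · have hH : y ∈ M.High m := ⟨⟨hyT, hp⟩, hd2, hd1⟩
    have hbind3 := hm.loss_eq_of_bindingIC_superHigh hM hyT hp hd2.ge hb
    -- The left condition holds with every `w` in `(y, xhat y)` in place of `xhat y`, since away
    -- from kinks the loss is strictly below the line there. Let `w` tend to `xhat y`.
    have hf2 : dUnit M.cA (m.eA y) ≤ M.cP (m.eP y) + K * dUnit M.uA (m.eA y)
        / (xhat y + M.τ) := by
      have hlim : Filter.Tendsto (fun w => M.cP (m.eP y) + K * dUnit M.uA (m.eA y) / (w + M.τ))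
          (nhdsWithin (xhat y) (Iio (xhat y)))
          (nhds (M.cP (m.eP y) + K * dUnit M.uA (m.eA y) / (xhat y + M.τ))) := by
        have : ContinuousAt (fun w => M.cP (m.eP y) + K * dUnit M.uA (m.eA y) / (w + M.τ))
            (xhat y) :=
          continuousAt_const.add (continuousAt_const.div (by fun_prop) hxτ.ne')
        exact this.tendsto.mono_left nhdsWithin_le_nhds
      refine ge_of_tendsto hlim ?_
      filter_upwards [self_mem_nhdsWithin, nhdsWithin_le_nhds (lt_mem_nhds hlt)] with w hw1 hw2
      have hwT : w ∈ M.types := ⟨hyT.1.trans (le_of_lt hw2), (le_of_lt hw1).trans hb.1.2⟩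
      have hwl := le_alpha_line hyT hl.2.2.2 (x := w) ⟨le_of_lt hw2, hwT.2⟩
      have hwne : M.loss m w ≠ y + M.alpha (M.loss m) y * (w - y) := fun h =>
        hk ⟨hy, hH, w, ⟨hw2, hw1⟩, by rw [h, hα]⟩
      have := le_cP_alpha_of_high_aux hM hl hyT he hmax hd2 (hα ▸ hp) hxT hwT hw1
        (hα ▸ hbind) (lt_of_le_of_ne hwl hwne)
      rwa [← hα] at this
    rw [← hα] at hf1
    have hDu := directImpact_mul (M := M) (m := m) (y := y) fun h => by
      rw [h, mul_zero, zero_div] at hf2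
      linarith
    have hD0 : 0 ≤ M.directImpact m y := div_nonneg (by linarith) hu0
    have hD1 : M.directImpact m y ≤ K / (xhat y + M.τ) := by
      rcases hu0.eq_or_lt with h0 | h0
      · unfold directImpact; rw [← h0, div_zero]; exact (div_pos hKpos hxτ).le
      · refine le_of_mul_le_mul_right ?_ h0
        rw [hDu, div_mul_eq_mul_div]
        linarith
    have hI : M.indirectImpact m xhat y
        = K / (xhat y - y) - (y + M.τ) / (xhat y - y) * M.directImpact m y := by
      unfold indirectImpact
      rw [if_neg, if_pos hH]
      rintro ((⟨-, h⟩ | ⟨-, h, -⟩) | ⟨-, h, -⟩) <;> linarith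
    have hratio : 0 ≤ (y + M.τ) / (xhat y - y) := div_nonneg hyτ.le hxy.le
    refine ⟨by linarith, hD1.trans hKτ, ?_, ?_, Or.inr hcP_le, ?_⟩
    · have h1 := mul_le_mul_of_nonneg_left hD1 hratio
      have h2 : (y + M.τ) / (xhat y - y) * (K / (xhat y + M.τ))
          = K / (xhat y - y) - K / (xhat y + M.τ) := by
        field_simp
        ring
      have h3 := (div_pos hKpos hxτ).le
      rw [hI]
      linarith
    · have := mul_nonneg hratio hD0
      rw [hI]
      linarith
    · intro ebar hcon hebar l' hl' e' he'
      have h2 := hcon.sub_le_pi2 hM hl hl' ⟨he.1.le, hebar⟩ he' he hyT hxI hp hα.symm hbind hpi2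
      have h3 := hcon.sub_le_pi3 hM hl hl' ⟨he.1.le, hebar⟩ he' he hyT hxT hp
        (hm.eP_eq_beta hM hyT hd2.ge).symm hbind3 (piMin_eq_pi3 hM hl hyT heI hd2.ge)
      rw [← hK] at h2 h3
      set Δ := M.piMin l' y e' - M.piMin (M.loss m) y (m.eA y)
      set D := M.directImpact m y
      have hκ : 0 < K / (xhat y + M.τ) := div_pos hKpos hxτ
      set κ := K / (xhat y + M.τ) with hκdef
      -- The weights are `1 - D / κ` on `pi2` and `D / κ` on `pi3`, multiplied through by `κ`.
      have h4 := mul_le_mul_of_nonneg_left h2 (show 0 ≤ κ - D by linarith)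
      have h5 := mul_le_mul_of_nonneg_left h3 hD0
      refine le_of_mul_le_mul_left ?_ hκ
      have h6 : (e' - m.eA y) * κ * (D * dUnit M.uA (m.eA y))
        = (e' - m.eA y) * κ * (dUnit M.cA (m.eA y) - M.cP (m.eP y)) := by rw [hDu]
      have h7 : κ * (K / (xhat y - y) - (y + M.τ) / (xhat y - y) * D)
          = (κ - D) * (K / (xhat y - y)) + D * κ := by
        rw [hκdef]
        field_simp
        ring
      rw [hI]
      have h8 : κ * ((1 + D) * (l' y - M.loss m y) - (K / (xhat y - y)
          - (y + M.τ) / (xhat y - y) * D) * (l' (xhat y) - M.loss m (xhat y)))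
          = κ * (1 + D) * (l' y - M.loss m y) - ((κ - D) * (K / (xhat y - y)) + D * κ)
            * (l' (xhat y) - M.loss m (xhat y)) := by
        rw [← h7]; ring
      rw [h8]
      linarith

end Pointwise

end TaxModel

/-! ### Measurability of efforts, profits and impacts. -/

namespace TaxModel

variable {M : TaxModel} {m : TaxMechanism} {l : ℝ → ℝ} {xhat : ℝ → ℝ}

section Measurability

theorem measurable_comp_of_continuousOn {X : Type*} [MeasurableSpace X] {f : ℝ → ℝ} {g : X → ℝ}
    (hf : ContinuousOn f (Icc 0 1)) (hg : Measurable g) (h : ∀ x, g x ∈ Icc (0 : ℝ) 1) :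
    Measurable fun x => f (g x) :=
  (continuousOn_iff_continuous_domRestrict.1 hf).measurable.comp (hg.subtype_mk (h := h))

theorem measurable_alpha (hl : l ∈ M.Lam) : Measurable fun y : M.types => M.alpha l y :=
  Antitone.measurable fun a b hab => alpha_antitoneOn hl.2.2.2 a.2 b.2 hab

theorem measurable_lam (hl : l ∈ M.Lam) : Measurable fun y : M.types => l y :=
  Monotone.measurable fun a b hab => hl.1 a.2 b.2 hab

/-- `beta l y e` depends on `y` and `e` only through `l y + uA e`, monotonically. -/
theorem exists_antitone_beta (hM : M.StandingAssumptions) (hl : l ∈ M.Lam) :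
    ∃ B : ℝ → ℝ, Antitone B ∧ ∀ y e, M.beta l y e = B (l y + M.uA e) := by
  refine ⟨fun u => max 0 (sSup ((fun x => (l x - u) / (x + M.τ)) '' M.types)), ?_, ?_⟩
  · intro u v huv
    refine max_le_max le_rfl (csSup_le (Set.Nonempty.image _ ⟨_, lo_mem hM⟩) ?_)
    rintro _ ⟨x, hx, rfl⟩
    have hxτ := add_tau_pos hM hx
    refine le_trans (div_le_div_of_nonneg_right (by linarith) hxτ.le : _ ≤ (l x - u) / (x + M.τ))
      (le_csSup ⟨|M.xhi - u| / M.τ, ?_⟩ ⟨x, hx, rfl⟩)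
    rintro _ ⟨z, hz, rfl⟩
    refine div_le_div₀ (abs_nonneg _) ?_ hM.tau_pos (by linarith [types_nonneg hM hz])
    exact le_trans (by linarith [hl.2.2.2 z hz, hz.2]) (le_abs_self _)
  · intro y e
    simp only [beta, sub_sub]

theorem measurable_beta (hM : M.StandingAssumptions) (hl : l ∈ M.Lam) {E : ℝ → ℝ}
    (hE : Measurable fun y : M.types => E y) (hE1 : ∀ y ∈ M.types, E y ∈ Icc (0 : ℝ) 1) :
    Measurable fun y : M.types => M.beta l y (E y) := by
  obtain ⟨B, hB, hBe⟩ := exists_antitone_beta hM hl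
  simp only [hBe]
  exact hB.measurable.comp ((measurable_lam hl).add
    (measurable_comp_of_continuousOn (uA_continuousOn hM) hE fun y => hE1 y y.2))

theorem measurable_piMin (hM : M.StandingAssumptions) (hl : l ∈ M.Lam) {e : ℝ}
    (he : e ∈ Icc (0 : ℝ) 1) : Measurable fun y : M.types => M.piMin l y e := by
  have hα : Measurable fun y : M.types => M.cP (M.alpha l y) :=
    measurable_comp_of_continuousOn hM.costP.continuousOn (measurable_alpha hl)
      fun y => ⟨alpha_nonneg _ _, alpha_le_one y.2 hl.2.2.2⟩
  have hβ : Measurable fun y : M.types => M.cP (M.beta l y e) :=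
    measurable_comp_of_continuousOn hM.costP.continuousOn
      (measurable_beta (E := fun _ => e) hM hl measurable_const fun _ _ => he)
      fun y => ⟨beta_nonneg _ _ _, beta_le_one hM hl y.2 he⟩
  have hy : Measurable fun y : M.types => (y : ℝ) := measurable_subtype_coe
  have hly := measurable_lam hl
  have hconst : ∀ c : ℝ, Measurable fun _ : M.types => c := fun _ => measurable_const
  exact (((hy.sub (hconst _)).sub (hconst _)).sub ((hconst (1 - e)).mul hα)).min
    (((hly.sub (hconst _)).sub ((hconst (1 - e)).mul hα)).min
      ((hly.sub (hconst _)).sub ((hconst (1 - e)).mul hβ)))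

/-- The supremum of `f` on `[0, t]` as a countable supremum. -/
noncomputable def supUpTo (f : ℝ → ℝ) (t : ℝ) : ℝ :=
  ⨆ n : ℕ, f (t * (TopologicalSpace.denseSeq (Icc (0 : ℝ) 1) n : ℝ))

theorem mul_mem_unit {s t : ℝ} (ht : t ∈ Icc (0 : ℝ) 1) (hs : s ∈ Icc (0 : ℝ) 1) :
    t * s ∈ Icc (0 : ℝ) 1 := ⟨mul_nonneg ht.1 hs.1, mul_le_one₀ ht.2 hs.1 hs.2⟩

theorem le_supUpTo {f : ℝ → ℝ} (hf : ContinuousOn f (Icc 0 1)) {t s : ℝ}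
    (ht : t ∈ Icc (0 : ℝ) 1) (hs : s ∈ Icc (0 : ℝ) 1) : f (t * s) ≤ supUpTo f t := by
  have hg : Continuous fun s : Icc (0 : ℝ) 1 => f (t * s) :=
    hf.comp_continuous (by fun_prop) fun s => mul_mem_unit ht s.2
  have hbdd : BddAbove (range fun n : ℕ =>
      f (t * (TopologicalSpace.denseSeq (Icc (0 : ℝ) 1) n : ℝ))) :=
    (isCompact_range hg).bddAbove.mono (by rintro _ ⟨n, rfl⟩; exact ⟨_, rfl⟩)
  refine (TopologicalSpace.denseRange_denseSeq (Icc (0 : ℝ) 1)).induction_on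
    (p := fun s => f (t * s) ≤ supUpTo f t) ⟨s, hs⟩ (isClosed_le hg continuous_const) fun n => ?_
  exact le_ciSup hbdd n

theorem supUpTo_le {f : ℝ → ℝ} {t c : ℝ} (h : ∀ s ∈ Icc (0 : ℝ) 1, f (t * s) ≤ c) :
    supUpTo f t ≤ c := ciSup_le fun n => h _ (TopologicalSpace.denseSeq (Icc (0 : ℝ) 1) n).2

/-- The maximum over `[0, 1]` is reached on `[0, t]` exactly when the unique maximizer lies there.
This expresses the sublevel sets of the maximizer through countable suprema. -/
theorem le_iff_supUpTo_le {f : ℝ → ℝ} (hf : ContinuousOn f (Icc 0 1)) {e t : ℝ}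
    (he : e ∈ Icc (0 : ℝ) 1) (ht : t ∈ Icc (0 : ℝ) 1) (hmax : IsMaxOn f (Icc 0 1) e)
    (huniq : ∀ e' ∈ Icc (0 : ℝ) 1, IsMaxOn f (Icc 0 1) e' → e' = e) :
    e ≤ t ↔ supUpTo f 1 ≤ supUpTo f t := by
  have h1 : (1 : ℝ) ∈ Icc (0 : ℝ) 1 := right_mem_Icc.2 zero_le_one
  have hone : supUpTo f 1 ≤ f e := supUpTo_le fun s hs => hmax (mul_mem_unit h1 hs)
  constructor
  · intro het
    refine hone.trans ?_
    rcases ht.1.eq_or_lt with h0 | h0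
    · have : e = t * 0 := by rw [← h0, zero_mul]; exact le_antisymm (h0 ▸ het) he.1
      rw [this]
      exact le_supUpTo hf ht (left_mem_Icc.2 zero_le_one)
    · have : e = t * (e / t) := by field_simp
      rw [this]
      exact le_supUpTo hf ht ⟨div_nonneg he.1 h0.le, (div_le_one h0).2 het⟩
  · intro hle
    obtain ⟨s, hs, hsmax⟩ := isCompact_Icc.exists_isMaxOn (nonempty_Icc.2 zero_le_one)
      (hf.comp (f := fun s => t * s) (by fun_prop) fun s hs => mul_mem_unit ht hs)
    have h2 : supUpTo f t ≤ f (t * s) := supUpTo_le fun r hr => hsmax hr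
    have h3 : f e ≤ supUpTo f 1 := by simpa using le_supUpTo hf h1 he
    have h4 := huniq (t * s) (mul_mem_unit ht hs) fun z hz =>
      (hmax hz).trans (h3.trans (hle.trans h2))
    rw [← h4]
    exact mul_le_of_le_one_right ht.1 hs.2

theorem measurable_supUpTo (hM : M.StandingAssumptions) (hl : l ∈ M.Lam) {t : ℝ}
    (ht : t ∈ Icc (0 : ℝ) 1) : Measurable fun y : M.types => supUpTo (M.piMin l y) t :=
  Measurable.iSup fun n => measurable_piMin hM hl
    (mul_mem_unit ht (TopologicalSpace.denseSeq (Icc (0 : ℝ) 1) n).2)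

theorem IsTight.measurable_eA (hM : M.StandingAssumptions) (hconc : M.GlobalConcavity)
    (hm : M.IsTight m) : Measurable fun y : M.types => m.eA y := by
  have hl := hm.loss_mem_Lam hM
  have hA : ∀ y : M.types, m.eA y ∈ Icc (0 : ℝ) 1 := fun y => (hm.1.1 y y.2).1
  refine measurable_of_Iic fun t => ?_
  rcases lt_or_ge t 0 with h0 | h0
  · convert MeasurableSet.empty using 1
    exact eq_empty_of_forall_notMem fun y hy => (h0.trans_le (hA y).1).not_ge hy
  rcases lt_or_ge 1 t with h1 | h1
  · convert MeasurableSet.univ using 1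
    exact eq_univ_of_forall fun y => (hA y).2.trans h1.le
  · convert measurableSet_le (measurable_supUpTo hM hl (right_mem_Icc.2 zero_le_one))
      (measurable_supUpTo hM hl ⟨h0, h1⟩) using 1
    ext y
    exact le_iff_supUpTo_le (piMin_continuousOn hM hl y.2) (hA y) ⟨h0, h1⟩
      (hm.isMaxOn hM y.2) fun e' he' hmax =>
        eq_of_isMaxOn_piMin hM hconc hl y.2 he' (hA y) hmax (hm.isMaxOn hM y.2)

theorem IsTight.measurable_profit (hM : M.StandingAssumptions) (hm : M.IsTight m) :
    Measurable fun y : M.types => M.profit m y := by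
  have hl := hm.loss_mem_Lam hM
  have h1 : (1 : ℝ) ∈ Icc (0 : ℝ) 1 := right_mem_Icc.2 zero_le_one
  have heq : (fun y : M.types => M.profit m y)
      = fun y : M.types => supUpTo (M.piMin (M.loss m) y) 1 := ?_
  · rw [heq]; exact measurable_supUpTo hM hl h1
  ext y
  rw [hm.profit_eq hM y.2]
  refine le_antisymm ?_ (supUpTo_le fun s hs => hm.isMaxOn hM y.2 (mul_mem_unit h1 hs))
  simpa using le_supUpTo (piMin_continuousOn hM hl y.2) h1 (hm.1.1 y y.2).1

theorem IsTight.measurable_eP (hM : M.StandingAssumptions) (hconc : M.GlobalConcavity)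
    (hm : M.IsTight m) : Measurable fun y : M.types => m.eP y := by
  have hl := hm.loss_mem_Lam hM
  have heq : (fun y : M.types => m.eP y) = fun y : M.types =>
      max (M.alpha (M.loss m) y) (M.beta (M.loss m) y (m.eA y)) :=
    funext fun y => hm.eP_eq hM y.2
  rw [heq]
  exact (measurable_alpha hl).max (measurable_beta hM hl (hm.measurable_eA hM hconc)
    fun y hy => (hm.1.1 y hy).1)

theorem dUnit_uA_continuousOn (hM : M.StandingAssumptions) :
    ContinuousOn (dUnit M.uA) (Icc 0 1) :=
  (continuousOn_id.mul hM.costA.differentiable_three.continuousOn).congr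
    fun _ he => dUnit_uA hM he

theorem IsTight.measurable_directImpact (hM : M.StandingAssumptions) (hconc : M.GlobalConcavity)
    (hm : M.IsTight m) : Measurable fun y : M.types => M.directImpact m y := by
  have hA := fun y : M.types => (hm.1.1 y y.2).1
  have hP := fun y : M.types => (hm.1.1 y y.2).2.1
  have hmA := hm.measurable_eA hM hconc
  have hmP := hm.measurable_eP hM hconc
  exact ((measurable_comp_of_continuousOn hM.costA.differentiable_two.continuousOn hmA hA).sub
    (measurable_comp_of_continuousOn hM.costP.continuousOn hmP hP)).div
    (measurable_comp_of_continuousOn (dUnit_uA_continuousOn hM) hmA hA)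

theorem IsImpactSelection.measurable_indirectImpact (hM : M.StandingAssumptions)
    (hconc : M.GlobalConcavity) (hm : M.IsTight m) (hs : M.IsImpactSelection m xhat) :
    Measurable fun y : Ioo M.xlo M.xhi => M.indirectImpact m xhat y := by
  have hl := hm.loss_mem_Lam hM
  set ι : Ioo M.xlo M.xhi → M.types := fun y => ⟨y, Ioo_subset_Icc_self y.2⟩ with hι
  have hιm : Measurable ι := measurable_subtype_coe.subtype_mk
  have hA := fun y : M.types => (hm.1.1 y y.2).1
  have hP := fun y : M.types => (hm.1.1 y y.2).2.1
  have hmA := hm.measurable_eA hM hconc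
  have hmP := hm.measurable_eP hM hconc
  have hK : Measurable fun y : Ioo M.xlo M.xhi => (1 - m.eA y) * dUnit M.cP (m.eP y) :=
    ((measurable_const.sub hmA).mul (measurable_comp_of_continuousOn
      hM.costP.differentiable_two.continuousOn hmP hP)).comp hιm
  have hD : Measurable fun y : Ioo M.xlo M.xhi => M.directImpact m y :=
    (hm.measurable_directImpact hM hconc).comp hιm
  have hx : Measurable fun y : Ioo M.xlo M.xhi => xhat y :=
    (continuousOn_iff_continuous_domRestrict.1 hs.selection.continuousOn).measurable
  have hy : Measurable fun y : Ioo M.xlo M.xhi => (y : ℝ) := measurable_subtype_coe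
  have hu : Measurable fun y : Ioo M.xlo M.xhi => M.uA (m.eA y) :=
    (measurable_comp_of_continuousOn (uA_continuousOn hM) hmA hA).comp hιm
  have hlm : Measurable fun y : Ioo M.xlo M.xhi => M.loss m y := (measurable_lam hl).comp hιm
  have hα : Measurable fun y : Ioo M.xlo M.xhi => M.alpha (M.loss m) y :=
    (measurable_alpha hl).comp hιm
  have hd1 : Measurable fun y : Ioo M.xlo M.xhi => M.d1 m y :=
    (hy.sub hu).sub hlm
  have hd2 : Measurable fun y : Ioo M.xlo M.xhi => M.d2 m y :=
    ((((measurable_const.sub hα).mul hy).sub hu).sub hlm).sub (hα.mul measurable_const)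
  have hint : ∀ y : Ioo M.xlo M.xhi, (y : ℝ) ∈ M.interiorAudit m := fun y =>
    ⟨Ioo_subset_Icc_self y.2, hs.interior y (Ioo_subset_Ico_self y.2)⟩
  have h1 : MeasurableSet {y : Ioo M.xlo M.xhi |
      (y : ℝ) ∈ M.SuperLow m ∪ M.Low m ∪ M.Middle m} := by
    have : {y : Ioo M.xlo M.xhi | (y : ℝ) ∈ M.SuperLow m ∪ M.Low m ∪ M.Middle m}
        = {y : Ioo M.xlo M.xhi | M.d1 m y < 0} ∪ {y | M.d2 m y < 0} ∩ {y | M.d1 m y = 0}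
          ∪ {y | M.d2 m y < 0} ∩ {y | 0 < M.d1 m y} := by
      ext y
      have := hint y
      simp only [SuperLow, Low, Middle, mem_union, mem_inter_iff, mem_ofPred_eq, this, true_and]
    rw [this]
    exact ((measurableSet_lt hd1 measurable_const).union
      ((measurableSet_lt hd2 measurable_const).inter
        (measurableSet_eq_fun hd1 measurable_const))).union
      ((measurableSet_lt hd2 measurable_const).inter (measurableSet_lt measurable_const hd1))
  have h2 : MeasurableSet {y : Ioo M.xlo M.xhi | (y : ℝ) ∈ M.High m} := by
    have : {y : Ioo M.xlo M.xhi | (y : ℝ) ∈ M.High m}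
        = {y : Ioo M.xlo M.xhi | M.d2 m y = 0} ∩ {y | 0 < M.d1 m y} := by
      ext y
      have := hint y
      simp only [High, mem_inter_iff, mem_ofPred_eq, this, true_and]
    rw [this]
    exact (measurableSet_eq_fun hd2 measurable_const).inter
      (measurableSet_lt measurable_const hd1)
  unfold indirectImpact
  refine Measurable.ite h1 (hK.div (hx.sub hy)) (Measurable.ite h2
    ((hK.div (hx.sub hy)).sub (((hy.add measurable_const).div (hx.sub hy)).mul hD))
    (hK.div (hx.add measurable_const)))

end Measurability

end TaxModel

/-! ### From balance on intervals to a push-forward of measures. -/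

section Pushforward

variable {μ : Measure ℝ} {a b : ℝ} {g f h : ℝ → ℝ}

theorem preimage_Icc_inter_of_strictMonoOn (hg : StrictMonoOn g (Ioo a b)) {c d : ℝ}
    (hc : c ∈ Ioo a b) (hd : d ∈ Ioo a b) : g ⁻¹' Icc (g c) (g d) ∩ Ioo a b = Icc c d := by
  ext y
  constructor
  · rintro ⟨⟨h1, h2⟩, hy⟩
    exact ⟨(hg.le_iff_le hc hy).1 h1, (hg.le_iff_le hy hd).1 h2⟩
  · intro hy
    have hy' : y ∈ Ioo a b := ⟨hc.1.trans_le hy.1, hy.2.trans_lt hd.2⟩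
    exact ⟨⟨(hg.le_iff_le hc hy').2 hy.1, (hg.le_iff_le hy' hd).2 hy.2⟩, hy'⟩

theorem lintegral_ofReal_Icc_eq (hf0 : ∀ᵐ y ∂μ, y ∈ Ioo a b → 0 ≤ f y) {c d : ℝ}
    (hac : a < c) (hdb : d < b) (hfi : IntegrableOn f (Icc c d) μ) :
    ∫⁻ y in Icc c d, ENNReal.ofReal (f y) ∂μ = ENNReal.ofReal (∫ y in Icc c d, f y ∂μ) := by
  refine (ofReal_integral_eq_lintegral_ofReal hfi ?_).symm
  filter_upwards [ae_restrict_of_ae hf0, ae_restrict_mem measurableSet_Icc] with y h1 h2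
  exact h1 ⟨hac.trans_le h2.1, h2.2.trans_lt hdb⟩

/-- If the density `h` on the range of an increasing `g` balances the density `f` on intervals, it
is the density of the push-forward under `g`. -/
theorem map_withDensity_eq (hab : a < b) (hgmaps : MapsTo g (Ioo a b) (Ioo a b))
    (hgc : ContinuousOn g (Ioo a b)) (hg : StrictMonoOn g (Ioo a b))
    (hgle : ∀ y ∈ Ioo a b, y ≤ g y)
    (hfi : ∀ c d, a < c → d < b → IntegrableOn f (Icc c d) μ)
    (hf0 : ∀ᵐ y ∂μ, y ∈ Ioo a b → 0 ≤ f y)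
    (hh : Integrable h μ) (hh0 : ∀ᵐ y ∂μ, y ∈ Ioo a b → 0 ≤ h y)
    (heq : ∀ c d, a < c → c ≤ d → d < b →
      ∫ y in Icc c d, f y ∂μ = ∫ y in Icc (g c) (g d), h y ∂μ) :
    ((μ.restrict (Ioo a b)).withDensity fun y => ENNReal.ofReal (f y)).map g
      = (μ.restrict (Ioo (sInf (g '' Ioo a b)) b)).withDensity
          fun y => ENNReal.ofReal (h y) := by
  set x₀ := sInf (g '' Ioo a b) with hx₀
  set ν := (μ.restrict (Ioo a b)).withDensity fun y => ENNReal.ofReal (f y) with hν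
  set ν₂ := (μ.restrict (Ioo x₀ b)).withDensity fun y => ENNReal.ofReal (h y) with hν₂
  have hne : (Ioo a b).Nonempty := nonempty_Ioo.2 hab
  have hbdd : BddBelow (g '' Ioo a b) := ⟨a, by rintro _ ⟨z, hz, rfl⟩; exact (hgmaps hz).1.le⟩
  have hlow : ∀ c ∈ Ioo a b, x₀ < g c := by
    intro c hc
    have hz : (a + c) / 2 ∈ Ioo a b := ⟨by linarith [hc.1], by linarith [hc.1, hc.2]⟩
    exact (csInf_le hbdd (mem_image_of_mem g hz)).trans_lt (hg hz hc (by linarith [hc.1]))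
  have hgm : AEMeasurable g ν :=
    (hgc.aemeasurable measurableSet_Ioo).mono_ac (withDensity_absolutelyContinuous _ _)
  have hfin2 : IsFiniteMeasure ν₂ := by
    refine isFiniteMeasure_withDensity_ofReal ?_
    exact (hh.mono_measure Measure.restrict_le_self).hasFiniteIntegral
  have hmapIcc : ∀ c ∈ Ioo a b, ∀ d ∈ Ioo a b, c ≤ d →
      (ν.map g) (Icc (g c) (g d)) = ν₂ (Icc (g c) (g d)) := by
    intro c hc d hd hcd
    have hνI : ν (Ioo a b)ᶜ = 0 := by
      refine withDensity_absolutelyContinuous _ _ ?_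
      rw [Measure.restrict_apply measurableSet_Ioo.compl, compl_inter_self, measure_empty]
    have hsub : Icc c d ⊆ Ioo a b := fun y hy => ⟨hc.1.trans_le hy.1, hy.2.trans_lt hd.2⟩
    have hsub2 : Icc (g c) (g d) ⊆ Ioo x₀ b := fun y hy =>
      ⟨(hlow c hc).trans_le hy.1, hy.2.trans_lt (hgmaps hd).2⟩
    have h1 : (ν.map g) (Icc (g c) (g d)) = ν (Icc c d) := by
      rw [Measure.map_apply_of_aemeasurable hgm measurableSet_Icc,
        ← preimage_Icc_inter_of_strictMonoOn hg hc hd]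
      exact (measure_inter_conull hνI).symm
    rw [h1, hν, hν₂, withDensity_apply _ measurableSet_Icc, withDensity_apply _ measurableSet_Icc,
      Measure.restrict_restrict measurableSet_Icc, Measure.restrict_restrict measurableSet_Icc,
      inter_eq_left.2 hsub, inter_eq_left.2 hsub2,
      lintegral_ofReal_Icc_eq hf0 hc.1 hd.2 (hfi c d hc.1 hd.2),
      lintegral_ofReal_Icc_eq hh0 (hgmaps hc).1 (hgmaps hd).2 hh.integrableOn,
      heq c d hc.1 hcd hd.2]
  obtain ⟨mid, hmid⟩ := hne
  -- Finiteness of `ν` is not yet known near the endpoints, so the two measures are compared on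
  -- compact pieces exhausting the interval.
  obtain ⟨u, -, hu, hulim⟩ := exists_seq_strictAnti_tendsto' hmid.1
  obtain ⟨v, -, hv, hvlim⟩ := exists_seq_strictMono_tendsto' hmid.2
  have huI : ∀ n, u n ∈ Ioo a b := fun n => ⟨(hu n).1, (hu n).2.trans hmid.2⟩
  have hvI : ∀ n, v n ∈ Ioo a b := fun n => ⟨hmid.1.trans (hv n).1, (hv n).2⟩
  have hres : ∀ n : ℕ × ℕ, (ν.map g).restrict (Icc (g (u n.1)) (g (v n.2)))
      = ν₂.restrict (Icc (g (u n.1)) (g (v n.2))) := by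
    rintro ⟨i, j⟩
    have hij : u i ≤ v j := ((hu i).2.trans (hv j).1).le
    -- Comparison on half-lines needs one measure known to be finite; here it is the restriction of
    -- `ν₂`.
    refine (Measure.ext_of_Iic _ _ fun t => ?_).symm
    rw [Measure.restrict_apply measurableSet_Iic, Measure.restrict_apply measurableSet_Iic]
    rcases lt_or_ge t (g (u i)) with h1 | h1
    · have : Iic t ∩ Icc (g (u i)) (g (v j)) = ∅ :=
        eq_empty_of_forall_notMem fun y hy => (hy.1.trans_lt h1).not_ge hy.2.1
      rw [this, measure_empty, measure_empty]
    rcases lt_or_ge (g (v j)) t with h2 | h2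
    · rw [inter_eq_right.2 fun y hy => hy.2.trans h2.le]
      exact (hmapIcc _ (huI i) _ (hvI j) hij).symm
    · have hsub : Icc (u i) (v j) ⊆ Ioo a b := fun y hy =>
        ⟨(huI i).1.trans_le hy.1, hy.2.trans_lt (hvI j).2⟩
      obtain ⟨s, hs, rfl⟩ := intermediate_value_Icc hij (hgc.mono hsub) ⟨h1, h2⟩
      have : Iic (g s) ∩ Icc (g (u i)) (g (v j)) = Icc (g (u i)) (g s) := by
        ext y
        exact ⟨fun hy => ⟨hy.2.1, hy.1⟩, fun hy => ⟨hy.2, hy.1, hy.2.trans h2⟩⟩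
      rw [this]
      exact (hmapIcc _ (huI i) _ (hsub hs) hs.1).symm
  have hunion := Measure.restrict_iUnion_congr.2 hres
  set A := ⋃ n : ℕ × ℕ, Icc (g (u n.1)) (g (v n.2)) with hA
  have hAm : MeasurableSet A := MeasurableSet.iUnion fun _ => measurableSet_Icc
  have hA1 : ∀ y ∈ Ioo a b, g y ∈ A := by
    intro y hy
    obtain ⟨i, hi⟩ := (hulim.eventually (gt_mem_nhds hy.1)).exists
    obtain ⟨j, hj⟩ := (hvlim.eventually (lt_mem_nhds hy.2)).exists
    exact mem_iUnion.2 ⟨(i, j), hg.monotoneOn (huI i) hy hi.le, hg.monotoneOn hy (hvI j) hj.le⟩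
  have hA2 : ∀ z ∈ Ioo x₀ b, z ∈ A := by
    intro z hz
    obtain ⟨_, ⟨y, hy, rfl⟩, hyz⟩ := exists_lt_of_csInf_lt
      (Set.Nonempty.image g ⟨mid, hmid⟩) hz.1
    obtain ⟨i, hi⟩ := (hulim.eventually (gt_mem_nhds hy.1)).exists
    obtain ⟨j, hj⟩ := (hvlim.eventually (lt_mem_nhds hz.2)).exists
    -- Because `g` is at least the identity, its values reach up to `b`.
    exact mem_iUnion.2 ⟨(i, j), (hg.monotoneOn (huI i) hy hi.le).trans hyz.le,
      hj.le.trans (hgle _ (hvI j))⟩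
  have hν1 : (ν.map g).restrict A = ν.map g := by
    refine Measure.restrict_eq_self_of_ae_mem ((ae_map_iff hgm hAm).2 ?_)
    refine (withDensity_absolutelyContinuous _ _).ae_le ?_
    filter_upwards [ae_restrict_mem measurableSet_Ioo] with y hy using hA1 y hy
  have hν2 : ν₂.restrict A = ν₂ := by
    refine Measure.restrict_eq_self_of_ae_mem ((withDensity_absolutelyContinuous _ _).ae_le ?_)
    filter_upwards [ae_restrict_mem measurableSet_Ioo] with y hy using hA2 y hy
  rw [← hν1, hunion, hν2]

theorem integral_comp_eq_of_balanced (hab : a < b) (hgmaps : MapsTo g (Ioo a b) (Ioo a b))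
    (hgc : ContinuousOn g (Ioo a b)) (hg : StrictMonoOn g (Ioo a b))
    (hgle : ∀ y ∈ Ioo a b, y ≤ g y)
    (hfm : AEMeasurable f (μ.restrict (Ioo a b)))
    (hf0 : ∀ᵐ y ∂μ, y ∈ Ioo a b → 0 ≤ f y)
    (hfi : ∀ c d, a < c → d < b → IntegrableOn f (Icc c d) μ)
    (hh : Integrable h μ) (hh0 : ∀ᵐ y ∂μ, y ∈ Ioo a b → 0 ≤ h y)
    (heq : ∀ c d, a < c → c ≤ d → d < b →
      ∫ y in Icc c d, f y ∂μ = ∫ y in Icc (g c) (g d), h y ∂μ)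
    {φ : ℝ → ℝ} (hφ : Continuous φ) {C : ℝ} (hC : ∀ x, |φ x| ≤ C) :
    IntegrableOn (fun y => f y * φ (g y)) (Ioo a b) μ ∧
      ∫ y in Ioo a b, f y * φ (g y) ∂μ
        = ∫ y in Ioo (sInf (g '' Ioo a b)) b, h y * φ y ∂μ := by
  have hmap := map_withDensity_eq hab hgmaps hgc hg hgle hfi hf0 hh hh0 heq
  have hgm : AEMeasurable g (μ.restrict (Ioo a b)) := hgc.aemeasurable measurableSet_Ioo
  have hf0' : 0 ≤ᵐ[μ.restrict (Ioo a b)] f := (ae_restrict_iff' measurableSet_Ioo).2 hf0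
  have ha : a ≤ sInf (g '' Ioo a b) := by
    refine le_csInf ((nonempty_Ioo.2 hab).image g) ?_
    rintro _ ⟨z, hz, rfl⟩
    exact (hgmaps hz).1.le
  have hh0' : 0 ≤ᵐ[μ.restrict (Ioo (sInf (g '' Ioo a b)) b)] h := by
    refine (ae_restrict_iff' measurableSet_Ioo).2 ?_
    filter_upwards [hh0] with y h1 h2 using h1 ⟨ha.trans_lt h2.1, h2.2⟩
  have hhr : Integrable h (μ.restrict (Ioo (sInf (g '' Ioo a b)) b)) :=
    hh.mono_measure Measure.restrict_le_self
  -- Only local integrability of `f` is assumed; equal total masses transfer integrability from `h`.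
  have hfint : IntegrableOn f (Ioo a b) μ := by
    refine ⟨hfm.aestronglyMeasurable, ?_⟩
    rw [hasFiniteIntegral_iff_ofReal hf0']
    have h1 := congrArg (fun ν : Measure ℝ => ν univ) hmap
    rw [Measure.map_apply_of_aemeasurable (hgm.mono_ac (withDensity_absolutelyContinuous _ _))
      MeasurableSet.univ, preimage_univ, withDensity_apply _ MeasurableSet.univ,
      withDensity_apply _ MeasurableSet.univ, Measure.restrict_univ, Measure.restrict_univ] at h1
    rw [h1, ← hasFiniteIntegral_iff_ofReal hh0']
    exact hhr.hasFiniteIntegral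
  have hφg : AEStronglyMeasurable (fun y => φ (g y)) (μ.restrict (Ioo a b)) :=
    (hφ.measurable.comp_aemeasurable hgm).aestronglyMeasurable
  refine ⟨Integrable.mul_bdd (c := C) hfint hφg (.of_forall fun y => hC _), ?_⟩
  have h2 := congrArg (fun ν : Measure ℝ => ∫ y, φ y ∂ν) hmap
  rw [integral_map (hgm.mono_ac (withDensity_absolutelyContinuous _ _))
      hφ.aestronglyMeasurable,
    integral_withDensity_eq_integral_toReal_smul₀ hfm.ennreal_ofReal
      (.of_forall fun _ => ENNReal.ofReal_lt_top),
    integral_withDensity_eq_integral_toReal_smul₀ hhr.aemeasurable.ennreal_ofReal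
      (.of_forall fun _ => ENNReal.ofReal_lt_top)] at h2
  have h3 : ∫ y in Ioo a b, f y * φ (g y) ∂μ
      = ∫ y in Ioo a b, (ENNReal.ofReal (f y)).toReal • φ (g y) ∂μ := by
    refine integral_congr_ae ?_
    filter_upwards [hf0'] with y hy
    rw [ENNReal.toReal_ofReal hy, smul_eq_mul]
  have h4 : ∫ y in Ioo (sInf (g '' Ioo a b)) b, h y * φ y ∂μ
      = ∫ y in Ioo (sInf (g '' Ioo a b)) b, (ENNReal.ofReal (h y)).toReal • φ y ∂μ := by
    refine integral_congr_ae ?_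
    filter_upwards [hh0'] with y hy
    rw [ENNReal.toReal_ofReal hy, smul_eq_mul]
  rw [h3, h4, h2]

end Pushforward

/-! ### Integrating the pointwise comparison. -/

namespace TaxModel

variable {M : TaxModel} {m m' : TaxMechanism} {l' : ℝ → ℝ} {xhat : ℝ → ℝ}

section Optimality

theorem ae_mem_Ioo (hac : M.F ≪ volume)
    (hfull : M.F.support = M.types) : ∀ᵐ y ∂M.F, y ∈ Ioo M.xlo M.xhi := by
  have h1 : ∀ᵐ y ∂M.F, y ∈ M.types := by
    rw [← hfull]; exact Measure.support_mem_ae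
  have h2 : ∀ a : ℝ, ∀ᵐ y ∂M.F, y ≠ a := fun a => hac.ae_le (Measure.ae_ne volume a)
  filter_upwards [h1, h2 M.xlo, h2 M.xhi] with y hy hlo hhi
  exact ⟨lt_of_le_of_ne hy.1 (Ne.symm hlo), lt_of_le_of_ne hy.2 hhi⟩

theorem abs_profit_le (hM : M.StandingAssumptions) (hm : M.IsMechanism m) {y : ℝ}
    (hy : y ∈ M.types) : |M.profit m y| ≤ 2 * (M.xhi + M.τ) + M.cA 1 + M.cP 1 := by
  obtain ⟨hA, hP, hrA, hrP, hN⟩ := hm.1 y hy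
  have hu := (uA_nonneg hM hA).trans (uA_le_evidenceRent hM hm hy)
  have hP1 : 0 ≤ 1 - m.eP y := by linarith [hP.2]
  have hA1 : 0 ≤ 1 - m.eA y := by linarith [hA.2]
  have hR0 : 0 ≤ RNA m y := add_nonneg (mul_nonneg hP.1 hrP.1) (mul_nonneg hP1 hN.1)
  have hR1 : RNA m y ≤ y + M.τ := by
    have h1 := mul_le_mul_of_nonneg_left hrP.2 hP.1
    have h2 := mul_le_mul_of_nonneg_left hN.2 hP1
    unfold RNA
    linarith
  have hcA0 := hM.costA.nonneg hA
  have hcP0 := hM.costP.nonneg hP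
  have hcA1 := hM.costA.monotone hA.1 hA.2 le_rfl
  have hcP1 := hM.costP.monotone hP.1 hP.2 le_rfl
  have hprod0 := mul_nonneg hA1 hcP0
  have hprod1 := mul_le_of_le_one_left hcP0 (show 1 - m.eA y ≤ 1 by linarith [hA.1])
  have hρ : M.evidenceRent m y ≤ y + M.τ := by
    have h1 := mul_nonneg hA.1 hR0
    have h2 := mul_le_of_le_one_left hrA.1 hA.2
    unfold evidenceRent
    linarith [hrA.2]
  have hy0 := types_nonneg hM hy
  have hyhi := hy.2
  have hτ := hM.tau_pos
  unfold profit
  rw [abs_le]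
  constructor <;> linarith

theorem integrable_profit (hM : M.StandingAssumptions) (hm : M.IsMechanism m)
    (hae : ∀ᵐ y ∂M.F, y ∈ Ioo M.xlo M.xhi) (hmeas : AEMeasurable (M.profit m) M.F) :
    Integrable (M.profit m) M.F := by
  have := hM.isProbability
  refine Integrable.of_bound hmeas.aestronglyMeasurable
    (2 * (M.xhi + M.τ) + M.cA 1 + M.cP 1) ?_
  filter_upwards [hae] with y hy
  rw [Real.norm_eq_abs]
  exact abs_profit_le hM hm (Ioo_subset_Icc_self hy)

theorem aemeasurable_of_measurable_types (hae : ∀ᵐ y ∂M.F, y ∈ Ioo M.xlo M.xhi) {f : ℝ → ℝ}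
    (hf : Measurable fun y : M.types => f y) : AEMeasurable f M.F := by
  rw [← Measure.restrict_eq_self_of_ae_mem (s := M.types)
    (hae.mono fun y hy => Ioo_subset_Icc_self hy)]
  exact aemeasurable_restrict_of_measurable_subtype measurableSet_Icc hf

/-- `SuperLow` contains every type below its supremum. -/
theorem IsImpactSelection.mem_superLow (hM : M.StandingAssumptions) (hm : M.IsTight m)
    (hs : M.IsImpactSelection m xhat) {y : ℝ} (hy : y ∈ Ioo M.xlo M.xhi)
    (hb : M.ImpactBounds m xhat y) (hlt : y < sInf (xhat '' Ioo M.xlo M.xhi)) :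
    y ∈ M.SuperLow m := by
  rw [hs.sInf_eq] at hlt
  rcases (M.SuperLow m).eq_empty_or_nonempty with hemp | hne
  -- The default supremum `0` of the empty set is harmless, since types are nonnegative.
  · rw [hemp, Real.sSup_empty] at hlt
    linarith [hy.1, hM.xlo_nonneg]
  obtain ⟨z, hz, hyz⟩ := exists_lt_of_lt_csSup hne hlt
  have hyT : y ∈ M.types := Ioo_subset_Icc_self hy
  have hzT : z ∈ M.types := hz.1.1
  have hl := hm.loss_mem_Lam hM
  have hp := hs.interior y (Ioo_subset_Ico_self hy)
  -- If `y` were not SuperLow, then `u_A(e_A(y)) ≤ y - loss y ≤ z - loss z < u_A(e_A(z))`, so effort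
  -- is strictly higher at `z`. But `c_A' + u_A'` is strictly increasing, at least `c_P(alpha)` at
  -- `y` and equal to it at `z`, while `alpha` is decreasing in the type.
  by_contra hnot
  have hd1 : 0 ≤ M.d1 m y := by
    by_contra! h
    exact hnot ⟨⟨hyT, hp⟩, h⟩
  have hcP := hb.cP_le.resolve_left hd1.not_gt
  have hzd := hz.2
  have hyA := (hm.1.1 y hyT).1
  have hzA := (hm.1.1 z hzT).1
  have hD := hs.superLow z hz
  have hDu := directImpact_mul (M := M) (m := m) (y := z) fun h => absurd h
    (uA_deriv_ne_zero_of_directImpact (by rw [hD]; norm_num))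
  rw [hD, hm.eP_eq_alpha hM hzT (hm.d2_neg hM hzT hz.1.2.1 hzd.le).le] at hDu
  have hα := hM.costP.monotone (alpha_nonneg (M.loss m) z)
    (alpha_antitoneOn hl.2.2.2 hyT hzT hyz.le) (alpha_le_one hyT hl.2.2.2)
  -- the loss gap `x - loss x` is increasing
  have hgap : y - M.loss m y ≤ z - M.loss m z := by
    have hpos : 0 < z - M.xlo := by linarith [hy.1]
    have hcv := hl.2.1.2
    have h := hcv (lo_mem hM) hzT (a := (z - y) / (z - M.xlo)) (b := (y - M.xlo) / (z - M.xlo))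
      (div_nonneg (by linarith) hpos.le) (div_nonneg (by linarith [hy.1]) hpos.le)
      (by field_simp; ring)
    simp only [smul_eq_mul, hl.2.2.1] at h
    have hc : (z - y) / (z - M.xlo) * M.xlo + (y - M.xlo) / (z - M.xlo) * z = y := by
      field_simp; ring
    rw [hc] at h
    have hr0 : 0 ≤ (z - y) / (z - M.xlo) := div_nonneg (by linarith) hpos.le
    have hz0 := mul_nonneg hr0 (sub_nonneg.2 (hl.2.2.2 z hzT))
    have hsum : (z - y) / (z - M.xlo) + (y - M.xlo) / (z - M.xlo) = 1 := by
      field_simp; ring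
    have h2 : (y - M.xlo) / (z - M.xlo) = 1 - (z - y) / (z - M.xlo) := by linarith
    rw [h2] at h hc
    linarith
  unfold d1 at hd1 hzd
  have hlt' : m.eA y < m.eA z := by
    by_contra! hle
    linarith [uA_monotoneOn hM hzA hyA hle]
  have := marginal_strictMono hM hyA hzA hlt'
  simp only at this
  linarith

theorem IsImpactSelection.optimal (hM : M.StandingAssumptions) (hac : M.F ≪ volume)
    (hfull : M.F.support = M.types) (hconc : M.GlobalConcavity) (hm : M.IsTight m)
    (hs : M.IsImpactSelection m xhat)
    (hbal : ∀ a b : ℝ, M.xlo < a → a ≤ b → b < M.xhi →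
      ∫ y in Icc a b, M.indirectImpact m xhat y ∂M.F
        = ∫ y in Icc (xhat a) (xhat b), (1 + M.directImpact m y) ∂M.F) :
    M.IsOptimal m := by
  have hprob := hM.isProbability
  have hae := ae_mem_Ioo hac hfull
  have hl := hm.loss_mem_Lam hM
  have hmeas : AEMeasurable (M.profit m) M.F :=
    aemeasurable_of_measurable_types hae (hm.measurable_profit hM)
  refine ⟨hm.1, hmeas, fun m' hm' hmeas' => ?_⟩
  have hf' : ∀ x ∈ M.types, M.loss m' x ≤ x := fun x hx => loss_le_self hM hm'.1 hx
  have hull := isLamHull_hull hM hf'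
  set l' := M.hull (M.loss m') with hl'def
  set x₀ := sInf (xhat '' Ioo M.xlo M.xhi) with hx₀
  have hkinks : ∀ᵐ y ∂M.F, y ∉ M.kinks m xhat :=
    hac.ae_le ((hs.countable_kinks hM hm).ae_notMem volume)
  have hbounds : ∀ᵐ y ∂M.F, y ∈ Ioo M.xlo M.xhi ∧ M.ImpactBounds m xhat y := by
    filter_upwards [hae, hkinks] with y hy hk using ⟨hy, hs.impactBounds hM hm hy hk⟩
  -- a continuous extension of the difference of the loss functions
  set φ : ℝ → ℝ := fun x => l' (projIcc M.xlo M.xhi hM.xlo_lt_xhi.le x)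
    - M.loss m (projIcc M.xlo M.xhi hM.xlo_lt_xhi.le x) with hφdef
  have hφc : Continuous φ :=
    ((continuousOn_iff_continuous_domRestrict.1 (Lam.continuousOn hM hull.mem)).comp
      continuous_projIcc).sub
    ((continuousOn_iff_continuous_domRestrict.1 (Lam.continuousOn hM hl)).comp
      continuous_projIcc)
  have hφeq : ∀ x ∈ M.types, φ x = l' x - M.loss m x := fun x hx => by
    simp only [hφdef, projIcc_of_mem hM.xlo_lt_xhi.le hx]
  have hφC : ∀ x, |φ x| ≤ M.xhi := by
    intro x
    have hx : (projIcc M.xlo M.xhi hM.xlo_lt_xhi.le x : ℝ) ∈ M.types := Subtype.coe_prop _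
    have h1 := hull.mem.2.2.2 _ hx
    have h2 := hl.2.2.2 _ hx
    have h3 := Lam.lo_le hM hull.mem hx
    have h4 := Lam.lo_le hM hl hx
    have h5 := hM.xlo_nonneg
    have h6 := hx.2
    rw [abs_le]
    constructor <;> linarith
  have hDint : Integrable (M.directImpact m) M.F := by
    refine Integrable.of_bound (aemeasurable_of_measurable_types hae
      (hm.measurable_directImpact hM hconc)).aestronglyMeasurable
      (1 + dUnit M.cP 1 / M.τ) ?_
    filter_upwards [hbounds] with y hy
    have h0 : 0 ≤ dUnit M.cP 1 / M.τ :=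
      div_nonneg (hM.costP.deriv_nonneg (right_mem_Icc.2 zero_le_one)) hM.tau_pos.le
    rw [Real.norm_eq_abs, abs_le]
    constructor <;> linarith [hy.2.direct_ge, hy.2.direct_le]
  have hhint : Integrable (fun y => 1 + M.directImpact m y) M.F := (integrable_const 1).add hDint
  have hIm : AEMeasurable (M.indirectImpact m xhat) (M.F.restrict (Ioo M.xlo M.xhi)) :=
    aemeasurable_restrict_of_measurable_subtype measurableSet_Ioo
      (hs.measurable_indirectImpact hM hconc hm)
  have hIint : ∀ c d, M.xlo < c → d < M.xhi →
      IntegrableOn (M.indirectImpact m xhat) (Icc c d) M.F := by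
    intro c d hc hd
    rcases lt_or_ge d c with hdc | hcd
    · rw [Icc_eq_empty hdc.not_ge]; exact integrableOn_empty
    have hsub : Icc c d ⊆ Ioo M.xlo M.xhi := fun y hy => ⟨hc.trans_le hy.1, hy.2.trans_lt hd⟩
    -- The bound on `I` may blow up where `xhat y - y` tends to zero, but on a compact subinterval
    -- this gap has a positive minimum.
    obtain ⟨z, hz, hzmin⟩ := isCompact_Icc.exists_isMinOn (nonempty_Icc.2 hcd)
      ((hs.selection.continuousOn.mono hsub).sub continuousOn_id)
    have hzpos : 0 < xhat z - z := sub_pos.2 (hs.lt_xhat hM hm (hsub hz))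
    refine IntegrableOn.of_bound (measure_lt_top _ _)
      (hIm.mono_measure (Measure.restrict_mono hsub le_rfl)).aestronglyMeasurable
      (dUnit M.cP 1 / (xhat z - z)) ?_
    filter_upwards [ae_restrict_of_ae hbounds, ae_restrict_mem measurableSet_Icc] with y hy hycd
    rw [Real.norm_eq_abs, abs_of_nonneg hy.2.indirect_nonneg]
    exact hy.2.indirect_le.trans (div_le_div_of_nonneg_left
      (hM.costP.deriv_nonneg (right_mem_Icc.2 zero_le_one)) hzpos (hzmin hycd))
  obtain ⟨hIφint, hIφ⟩ := integral_comp_eq_of_balanced (h := fun y => 1 + M.directImpact m y)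
    hM.xlo_lt_xhi hs.selection.mapsTo hs.selection.continuousOn hs.selection.strictMonoOn
    (fun y hy => (hs.selection.binding y hy).1.1) hIm
    (hbounds.mono fun y hy _ => hy.2.indirect_nonneg) hIint hhint
    (hbounds.mono fun y hy _ => by linarith [hy.2.direct_ge]) hbal hφc hφC
  rw [← hx₀] at hIφ
  have hJ : M.F.restrict (Ioo M.xlo M.xhi) = M.F := Measure.restrict_eq_self_of_ae_mem hae
  rw [IntegrableOn, hJ] at hIφint
  rw [hJ] at hIφ
  have hDφint : Integrable (fun y => (1 + M.directImpact m y) * φ y) M.F :=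
    hhint.mul_bdd (c := M.xhi) hφc.aestronglyMeasurable (.of_forall hφC)
  have hx₀lo : M.xlo ≤ x₀ := by
    refine le_csInf ((nonempty_Ioo.2 hM.xlo_lt_xhi).image xhat) ?_
    rintro _ ⟨z, hz, rfl⟩
    exact (hs.selection.mapsTo hz).1.le
  -- Types below `x₀` are SuperLow, so their density `1 + D` vanishes.
  have hDφ : ∫ y in Ioo x₀ M.xhi, (1 + M.directImpact m y) * φ y ∂M.F
      = ∫ y, (1 + M.directImpact m y) * φ y ∂M.F := by
    refine setIntegral_eq_integral_of_ae_compl_eq_zero ?_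
    filter_upwards [hbounds, hac.ae_le (Measure.ae_ne volume x₀)] with y hy hne hnot
    have hlt : y < x₀ := by
      by_contra! hle
      exact hnot ⟨lt_of_le_of_ne hle (Ne.symm hne), hy.1.2⟩
    rw [hs.superLow y (hs.mem_superLow hM hm hy.1 hy.2 hlt)]
    ring
  obtain ⟨ebar, -, hbar, hcc⟩ := hconc
  have hpoint : ∀ᵐ y ∂M.F, M.profit m' y - M.profit m y
      ≤ (1 + M.directImpact m y) * φ y - M.indirectImpact m xhat y * φ (xhat y) := by
    filter_upwards [hbounds] with y hy
    have hyT : y ∈ M.types := Ioo_subset_Icc_self hy.1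
    -- The rival's effort is replaced by a maximizer for `l'`, because the bound `ebar`, and with it
    -- concavity, is available only for maximizers.
    obtain ⟨e', he', hmax'⟩ := exists_piMin_isMaxOn hM hull.mem hyT
    have h1 := (hull.profit_le hM hm' hyT).trans (hmax' (hm'.1 y hyT).1)
    have h2 := hy.2.sub_le ebar (hcc y hyT)
      (hbar y hyT _ hl _ (hm.1.1 y hyT).1 (hm.isMaxOn hM hyT)) l' hull.mem e'
      ⟨he'.1, hbar y hyT _ hull.mem _ he' hmax'⟩
    rw [hφeq y hyT, hφeq (xhat y) (Ioo_subset_Icc_self (hs.selection.mapsTo hy.1)),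
      hm.profit_eq hM hyT]
    linarith
  have hint := integrable_profit hM hm.1 hae hmeas
  have hint' := integrable_profit hM hm' hae hmeas'
  have hfin := integral_mono_ae (hint'.sub hint) (hDφint.sub hIφint) hpoint
  have e1 := integral_sub hint' hint
  have e2 := integral_sub hDφint hIφint
  simp only [Pi.sub_apply] at hfin
  linarith

end Optimality

end TaxModel
theorem mainTheorem8 (M : TaxModel) (hM : M.StandingAssumptions)
    (hac : M.F ≪ volume) (hfull : M.F.support = M.types)
    (hconc : M.GlobalConcavity)
    (m : TaxMechanism) (htight : M.IsTight m)
    (hint : ∀ y ∈ Ico M.xlo M.xhi, m.eP y ∈ Ioo (0 : ℝ) 1)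
    (hsel : ∃ xhat : ℝ → ℝ, M.IsBindingSelection m xhat ∧
      sInf (xhat '' Ioo M.xlo M.xhi) = sSup (M.SuperLow m) ∧
      (∀ a b : ℝ, M.xlo < a → a ≤ b → b < M.xhi →
        ∫ y in Icc a b, M.indirectImpact m xhat y ∂M.F
          = ∫ y in Icc (xhat a) (xhat b), (1 + M.directImpact m y) ∂M.F) ∧
      (∀ x ∈ M.SuperLow m, M.directImpact m x = -1) ∧
      (∀ x ∈ M.Middle m, M.directImpact m x = 0) ∧
      (∀ x ∈ M.SuperHigh m, M.directImpact m x = M.indirectImpact m xhat x)) :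
    M.IsOptimal m := by
  obtain ⟨xhat, hxhat, hinf, hbal, hSL, -, hSH⟩ := hsel
  exact TaxModel.IsImpactSelection.optimal hM hac hfull hconc htight
    ⟨hxhat, hint, hinf, hSL, hSH⟩ hbal
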